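/- **Setting.** Let $d\ge 2$, let $\Omega\subset\mathbb R^d$ be a bounded open set (no smoothness of the boundary is needed), and let $$g_F(s)=a_0s^{\alpha_0}+a_1s^{\alpha_1}+\dots+a_Ns^{\alpha_N}\quad(s\ge 0),$$ where $N\ge1$, $0=\alpha_0<\alpha_1<\dots<\alpha_N$ are real, $a_i\ge 0$, $a_0>0$, $a_N>0$. For $\xi\ge0$ put $K(\xi)=1/g_F(s(\xi))$, where $s(\xi)$ is the unique $s\ge 0$ with $s\,g_F(s)=\xi$. Put $$a=\frac{\alpha_N}{\alpha_N+1},\qquad \beta=2-a,\qquad \lambda=\frac{2-a}{1-a},$$ and assume the degree condition $a\le \frac{4}{d+2}$. Write $(\cdot,\cdot)$ and $\|\cdot\|$ for the inner product and norm of $L^2(\Omega)$ (scalar or vector), $\|u\|_1=(\|u\|^2+\|\nabla u\|^2)^{1/2}$ for the norm of $H^1(\Omega)$, and $\|\cdot\|_{0,\beta}$ for the norm of $L^\beta(\Omega)$; $H^1_0(\Omega)$ is the closure of $C_c^\infty(\Omega)$ in $H^1(\Omega)$. Let $\phi\in C([0,\infty);H^1(\Omega))\cap C^1((0,\infty);H^1(\Omega))$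 (an extension of the boundary data to $\Omega$), let $f:(0,\infty)\to L^2(\Omega)$ be such that $\tilde f=f-\phi_t\in C^1((0,\infty);L^2(\Omega))$, and let $\rho^0\in H^1(\Omega)$. Let $\tilde\rho$ be a solution of the variational problem, in the following sense: $\tilde\rho:[0,\infty)\to H^1_0(\Omega)$, $$\tilde\rho\in C([0,\infty);H^1(\Omega))\cap C^1((0,\infty);H^1(\Omega))\cap C^2((0,\infty);L^2(\Omega)),$$ and, with $\rho=\tilde\rho+\phi$, $$(\tilde\rho_t,w)+(K(|\nabla\rho|)\nabla\rho,\nabla w)=(\tilde f,w)\quad\text{for all } w\in H^1_0(\Omega),\ t>0,\qquad \tilde\rho(0)=\tilde\rho^0:=\rho^0-\phi^0,\quad \phi^0=\phi(0).$$ (The time regularity holds in particular if $\tilde\rho$ is $C^2$ on $\bar\Omega\times(0,\infty)$ and $\tilde\rho,\nabla\tilde\rho$ are continuous on $\bar\Omega\times[0,\infty)$.) Put $$g(t)=\|\tilde f(t)\|^{\lambda}+\|\phi(t)\|_1^2\qquad(t>0).$$ Below, $Env\,g$ denotes an arbitrary continuous nondecreasing function on $(0,\infty)$ with $Env\,g\ge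 g$; each estimate containing $Env\,g$ is asserted for every such function. Limits superior and integrals take values in $[0,\infty]$. Put $$\mathcal A(t)=1+\|\rho^0\|_1^2+\|\phi^0\|^2+\int_0^te^{-\frac12(t-s)}\Big(\|\phi_t(s)\|_1^2+(Env\,g(s))^{\frac2\beta}\Big)ds,$$ and, for $0<t_0<1$, $$\begin{aligned}\mathcal B(t)={}&t_0^{-1}e^{-\frac14(t-t_0)}\Big\{1+\|\rho^0\|_1^2+\|\phi^0\|^2+\int_0^{t_0}\Big(\|\phi_t(s)\|_1^2+(Env\,g(s))^{\frac2\beta}\Big)ds\Big\}\\&+\int_0^te^{-\frac14(t-s)}\Big(1+\|\tilde\rho^0\|^2+\|\phi_t(s)\|_1^2+\|\tilde f_t(s)\|^2+(Env\,g(s))^{\frac2\beta}\Big)ds.\end{aligned}$$ **Theorem 4.6.** There is a constant $C>0$ depending only on $g_F$, $d$ and $\Omega$ (and not on $\phi,f,\rho^0,\tilde\rho$, $Env\,g$, $t_0$, $t$) such that the following hold. (i) For all $t>0$, $$\|\tilde\rho(t)\|\le C\Big(1+\|\rho^0\|+(Env\,g(t))^{\frac1\beta}\Big);$$ $$\limsup_{t\to\infty}\|\tilde\rho(t)\|^2\le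 C\Big(1+\limsup_{t\to\infty}g(t)\Big)^{\frac2\beta};$$ and if $\limsup_{t\to\infty}\|\tilde f(t)\|=\limsup_{t\to\infty}\|\phi(t)\|_1=0$, then $\limsup_{t\to\infty}\|\tilde\rho(t)\|^2=0$. (ii) For all $t>0$, $$\|\nabla\rho(t)\|_{0,\beta}^\beta\le C\mathcal A(t);$$ $$\limsup_{t\to\infty}\|\nabla\rho(t)\|_{0,\beta}^\beta\le C\Big(1+\limsup_{t\to\infty}\|\phi_t(t)\|_1^2+\big(\limsup_{t\to\infty}g(t)\big)^{\frac2\beta}\Big);$$ and if $\limsup_{t\to\infty}\|\tilde f(t)\|=\limsup_{t\to\infty}\|\phi(t)\|_1=\limsup_{t\to\infty}\|\phi_t(t)\|_1=0$, then $\limsup_{t\to\infty}\|\nabla\rho(t)\|_{0,\beta}=0$. (iii) For all $0<t_0<1$ and all $t\ge t_0$, $$\|\tilde\rho_t(t)\|^2\le C\mathcal B(t);$$ moreover $$\limsup_{t\to\infty}\|\tilde\rho_t(t)\|^2\le C\Big(1+\big(\limsup_{t\to\infty}g(t)\big)^{\frac2\beta}+\limsup_{t\to\infty}\|\phi_t(t)\|_1^2+\limsup_{t\to\infty}\|\tilde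 f_t(t)\|^2\Big).$$ (iv) For all $t\ge1$, $$\|\nabla\rho(t)\|_{0,\beta}^\beta\le C\Big(1+\|\tilde\rho^0\|^2+(Env\,g(t))^{\frac2\beta}+\int_{t-1}^t\|\phi_t(s)\|_1^2\,ds\Big),$$ $$\|\tilde\rho_t(t)\|^2\le C\Big(1+\|\tilde\rho^0\|^2+(Env\,g(t))^{\frac2\beta}+\int_{t-1}^t\big(\|\phi_t(s)\|_1^2+\|\tilde f_t(s)\|^2\big)ds\Big).$$ -/

import Mathlib

open MeasureTheory Filter Set
open scoped ENNReal NNReal Topology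

noncomputable section

namespace Forchheimer

/-! ### The generalized polynomial `g`, the exponents and the function `K` -/

/-- A generalized polynomial `g(s) = a₀ s ^ α₀ + ⋯ + a_N s ^ α_N` with `N ≥ 1`,
`0 = α₀ < α₁ < ⋯ < α_N`, coefficients `aᵢ ≥ 0`, `a₀ > 0` and `a_N > 0`. -/
structure GenPoly where
  N : ℕ
  one_le_N : 1 ≤ N
  α : Fin (N + 1) → ℝ
  coeff : Fin (N + 1) → ℝ
  α_zero : α 0 = 0
  α_strictMono : StrictMono α
  coeff_nonneg : ∀ i, 0 ≤ coeff i
  coeff_zero_pos : 0 < coeff 0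
  coeff_last_pos : 0 < coeff (Fin.last N)

namespace GenPoly

variable (P : GenPoly)

/-- The value `g(s)`, meant for `s ≥ 0`. -/
def eval (s : ℝ) : ℝ := ∑ i, P.coeff i * s ^ P.α i

/-- `deg g = α_N`. -/
def deg : ℝ := P.α (Fin.last P.N)

/-- `a = deg g / (deg g + 1)`. -/
def a : ℝ := P.deg / (P.deg + 1)

/-- `β = 2 - a`. -/
def β : ℝ := 2 - P.a

/-- `λ = (2 - a) / (1 - a)`. -/
def lam : ℝ := (2 - P.a) / (1 - P.a)

/-- `s(ξ)`: for `ξ ≥ 0`, the unique `s ≥ 0` with `s g(s) = ξ`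
(see `existsUnique_root` and `root_spec`). -/
def root (ξ : ℝ) : ℝ := sInf {s : ℝ | 0 ≤ s ∧ s * P.eval s = ξ}

/-- `K(ξ) = 1 / g(s(ξ))`, meant for `ξ ≥ 0`. -/
def K (ξ : ℝ) : ℝ := 1 / P.eval (P.root ξ)

theorem α_nonneg (i : Fin (P.N + 1)) : 0 ≤ P.α i := by
  rw [← P.α_zero]
  exact P.α_strictMono.monotone (Fin.zero_le i)

theorem coeff_zero_le_eval {s : ℝ} (hs : 0 ≤ s) : P.coeff 0 ≤ P.eval s := by
  have h : P.coeff 0 * s ^ P.α 0 ≤ P.eval s :=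
    Finset.single_le_sum (f := fun i => P.coeff i * s ^ P.α i)
      (fun i _ => mul_nonneg (P.coeff_nonneg i) (Real.rpow_nonneg hs _)) (Finset.mem_univ 0)
  simpa [P.α_zero] using h

theorem eval_mono {s t : ℝ} (hs : 0 ≤ s) (hst : s ≤ t) : P.eval s ≤ P.eval t :=
  Finset.sum_le_sum fun i _ =>
    mul_le_mul_of_nonneg_left (Real.rpow_le_rpow hs hst (P.α_nonneg i)) (P.coeff_nonneg i)

theorem continuous_eval : Continuous P.eval := by
  unfold eval
  exact continuous_finsetSum _ fun i _ =>
    continuous_const.mul (Real.continuous_rpow_const (P.α_nonneg i))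

theorem existsUnique_root {ξ : ℝ} (hξ : 0 ≤ ξ) : ∃! s : ℝ, 0 ≤ s ∧ s * P.eval s = ξ := by
  have h0 := P.coeff_zero_pos
  have hR : 0 ≤ ξ / P.coeff 0 := div_nonneg hξ h0.le
  have hc : ContinuousOn (fun s => s * P.eval s) (Icc 0 (ξ / P.coeff 0)) :=
    (continuous_id.mul P.continuous_eval).continuousOn
  have hmem : ξ ∈ Icc ((0 : ℝ) * P.eval 0) (ξ / P.coeff 0 * P.eval (ξ / P.coeff 0)) := by
    refine ⟨by simpa using hξ, ?_⟩
    calc ξ = ξ / P.coeff 0 * P.coeff 0 := by field_simp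
      _ ≤ _ := mul_le_mul_of_nonneg_left (P.coeff_zero_le_eval hR) hR
  obtain ⟨s, hs, hsξ⟩ := intermediate_value_Icc hR hc hmem
  have key : ∀ u v : ℝ, 0 ≤ u → u < v → u * P.eval u < v * P.eval v := fun u v hu huv =>
    mul_lt_mul huv (P.eval_mono hu huv.le) (h0.trans_le (P.coeff_zero_le_eval hu))
      (hu.trans huv.le)
  refine ⟨s, ⟨hs.1, hsξ⟩, ?_⟩
  rintro t ⟨ht, htξ⟩
  simp only at hsξ
  rcases lt_trichotomy t s with h | h | h
  · have := key t s ht h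
    linarith
  · exact h
  · have := key s t hs.1 h
    linarith

theorem root_spec {ξ : ℝ} (hξ : 0 ≤ ξ) :
    0 ≤ P.root ξ ∧ P.root ξ * P.eval (P.root ξ) = ξ := by
  obtain ⟨s, hs, hu⟩ := P.existsUnique_root hξ
  have hset : {s : ℝ | 0 ≤ s ∧ s * P.eval s = ξ} = {s} := by
    ext t
    exact ⟨fun ht => hu t ht, fun ht => by rw [mem_singleton_iff.1 ht]; exact hs⟩
  have : P.root ξ = s := by rw [root, hset, csInf_singleton]
  rw [this]
  exact hs

end GenPoly

/-! ### The Sobolev spaces `H¹(Ω)` and `H¹₀(Ω)` -/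

/-- `L²(Ω)`. -/
abbrev L2 {d : ℕ} (Ω : Set (EuclideanSpace ℝ (Fin d))) : Type :=
  Lp ℝ 2 (volume.restrict Ω)

/-- `(L²(Ω))ᵈ`, with the norm `(∫_Ω |v|²)^(1/2)`. -/
abbrev L2Vec {d : ℕ} (Ω : Set (EuclideanSpace ℝ (Fin d))) : Type :=
  Lp (EuclideanSpace ℝ (Fin d)) 2 (volume.restrict Ω)

/-- `η ∈ C_c^∞(Ω)`. -/
structure IsTestFunction {d : ℕ} (Ω : Set (EuclideanSpace ℝ (Fin d)))
    (η : EuclideanSpace ℝ (Fin d) → ℝ) : Prop where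
  contDiff : ContDiff ℝ (⊤ : ℕ∞) η
  hasCompactSupport : HasCompactSupport η
  tsupport_subset : tsupport η ⊆ Ω

/-- `G` is the weak gradient of `u` in `Ω`: `∫_Ω u ∂ᵢη = - ∫_Ω Gᵢ η` for all `η ∈ C_c^∞(Ω)`
and all `i`. -/
def IsWeakGradient {d : ℕ} (Ω : Set (EuclideanSpace ℝ (Fin d))) (u : L2 Ω) (G : L2Vec Ω) : Prop :=
  ∀ η : EuclideanSpace ℝ (Fin d) → ℝ, IsTestFunction Ω η → ∀ i : Fin d,
    ∫ x in Ω, u x * fderiv ℝ η x (EuclideanSpace.single i 1) = - ∫ x in Ω, G x i * η x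

section

variable {d : ℕ} {Ω : Set (EuclideanSpace ℝ (Fin d))}

theorem IsTestFunction.integrable_left {η : EuclideanSpace ℝ (Fin d) → ℝ}
    (hη : IsTestFunction Ω η) (u : L2 Ω) (i : Fin d) :
    IntegrableOn (fun x => u x * fderiv ℝ η x (EuclideanSpace.single i 1)) Ω := by
  have hcont : Continuous (fun x => fderiv ℝ η x (EuclideanSpace.single i 1)) :=
    (hη.contDiff.continuous_fderiv (by simp)).clm_apply continuous_const
  have hsupp : HasCompactSupport (fun x => fderiv ℝ η x (EuclideanSpace.single i 1)) :=
    hη.hasCompactSupport.fderiv_apply (𝕜 := ℝ) _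
  exact (Lp.memLp u).integrable_mul
    ((hcont.memLp_of_hasCompactSupport (p := 2) (μ := volume) hsupp).restrict Ω)

theorem IsTestFunction.integrable_right {η : EuclideanSpace ℝ (Fin d) → ℝ}
    (hη : IsTestFunction Ω η) (G : L2Vec Ω) (i : Fin d) :
    IntegrableOn (fun x => G x i * η x) Ω := by
  have hG : MemLp (fun x => G x i) 2 (volume.restrict Ω) :=
    (EuclideanSpace.proj i : EuclideanSpace ℝ (Fin d) →L[ℝ] ℝ).comp_memLp' (Lp.memLp G)
  exact hG.integrable_mul
    ((hη.contDiff.continuous.memLp_of_hasCompactSupport (p := 2) (μ := volume)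
      hη.hasCompactSupport).restrict Ω)

theorem IsWeakGradient.add {u v : L2 Ω} {G H : L2Vec Ω} (hu : IsWeakGradient Ω u G)
    (hv : IsWeakGradient Ω v H) : IsWeakGradient Ω (u + v) (G + H) := by
  intro η hη i
  have h1 : ∫ x in Ω, (u + v : L2 Ω) x * fderiv ℝ η x (EuclideanSpace.single i 1) =
      ∫ x in Ω, (u x * fderiv ℝ η x (EuclideanSpace.single i 1) +
        v x * fderiv ℝ η x (EuclideanSpace.single i 1)) := by
    refine integral_congr_ae ?_
    filter_upwards [Lp.coeFn_add u v] with x hx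
    rw [hx, Pi.add_apply, add_mul]
  have h2 : ∫ x in Ω, (G + H : L2Vec Ω) x i * η x =
      ∫ x in Ω, (G x i * η x + H x i * η x) := by
    refine integral_congr_ae ?_
    filter_upwards [Lp.coeFn_add G H] with x hx
    rw [hx, Pi.add_apply, PiLp.add_apply, add_mul]
  rw [h1, h2, integral_add (hη.integrable_left u i) (hη.integrable_left v i),
    integral_add (hη.integrable_right G i) (hη.integrable_right H i), hu η hη i, hv η hη i]
  ring

theorem IsWeakGradient.smul (c : ℝ) {u : L2 Ω} {G : L2Vec Ω} (hu : IsWeakGradient Ω u G) :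
    IsWeakGradient Ω (c • u) (c • G) := by
  intro η hη i
  have h1 : ∫ x in Ω, (c • u : L2 Ω) x * fderiv ℝ η x (EuclideanSpace.single i 1) =
      ∫ x in Ω, c * (u x * fderiv ℝ η x (EuclideanSpace.single i 1)) := by
    refine integral_congr_ae ?_
    filter_upwards [Lp.coeFn_smul c u] with x hx
    rw [hx, Pi.smul_apply, smul_eq_mul, mul_assoc]
  have h2 : ∫ x in Ω, (c • G : L2Vec Ω) x i * η x = ∫ x in Ω, c * (G x i * η x) := by
    refine integral_congr_ae ?_
    filter_upwards [Lp.coeFn_smul c G] with x hx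
    rw [hx, Pi.smul_apply, PiLp.smul_apply, smul_eq_mul, mul_assoc]
  rw [h1, h2, integral_const_mul, integral_const_mul, hu η hη i]
  ring

theorem IsWeakGradient.zero : IsWeakGradient Ω (0 : L2 Ω) (0 : L2Vec Ω) := by
  intro η _ i
  have h1 : ∫ x in Ω, (0 : L2 Ω) x * fderiv ℝ η x (EuclideanSpace.single i 1) =
      ∫ _x in Ω, (0 : ℝ) := by
    refine integral_congr_ae ?_
    filter_upwards [Lp.coeFn_zero ℝ 2 (volume.restrict Ω)] with x hx
    rw [hx, Pi.zero_apply, zero_mul]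
  have h2 : ∫ x in Ω, (0 : L2Vec Ω) x i * η x = ∫ _x in Ω, (0 : ℝ) := by
    refine integral_congr_ae ?_
    filter_upwards [Lp.coeFn_zero (EuclideanSpace ℝ (Fin d)) 2 (volume.restrict Ω)] with x hx
    rw [hx, Pi.zero_apply, PiLp.zero_apply, zero_mul]
  rw [h1, h2]
  simp

end

/-- `H¹(Ω)`, realized as the space of the pairs `(u, ∇u)` in `L²(Ω) × (L²(Ω))ᵈ`; its norm is
`‖u‖₁ = (‖u‖² + ‖∇u‖²)^(1/2)`. -/
def H1 {d : ℕ} (Ω : Set (EuclideanSpace ℝ (Fin d))) :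
    Submodule ℝ (WithLp 2 (L2 Ω × L2Vec Ω)) where
  carrier := {p | IsWeakGradient Ω p.fst p.snd}
  add_mem' hp hq := hp.add hq
  zero_mem' := IsWeakGradient.zero
  smul_mem' c _ hp := hp.smul c

/-- The element of `L²(Ω)` underlying an element of `H¹(Ω)`. -/
def toL2 {d : ℕ} {Ω : Set (EuclideanSpace ℝ (Fin d))} (u : H1 Ω) : L2 Ω := u.1.fst

/-- The weak gradient of an element of `H¹(Ω)`. -/
def grad {d : ℕ} {Ω : Set (EuclideanSpace ℝ (Fin d))} (u : H1 Ω) : L2Vec Ω := u.1.snd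

theorem norm_sq_H1 {d : ℕ} {Ω : Set (EuclideanSpace ℝ (Fin d))} (u : H1 Ω) :
    ‖u‖ ^ 2 = ‖toL2 u‖ ^ 2 + ‖grad u‖ ^ 2 :=
  WithLp.prod_norm_sq_eq_of_L2 u.1

/-- The elements of `H¹(Ω)` that are (represented by) functions in `C_c^∞(Ω)`. -/
def testH1 {d : ℕ} (Ω : Set (EuclideanSpace ℝ (Fin d))) : Set (H1 Ω) :=
  {u | ∃ η : EuclideanSpace ℝ (Fin d) → ℝ, IsTestFunction Ω η ∧ toL2 u =ᵐ[volume.restrict Ω] η}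

/-- `H¹₀(Ω)`: the closure of `C_c^∞(Ω)` in `H¹(Ω)`. -/
def H01 {d : ℕ} (Ω : Set (EuclideanSpace ℝ (Fin d))) : Set (H1 Ω) := closure (testH1 Ω)

/-- `‖∇u‖_{0,q}`, the `L^q(Ω)` norm of the gradient. -/
def gradNorm {d : ℕ} {Ω : Set (EuclideanSpace ℝ (Fin d))} (q : ℝ) (u : H1 Ω) : ℝ≥0∞ :=
  eLpNorm (grad u) (ENNReal.ofReal q) (volume.restrict Ω)

/-! ### The variational problem -/

/-- `F` is a continuous, increasing envelope of `f` on `I`. -/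
structure IsEnvelope (I : Set ℝ) (f F : ℝ → ℝ) : Prop where
  continuousOn : ContinuousOn F I
  monotoneOn : MonotoneOn F I
  le : ∀ t ∈ I, f t ≤ F t

section

variable {d : ℕ} {Ω : Set (EuclideanSpace ℝ (Fin d))}

/-- `f̃ = f - φ_t`. -/
def fTilde (φ : ℝ → H1 Ω) (f : ℝ → L2 Ω) (t : ℝ) : L2 Ω := f t - toL2 (deriv φ t)

/-- Regularity in time of the extension `φ` of the boundary data and of the source:
`φ ∈ C([0,∞); H¹(Ω)) ∩ C¹((0,∞); H¹(Ω))` and `f̃ ∈ C¹((0,∞); L²(Ω))`. -/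
structure IsRegularData (φ : ℝ → H1 Ω) (f : ℝ → L2 Ω) : Prop where
  continuousOn_φ : ContinuousOn φ (Ici 0)
  contDiffOn_φ : ContDiffOn ℝ 1 φ (Ioi 0)
  contDiffOn_fTilde : ContDiffOn ℝ 1 (fTilde φ f) (Ioi 0)

/-- `ρ̃ : [0,∞) → H¹₀(Ω)` solves, with `ρ = ρ̃ + φ`,
`(ρ̃_t, w) + (K(|∇ρ|)∇ρ, ∇w) = (f̃, w)` for all `w ∈ H¹₀(Ω)` and `t > 0`, and `ρ(0) = ρ⁰`.
The regularity required is `ρ̃ ∈ C([0,∞); H¹(Ω)) ∩ C¹((0,∞); H¹(Ω)) ∩ C²((0,∞); L²(Ω))`; it holds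
as soon as `ρ̃` is `C²` on `closure Ω × (0,∞)` and `ρ̃`, `∇ρ̃` are continuous on
`closure Ω × [0,∞)`. -/
structure IsWeakSolution (P : GenPoly) (φ : ℝ → H1 Ω) (f : ℝ → L2 Ω) (ρ₀ : H1 Ω)
    (ρt : ℝ → H1 Ω) : Prop where
  mem_H01 : ∀ t, 0 ≤ t → ρt t ∈ H01 Ω
  continuousOn : ContinuousOn ρt (Ici 0)
  contDiffOn_H1 : ContDiffOn ℝ 1 ρt (Ioi 0)
  contDiffOn_L2 : ContDiffOn ℝ 2 (fun t => toL2 (ρt t)) (Ioi 0)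
  initial : ρt 0 = ρ₀ - φ 0
  variational : ∀ t, 0 < t → ∀ w ∈ H01 Ω,
    inner ℝ (toL2 (deriv ρt t)) (toL2 w)
      + ∫ x in Ω, P.K ‖grad (ρt t + φ t) x‖ * inner ℝ (grad (ρt t + φ t) x) (grad w x)
    = inner ℝ (fTilde φ f t) (toL2 w)

/-- `g(t) = ‖f̃(t)‖^λ + ‖φ(t)‖₁²`. -/
def gFun (P : GenPoly) (φ : ℝ → H1 Ω) (f : ℝ → L2 Ω) (t : ℝ) : ℝ :=
  ‖fTilde φ f t‖ ^ P.lam + ‖φ t‖ ^ 2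

/-- `𝒜(t) = 1 + ‖ρ⁰‖₁² + ‖φ⁰‖² + ∫₀ᵗ e^{-(t-s)/2} (‖φ_t(s)‖₁² + G(s)^{2/β}) ds`,
where `G` stands for `Env g`; the integral may be infinite. -/
def boundA (P : GenPoly) (φ : ℝ → H1 Ω) (ρ₀ : H1 Ω) (G : ℝ → ℝ) (t : ℝ) : ℝ≥0∞ :=
  ENNReal.ofReal (1 + ‖ρ₀‖ ^ 2 + ‖toL2 (φ 0)‖ ^ 2)
    + ∫⁻ s in Ioo 0 t,
        ENNReal.ofReal (Real.exp (-(1 / 2) * (t - s)) * (‖deriv φ s‖ ^ 2 + G s ^ (2 / P.β)))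

/-- `ℬ(t) = t₀⁻¹ e^{-(t-t₀)/4} {1 + ‖ρ⁰‖₁² + ‖φ⁰‖² + ∫₀^{t₀} (‖φ_t(s)‖₁² + G(s)^{2/β}) ds}`
`+ ∫₀ᵗ e^{-(t-s)/4} (1 + ‖ρ̃⁰‖² + ‖φ_t(s)‖₁² + ‖f̃_t(s)‖² + G(s)^{2/β}) ds`,
where `G` stands for `Env g` and `ρ̃⁰ = ρ⁰ - φ⁰`; the integrals may be infinite. -/
def boundB (P : GenPoly) (φ : ℝ → H1 Ω) (f : ℝ → L2 Ω) (ρ₀ : H1 Ω) (G : ℝ → ℝ) (t₀ t : ℝ) :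
    ℝ≥0∞ :=
  ENNReal.ofReal (t₀⁻¹ * Real.exp (-(1 / 4) * (t - t₀)))
      * (ENNReal.ofReal (1 + ‖ρ₀‖ ^ 2 + ‖toL2 (φ 0)‖ ^ 2)
        + ∫⁻ s in Ioo 0 t₀, ENNReal.ofReal (‖deriv φ s‖ ^ 2 + G s ^ (2 / P.β)))
    + ∫⁻ s in Ioo 0 t,
        ENNReal.ofReal (Real.exp (-(1 / 4) * (t - s))
          * (1 + ‖toL2 (ρ₀ - φ 0)‖ ^ 2 + ‖deriv φ s‖ ^ 2 + ‖deriv (fTilde φ f) s‖ ^ 2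
            + G s ^ (2 / P.β)))

end

end Forchheimer

end

noncomputable section

namespace Forchheimer

/-! ### Exponents, the inverse function `root`, and monotonicity of `K`. -/

namespace GenPoly

variable (P : GenPoly)

/-! Write F(y) = K(|y|) y. This field inverts v ↦ g_F(|v|) v, which is strongly monotone with
constant a₀ because g_F is nondecreasing and at least a₀. Hence F is cocoercive (`flux_cocoercive`):
increments of F are controlled by the monotone pairing, and K never has to be differentiated. F is
also the gradient of a convex radial potential Φ with Φ(r) ≤ K(r) r² ≤ 2 Φ(r). So the energy E = ∫
Φ(|∇ρ|) is comparable to the dissipation J = ∫ K(|∇ρ|) |∇ρ|², and it satisfies the chain rule along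
differentiable curves (`hasDerivAt_energy`).

Coercivity is r^β ≤ δ + C K(r) r² for every δ > 0 (`exists_rpow_le`). The degree condition says β ≥
2d/(d+2), so on H¹₀(Ω) the L² norm is controlled by the L^β norm of the gradient (`exists_sobolev`).

Three differential inequalities carry the theorem. Testing with ρ̃, then using coercivity, Sobolev
and Young with the conjugate exponents β, λ, gives (‖ρ̃‖²)' ≤ c(-(‖ρ̃‖²)^{β/2} + δ + D g)
(`exists_deriv_massSq_le`). Testing with ρ̃ and ρ̃_t gives E' + ‖ρ̃_t‖²/4 + E/2 ≤ C(‖ρ̃‖² + data)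
(`deriv_energyAt_le`). Subtracting the equation at two times and testing with the increment of ρ̃
gives (‖ρ̃_t‖²)' ≤ ‖ρ̃_t‖² + ‖f̃_t‖² + C(‖ρ̃‖² + data) (`deriv_rateSq_le`).

The first yields the bounds of ρ̃ by comparison. The second yields those of ∇ρ by Gronwall. Adding
eight times the second to the third absorbs ‖ρ̃_t‖² and yields those of ρ̃_t. Weights in time that
vanish at the left end of an interval remove initial values that are not controlled, both near t = 0
and on windows inside [t-1, t]. That δ is arbitrary gives the two statements with limit zero. -/

theorem deg_pos : 0 < P.deg := by
  have h : (0 : Fin (P.N + 1)) < Fin.last P.N :=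
    Fin.pos_iff_ne_zero.2 (fun h => by
      have := congrArg Fin.val h
      have := P.one_le_N
      simp at *
      omega)
  have := P.α_strictMono h
  rwa [P.α_zero] at this

theorem a_pos : 0 < P.a := div_pos P.deg_pos (by linarith [P.deg_pos])

theorem one_sub_a : 1 - P.a = 1 / (P.deg + 1) := by
  have := P.deg_pos
  unfold a
  field_simp
  ring

theorem a_lt_one : P.a < 1 := by
  have h : 0 < 1 - P.a := by
    rw [one_sub_a]
    exact div_pos one_pos (by linarith [P.deg_pos])
  linarith

theorem one_lt_β : 1 < P.β := by
  unfold β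
  linarith [P.a_lt_one]

theorem β_pos : 0 < P.β := one_pos.trans P.one_lt_β

theorem β_lt_two : P.β < 2 := by
  unfold β
  linarith [P.a_pos]

theorem two_le_lam : 2 ≤ P.lam := by
  unfold lam
  rw [le_div_iff₀ (by linarith [P.a_lt_one])]
  linarith [P.a_pos]

theorem holderConjugate : P.β.HolderConjugate P.lam := by
  rw [Real.holderConjugate_iff]
  refine ⟨P.one_lt_β, ?_⟩
  have h1 : 0 < 2 - P.a := by linarith [P.a_lt_one]
  have h2 : 0 < 1 - P.a := by linarith [P.a_lt_one]
  unfold β lam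
  field_simp
  ring

theorem eval_pos {s : ℝ} (hs : 0 ≤ s) : 0 < P.eval s :=
  P.coeff_zero_pos.trans_le (P.coeff_zero_le_eval hs)

theorem root_nonneg {r : ℝ} (hr : 0 ≤ r) : 0 ≤ P.root r := (P.root_spec hr).1

theorem root_mul_eval {r : ℝ} (hr : 0 ≤ r) : P.root r * P.eval (P.root r) = r :=
  (P.root_spec hr).2

theorem K_mul_self {r : ℝ} (hr : 0 ≤ r) : P.K r * r = P.root r := by
  have h := P.eval_pos (P.root_nonneg hr)
  unfold K
  rw [one_div, inv_mul_eq_div, div_eq_iff h.ne', P.root_mul_eval hr]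

theorem K_pos {r : ℝ} (hr : 0 ≤ r) : 0 < P.K r :=
  one_div_pos.2 (P.eval_pos (P.root_nonneg hr))

theorem eval_root_mul_K {r : ℝ} (hr : 0 ≤ r) : P.eval (P.root r) * P.K r = 1 := by
  have h := P.eval_pos (P.root_nonneg hr)
  unfold K
  field_simp

theorem mul_eval_lt {u v : ℝ} (hu : 0 ≤ u) (huv : u < v) : u * P.eval u < v * P.eval v :=
  mul_lt_mul huv (P.eval_mono hu huv.le) (P.eval_pos hu) (hu.trans huv.le)

theorem root_mono {r s : ℝ} (hr : 0 ≤ r) (hrs : r ≤ s) : P.root r ≤ P.root s := by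
  by_contra! h
  have := P.mul_eval_lt (P.root_nonneg (hr.trans hrs)) h
  rw [P.root_mul_eval hr, P.root_mul_eval (hr.trans hrs)] at this
  linarith

theorem root_zero : P.root 0 = 0 := by
  have := P.K_mul_self le_rfl
  simpa using this.symm

theorem root_pos {r : ℝ} (hr : 0 < r) : 0 < P.root r := by
  rw [← P.K_mul_self hr.le]
  exact mul_pos (P.K_pos hr.le) hr

theorem K_anti {r s : ℝ} (hr : 0 ≤ r) (hrs : r ≤ s) : P.K s ≤ P.K r :=
  one_div_le_one_div_of_le (P.eval_pos (P.root_nonneg hr))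
    (P.eval_mono (P.root_nonneg hr) (P.root_mono hr hrs))

/-- The vector field `y ↦ K(|y|) y`. -/
def flux {V : Type*} [NormedAddCommGroup V] [InnerProductSpace ℝ V] (y : V) : V := P.K ‖y‖ • y

/-! ### Cocoercivity of the flux field. -/

section flux

variable {V : Type*} [NormedAddCommGroup V] [InnerProductSpace ℝ V]

theorem flux_zero : P.flux (0 : V) = 0 := by simp [flux]

theorem norm_flux (y : V) : ‖P.flux y‖ = P.root ‖y‖ := by
  rw [flux, norm_smul, Real.norm_of_nonneg (P.K_pos (norm_nonneg y)).le,
    P.K_mul_self (norm_nonneg y)]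

theorem inner_flux_self (y : V) : inner ℝ (P.flux y) y = P.root ‖y‖ * ‖y‖ := by
  rw [flux, real_inner_smul_left, real_inner_self_eq_norm_sq, ← P.K_mul_self (norm_nonneg y)]
  ring

theorem eval_smul_flux (y : V) : P.eval ‖P.flux y‖ • P.flux y = y := by
  rw [norm_flux, flux, smul_smul, P.eval_root_mul_K (norm_nonneg y), one_smul]

/-- After a₀ is split off, the coefficient of the inner product of v and w is -(g(|v|) + g(|w|) -
2a₀) ≤ 0. Cauchy–Schwarz then reduces the claim to the monotonicity of r ↦ (g(r) - a₀) r on r ≥ 0.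
-/
theorem eval_smul_strongly_monotone (v w : V) :
    P.coeff 0 * ‖v - w‖ ^ 2 ≤ inner ℝ (v - w) (P.eval ‖v‖ • v - P.eval ‖w‖ • w) := by
  have hvw : inner ℝ v w ≤ ‖v‖ * ‖w‖ := real_inner_le_norm v w
  have e1 : inner ℝ (v - w) (P.eval ‖v‖ • v - P.eval ‖w‖ • w) =
      P.eval ‖v‖ * ‖v‖ ^ 2 + P.eval ‖w‖ * ‖w‖ ^ 2
        - (P.eval ‖v‖ + P.eval ‖w‖) * inner ℝ v w := by
    simp only [inner_sub_left, inner_sub_right, real_inner_smul_right, real_inner_self_eq_norm_sq,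
      real_inner_comm v w]
    ring
  have e2 : ‖v - w‖ ^ 2 = ‖v‖ ^ 2 - 2 * inner ℝ v w + ‖w‖ ^ 2 := norm_sub_sq_real v w
  rw [e1, e2]
  have h1 := P.coeff_zero_le_eval (norm_nonneg v)
  have h2 := P.coeff_zero_le_eval (norm_nonneg w)
  have h3 : 0 ≤ (P.eval ‖v‖ * ‖v‖ - P.coeff 0 * ‖v‖ - (P.eval ‖w‖ * ‖w‖ - P.coeff 0 * ‖w‖))
      * (‖v‖ - ‖w‖) := by
    rcases le_total ‖v‖ ‖w‖ with h | h
    · refine mul_nonneg_of_nonpos_of_nonpos ?_ (by linarith)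
      have := P.eval_mono (norm_nonneg v) h
      have h4 := mul_le_mul (sub_le_sub_right this (P.coeff 0)) h (norm_nonneg v) (by linarith)
      linarith
    · refine mul_nonneg ?_ (by linarith)
      have := P.eval_mono (norm_nonneg w) h
      have h4 := mul_le_mul (sub_le_sub_right this (P.coeff 0)) h (norm_nonneg w) (by linarith)
      linarith
  have h5 := mul_le_mul_of_nonneg_left hvw
    (show 0 ≤ P.eval ‖v‖ + P.eval ‖w‖ - 2 * P.coeff 0 by linarith)
  linarith

/-- `flux` is a right inverse of v ↦ g(|v|) v, so strong monotonicity of that map, read at the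
fluxes of y and z, is cocoercivity. -/
theorem flux_cocoercive (y z : V) :
    P.coeff 0 * ‖P.flux y - P.flux z‖ ^ 2 ≤ inner ℝ (P.flux y - P.flux z) (y - z) := by
  have h := P.eval_smul_strongly_monotone (P.flux y) (P.flux z)
  rwa [eval_smul_flux, eval_smul_flux] at h

theorem norm_flux_sub_le (y z : V) :
    ‖P.flux y - P.flux z‖ ≤ (P.coeff 0)⁻¹ * ‖y - z‖ := by
  have h := (P.flux_cocoercive y z).trans (real_inner_le_norm _ _)
  have h0 := P.coeff_zero_pos
  rw [inv_mul_eq_div, le_div_iff₀ h0]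
  rcases (norm_nonneg (P.flux y - P.flux z)).eq_or_lt with h1 | h1
  · rw [← h1, zero_mul]
    exact norm_nonneg _
  · refine le_of_mul_le_mul_left ?_ h1
    linarith

theorem lipschitzWith_flux :
    LipschitzWith (Real.toNNReal (P.coeff 0)⁻¹) (P.flux : V → V) := by
  refine LipschitzWith.of_dist_le_mul fun y z => ?_
  rw [dist_eq_norm, dist_eq_norm, Real.coe_toNNReal _ (inv_nonneg.2 P.coeff_zero_pos.le)]
  exact P.norm_flux_sub_le y z

end flux

/-! ### The convex potential and coercivity with exponent β. -/

theorem intervalIntegrable_root {r s : ℝ} (hr : 0 ≤ r) (hs : 0 ≤ s) :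
    IntervalIntegrable P.root volume r s := by
  refine MonotoneOn.intervalIntegrable fun x hx y _ hxy => P.root_mono ?_ hxy
  exact (le_min hr hs).trans hx.1

/-- The potential `r ↦ ∫₀ʳ K(ξ) ξ dξ`, of which `y ↦ K(|y|) y` is the gradient at `r = |y|`. -/
def potential (r : ℝ) : ℝ := ∫ x in (0 : ℝ)..r, P.root x

theorem potential_sub {r s : ℝ} (hr : 0 ≤ r) (hs : 0 ≤ s) :
    P.potential s - P.potential r = ∫ x in r..s, P.root x :=
  intervalIntegral.integral_interval_sub_left (P.intervalIntegrable_root le_rfl hs)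
    (P.intervalIntegrable_root le_rfl hr)

/-- Tangent-line inequality of a convex function: the potential is the integral of the nondecreasing
`root`. Continuity of `root` plays no role. -/
theorem root_mul_sub_le {r s : ℝ} (hr : 0 ≤ r) (hs : 0 ≤ s) :
    P.root r * (s - r) ≤ P.potential s - P.potential r := by
  rw [P.potential_sub hr hs]
  rcases le_total r s with h | h
  · have := intervalIntegral.integral_mono_on (f := fun _ => P.root r) h (by simp)
      (P.intervalIntegrable_root hr hs) (fun x hx => P.root_mono hr hx.1)
    simp only [intervalIntegral.integral_const, smul_eq_mul] at this
    linarith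
  · rw [intervalIntegral.integral_symm]
    have := intervalIntegral.integral_mono_on (g := fun _ => P.root r) h
      (P.intervalIntegrable_root hs hr) (by simp) (fun x hx => P.root_mono (hs.trans hx.1) hx.2)
    simp only [intervalIntegral.integral_const, smul_eq_mul] at this
    linarith

theorem potential_zero : P.potential 0 = 0 := by simp [potential]

theorem potential_nonneg {r : ℝ} (hr : 0 ≤ r) : 0 ≤ P.potential r := by
  have := P.root_mul_sub_le le_rfl hr
  rw [P.root_zero, P.potential_zero] at this
  linarith

theorem potential_le {r : ℝ} (hr : 0 ≤ r) : P.potential r ≤ P.root r * r := by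
  have := P.root_mul_sub_le hr le_rfl
  rw [P.potential_zero] at this
  linarith

/-- Since K is nonincreasing, `root x = K x * x` dominates `K r * x` on [0, r]. Integrating gives
K(r) r²/2. -/
theorem root_mul_le_potential {r : ℝ} (hr : 0 ≤ r) : P.root r * r ≤ 2 * P.potential r := by
  have h : ∫ x in (0 : ℝ)..r, P.K r * x ≤ P.potential r := by
    refine intervalIntegral.integral_mono_on hr
      ((continuous_const.mul continuous_id).intervalIntegrable _ _)
      (P.intervalIntegrable_root le_rfl hr) fun x hx => ?_
    rw [← P.K_mul_self hx.1]
    exact mul_le_mul_of_nonneg_right (P.K_anti hx.1 hx.2) hx.1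
  rw [intervalIntegral.integral_const_mul, integral_id, ← P.K_mul_self hr] at *
  linarith

theorem continuous_potential_norm {V : Type*} [NormedAddCommGroup V] :
    Continuous fun y : V => P.potential ‖y‖ := by
  have h : ContinuousOn P.potential (Ici 0) := by
    intro r hr
    rw [Metric.continuousWithinAt_iff]
    intro ε hε
    -- `root (r + 1)` bounds the slopes of the potential on [0, r + 1]. The added 1 makes the
    -- divisor positive.
    have hL : 0 < P.root (r + 1) + 1 := by
      have := P.root_nonneg (add_nonneg (mem_Ici.1 hr) zero_le_one)
      linarith
    refine ⟨min 1 (ε / (P.root (r + 1) + 1)), by positivity, fun {s} hs hd => ?_⟩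
    rw [Real.dist_eq, abs_lt] at hd
    have hr : 0 ≤ r := hr
    have hs : 0 ≤ s := hs
    have hd1 := min_le_left 1 (ε / (P.root (r + 1) + 1))
    have hd2 := min_le_right 1 (ε / (P.root (r + 1) + 1))
    have h1 := P.root_mul_sub_le hr hs
    have h2 := P.root_mul_sub_le hs hr
    have h3 : P.root r ≤ P.root (r + 1) := P.root_mono hr (by linarith)
    have h4 : P.root s ≤ P.root (r + 1) := P.root_mono hs (by linarith)
    have h5 : |s - r| < ε / (P.root (r + 1) + 1) := by
      rw [abs_lt]
      constructor <;> linarith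
    rw [lt_div_iff₀ hL] at h5
    have h6 : P.root s * (s - r) ≤ P.root (r + 1) * |s - r| := by
      calc P.root s * (s - r) ≤ P.root s * |s - r| :=
              mul_le_mul_of_nonneg_left (le_abs_self _) (P.root_nonneg hs)
        _ ≤ _ := mul_le_mul_of_nonneg_right h4 (abs_nonneg _)
    have h7 : P.root r * (r - s) ≤ P.root (r + 1) * |s - r| := by
      calc P.root r * (r - s) ≤ P.root r * |s - r| :=
            mul_le_mul_of_nonneg_left (by rw [abs_sub_comm]; exact le_abs_self _)
              (P.root_nonneg hr)
        _ ≤ _ := mul_le_mul_of_nonneg_right h3 (abs_nonneg _)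
    have h8 := abs_nonneg (s - r)
    rw [Real.dist_eq, abs_lt]
    constructor <;> nlinarith
  exact h.comp_continuous continuous_norm fun y => norm_nonneg y

theorem inner_flux_sub_le {V : Type*} [NormedAddCommGroup V] [InnerProductSpace ℝ V] (y z : V) :
    inner ℝ (P.flux y) (z - y) ≤ P.potential ‖z‖ - P.potential ‖y‖ := by
  refine le_trans ?_ (P.root_mul_sub_le (norm_nonneg y) (norm_nonneg z))
  rw [inner_sub_right, inner_flux_self, mul_sub]
  have := real_inner_le_norm (P.flux y) z
  rw [norm_flux] at this
  linarith

/-- Below r₀ = δ^{1/β} the left side is at most δ. Above r₀ the leading term governs g, so r ≤ C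
s^{deg+1} with s = `root r`; as 1 - a = 1/(deg+1), this reads r^{1-a} ≤ C' s, and multiplying by r
gives r^β. The free δ is what later permits limits equal to zero. -/
theorem exists_rpow_le {δ : ℝ} (hδ : 0 < δ) :
    ∃ C, 0 < C ∧ ∀ r, 0 ≤ r → r ^ P.β ≤ δ + C * (P.root r * r) := by
  set r₀ := δ ^ (P.β)⁻¹ with hr₀
  have hr₀pos : 0 < r₀ := Real.rpow_pos_of_pos hδ _
  set s₀ := P.root r₀ with hs₀
  have hs₀pos : 0 < s₀ := P.root_pos hr₀pos
  -- For s ≥ s₀ the powers s^{αᵢ - deg} have nonpositive exponents, so they are largest at s₀; this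
  -- gives g(s) ≤ B s^{deg}.
  set B := ∑ i, P.coeff i * s₀ ^ (P.α i - P.deg) with hB
  have hB0 : 0 ≤ B := Finset.sum_nonneg fun i _ =>
    mul_nonneg (P.coeff_nonneg i) (Real.rpow_nonneg hs₀pos.le _)
  have hev : ∀ s, s₀ ≤ s → P.eval s ≤ B * s ^ P.deg := by
    intro s hs
    rw [hB, Finset.sum_mul]
    refine Finset.sum_le_sum fun i _ => ?_
    rw [mul_assoc]
    refine mul_le_mul_of_nonneg_left ?_ (P.coeff_nonneg i)
    have hspos := hs₀pos.trans_le hs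
    have hi : P.α i - P.deg ≤ 0 :=
      sub_nonpos.2 (P.α_strictMono.monotone (Fin.le_last i))
    calc s ^ P.α i = s ^ (P.α i - P.deg) * s ^ P.deg := by
          rw [← Real.rpow_add hspos]; ring_nf
      _ ≤ _ := mul_le_mul_of_nonneg_right (Real.rpow_le_rpow_of_nonpos hs₀pos hs hi)
          (Real.rpow_nonneg hspos.le _)
  have hdeg := P.deg_pos
  refine ⟨(B + 1) ^ (1 - P.a), Real.rpow_pos_of_pos (by linarith) _, fun r hr => ?_⟩
  have hC : 0 < (B + 1) ^ (1 - P.a) := Real.rpow_pos_of_pos (by linarith) _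
  rcases le_total r r₀ with h | h
  · have h1 : r ^ P.β ≤ δ := by
      calc r ^ P.β ≤ r₀ ^ P.β := Real.rpow_le_rpow hr h P.β_pos.le
        _ = δ := Real.rpow_inv_rpow hδ.le P.β_pos.ne'
    have := mul_nonneg hC.le (mul_nonneg (P.root_nonneg hr) hr)
    linarith
  · have hrpos : 0 < r := hr₀pos.trans_le h
    have hs := P.root_mono hr₀pos.le h
    have hspos := P.root_pos hrpos
    have h1 : r ≤ (B + 1) * P.root r ^ (P.deg + 1) := by
      calc r = P.root r * P.eval (P.root r) := (P.root_mul_eval hr).symm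
        _ ≤ P.root r * (B * P.root r ^ P.deg) := mul_le_mul_of_nonneg_left (hev _ hs) hspos.le
        _ = B * P.root r ^ (P.deg + 1) := by rw [Real.rpow_add_one hspos.ne']; ring
        _ ≤ _ := mul_le_mul_of_nonneg_right (by linarith) (Real.rpow_nonneg hspos.le _)
    have h2 : r ^ (1 - P.a) ≤ (B + 1) ^ (1 - P.a) * P.root r := by
      calc r ^ (1 - P.a) ≤ ((B + 1) * P.root r ^ (P.deg + 1)) ^ (1 - P.a) :=
            Real.rpow_le_rpow hr h1 (by linarith [P.a_lt_one])
        _ = (B + 1) ^ (1 - P.a) * P.root r := by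
            rw [Real.mul_rpow (by linarith) (Real.rpow_nonneg hspos.le _),
              ← Real.rpow_mul hspos.le, one_sub_a, mul_one_div_cancel (by linarith),
              Real.rpow_one]
    calc r ^ P.β = r ^ (1 - P.a) * r := by
          rw [← Real.rpow_add_one hrpos.ne', β]; ring_nf
      _ ≤ (B + 1) ^ (1 - P.a) * P.root r * r := mul_le_mul_of_nonneg_right h2 hr
      _ ≤ _ := by rw [mul_assoc]; linarith

end GenPoly

/-! ### Linear structure of H¹ and H¹₀, weak gradients of test functions, L^q integrals. -/

section Spaces

variable {d : ℕ} {Ω : Set (EuclideanSpace ℝ (Fin d))}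

/-- The map `(u, ∇u) ↦ u` as a continuous linear map. -/
def toL2L : H1 Ω →L[ℝ] L2 Ω := (WithLp.fstL 2 ℝ (L2 Ω) (L2Vec Ω)).comp (H1 Ω).subtypeL

/-- The weak gradient as a continuous linear map. -/
def gradL : H1 Ω →L[ℝ] L2Vec Ω := (WithLp.sndL 2 ℝ (L2 Ω) (L2Vec Ω)).comp (H1 Ω).subtypeL

theorem toL2_add (u v : H1 Ω) : toL2 (u + v) = toL2 u + toL2 v := toL2L.map_add u v

theorem toL2_sub (u v : H1 Ω) : toL2 (u - v) = toL2 u - toL2 v := toL2L.map_sub u v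

theorem grad_add (u v : H1 Ω) : grad (u + v) = grad u + grad v := gradL.map_add u v

theorem grad_sub (u v : H1 Ω) : grad (u - v) = grad u - grad v := gradL.map_sub u v

theorem norm_toL2_le (u : H1 Ω) : ‖toL2 u‖ ≤ ‖u‖ := by
  have := norm_sq_H1 u
  exact abs_le_of_sq_le_sq' (by nlinarith [sq_nonneg ‖grad u‖]) (norm_nonneg _) |>.2

theorem norm_grad_le (u : H1 Ω) : ‖grad u‖ ≤ ‖u‖ := by
  have := norm_sq_H1 u
  exact abs_le_of_sq_le_sq' (by nlinarith [sq_nonneg ‖toL2 u‖]) (norm_nonneg _) |>.2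

theorem IsTestFunction.add {η ζ : EuclideanSpace ℝ (Fin d) → ℝ} (hη : IsTestFunction Ω η)
    (hζ : IsTestFunction Ω ζ) : IsTestFunction Ω (η + ζ) where
  contDiff := hη.contDiff.add hζ.contDiff
  hasCompactSupport := hη.hasCompactSupport.add hζ.hasCompactSupport
  tsupport_subset := (tsupport_add η ζ).trans
    (union_subset hη.tsupport_subset hζ.tsupport_subset)

theorem IsTestFunction.const_smul {η : EuclideanSpace ℝ (Fin d) → ℝ} (c : ℝ)
    (hη : IsTestFunction Ω η) : IsTestFunction Ω (c • η) where
  contDiff := contDiff_const.smul hη.contDiff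
  hasCompactSupport := hη.hasCompactSupport.smul_left (f := fun _ => c)
  tsupport_subset := (tsupport_smul_subset_right (fun _ => c) η).trans hη.tsupport_subset

/-- The test functions as a subspace of `H¹(Ω)`. -/
def testSubmodule (Ω : Set (EuclideanSpace ℝ (Fin d))) : Submodule ℝ (H1 Ω) where
  carrier := testH1 Ω
  add_mem' := by
    rintro u v ⟨η, hη, hu⟩ ⟨ζ, hζ, hv⟩
    refine ⟨η + ζ, hη.add hζ, ?_⟩
    rw [toL2_add]
    exact (Lp.coeFn_add _ _).trans (hu.add hv)
  zero_mem' := by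
    refine ⟨0, ⟨contDiff_const, HasCompactSupport.zero, by simp [tsupport]⟩, ?_⟩
    exact Lp.coeFn_zero _ _ _
  smul_mem' := by
    rintro c u ⟨η, hη, hu⟩
    refine ⟨c • η, hη.const_smul c, ?_⟩
    have : toL2 (c • u) = c • toL2 u := toL2L.map_smul c u
    rw [this]
    exact (Lp.coeFn_smul _ _).trans (hu.const_smul c)

/-- `H¹₀(Ω)` as a closed subspace of `H¹(Ω)`. -/
def H01Submodule (Ω : Set (EuclideanSpace ℝ (Fin d))) : Submodule ℝ (H1 Ω) :=
  (testSubmodule Ω).topologicalClosure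

theorem isClosed_H01 : IsClosed (H01 Ω) := isClosed_closure

theorem sub_mem_H01 {u v : H1 Ω} (hu : u ∈ H01 Ω) (hv : v ∈ H01 Ω) : u - v ∈ H01 Ω :=
  (H01Submodule Ω).sub_mem hu hv

theorem smul_mem_H01 (c : ℝ) {u : H1 Ω} (hu : u ∈ H01 Ω) : c • u ∈ H01 Ω :=
  (H01Submodule Ω).smul_mem c hu

/-- Membership in `testH1` only prescribes the L² component. The weak gradient and the classical
derivative satisfy the same integration by parts against test functions, so the fundamental lemma of
the calculus of variations on the open set Ω identifies them. -/
theorem grad_ae_eq_of_mem_testH1 (hΩ : IsOpen Ω) {u : H1 Ω}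
    {η : EuclideanSpace ℝ (Fin d) → ℝ} (hη : IsTestFunction Ω η)
    (hu : toL2 u =ᵐ[volume.restrict Ω] η) (i : Fin d) :
    ∀ᵐ x ∂volume.restrict Ω, grad u x i = fderiv ℝ η x (EuclideanSpace.single i 1) := by
  have hGi : MemLp (fun x => grad u x i) 2 (volume.restrict Ω) :=
    (EuclideanSpace.proj i : EuclideanSpace ℝ (Fin d) →L[ℝ] ℝ).comp_memLp' (Lp.memLp (grad u))
  have hηi : Continuous fun x => fderiv ℝ η x (EuclideanSpace.single i 1) :=
    (hη.contDiff.continuous_fderiv (by simp)).clm_apply continuous_const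
  have hloc : LocallyIntegrableOn
      (fun x => grad u x i - fderiv ℝ η x (EuclideanSpace.single i 1)) Ω volume := by
    refine LocallyIntegrableOn.sub ?_ (hηi.locallyIntegrable.locallyIntegrableOn _)
    have h1 : LocallyIntegrable (fun x => grad u x i) (volume.restrict Ω) :=
      hGi.locallyIntegrable (by norm_num)
    exact locallyIntegrableOn_of_locallyIntegrable_restrict h1
  have key : ∀ ψ : EuclideanSpace ℝ (Fin d) → ℝ, ContDiff ℝ (⊤ : ℕ∞) ψ → HasCompactSupport ψ →
      tsupport ψ ⊆ Ω →
      ∫ x, ψ x • (grad u x i - fderiv ℝ η x (EuclideanSpace.single i 1)) = 0 := by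
    intro ψ h1 h2 h3
    have hψ : IsTestFunction Ω ψ := ⟨h1, h2, h3⟩
    have hψi : Continuous fun x => fderiv ℝ ψ x (EuclideanSpace.single i 1) :=
      (hψ.contDiff.continuous_fderiv (by simp)).clm_apply continuous_const
    have hw := u.2 ψ hψ i
    have hzero : ∀ x, x ∉ Ω → ψ x = 0 := fun x hx =>
      image_eq_zero_of_notMem_tsupport fun h => hx (h3 h)
    have hzero' : ∀ x, x ∉ Ω → fderiv ℝ ψ x (EuclideanSpace.single i 1) = 0 := fun x hx => by
      have : fderiv ℝ ψ x = 0 := by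
        refine image_eq_zero_of_notMem_tsupport fun h => hx (h3 ?_)
        exact tsupport_fderiv_subset ℝ (f := ψ) h
      rw [this]; rfl
    have e1 : ∫ x in Ω, toL2 u x * fderiv ℝ ψ x (EuclideanSpace.single i 1) =
        ∫ x, η x * fderiv ℝ ψ x (EuclideanSpace.single i 1) := by
      rw [← setIntegral_eq_integral_of_forall_compl_eq_zero (s := Ω) (μ := volume)
        (f := fun x => η x * fderiv ℝ ψ x (EuclideanSpace.single i 1))
        (fun x hx => by rw [hzero' x hx, mul_zero])]
      refine integral_congr_ae ?_
      filter_upwards [hu] with x hx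
      rw [hx]
    have e2 : ∫ x, η x * fderiv ℝ ψ x (EuclideanSpace.single i 1) =
        - ∫ x, fderiv ℝ η x (EuclideanSpace.single i 1) * ψ x := by
      refine integral_mul_fderiv_eq_neg_fderiv_mul_of_integrable ?_ ?_ ?_ ?_ ?_
      · exact (hηi.mul h1.continuous).integrable_of_hasCompactSupport h2.mul_left
      · exact (hη.contDiff.continuous.mul hψi).integrable_of_hasCompactSupport
          hη.hasCompactSupport.mul_right
      · exact (hη.contDiff.continuous.mul h1.continuous).integrable_of_hasCompactSupport
          h2.mul_left
      · exact fun x _ => hη.contDiff.differentiable (by simp) x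
      · exact fun x _ => h1.differentiable (by simp) x
    have e3 : ∫ x, ψ x • (grad u x i - fderiv ℝ η x (EuclideanSpace.single i 1)) =
        ∫ x in Ω, (grad u x i * ψ x - fderiv ℝ η x (EuclideanSpace.single i 1) * ψ x) := by
      rw [← setIntegral_eq_integral_of_forall_compl_eq_zero (s := Ω)
        (fun x hx => by rw [hzero x hx, zero_smul])]
      refine integral_congr_ae (Eventually.of_forall fun x => ?_)
      simp only [smul_eq_mul]
      ring
    have e4 : ∫ x in Ω, fderiv ℝ η x (EuclideanSpace.single i 1) * ψ x =
        ∫ x, fderiv ℝ η x (EuclideanSpace.single i 1) * ψ x :=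
      setIntegral_eq_integral_of_forall_compl_eq_zero
        (fun x hx => by rw [hzero x hx, mul_zero])
    have h5 : IntegrableOn (fun x => fderiv ℝ η x (EuclideanSpace.single i 1) * ψ x) Ω :=
      ((hηi.mul h1.continuous).integrable_of_hasCompactSupport h2.mul_left).integrableOn
    rw [e3, integral_sub (hψ.integrable_right (grad u) i) h5, e4]
    change ∫ x in Ω, toL2 u x * fderiv ℝ ψ x (EuclideanSpace.single i 1) =
      - ∫ x in Ω, grad u x i * ψ x at hw
    linarith
  have := hΩ.ae_eq_zero_of_integral_contDiff_smul_eq_zero hloc key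
  rw [ae_restrict_iff' hΩ.measurableSet]
  filter_upwards [this] with x hx hxΩ
  exact sub_eq_zero.1 (hx hxΩ)

/-- `∫_Ω |v|^q`. -/
def powInt (q : ℝ) (v : L2Vec Ω) : ℝ := ∫ x in Ω, ‖v x‖ ^ q

theorem powInt_nonneg (q : ℝ) (v : L2Vec Ω) : 0 ≤ powInt q v :=
  integral_nonneg fun _ => Real.rpow_nonneg (norm_nonneg _) _

theorem isFiniteMeasure_restrict (hb : Bornology.IsBounded Ω) :
    IsFiniteMeasure (volume.restrict Ω) :=
  ⟨by rw [Measure.restrict_apply_univ]; exact hb.measure_lt_top⟩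

theorem memLp_of_le_two (hb : Bornology.IsBounded Ω) {q : ℝ} (hq : q ≤ 2) (v : L2Vec Ω) :
    MemLp v (ENNReal.ofReal q) (volume.restrict Ω) := by
  have := isFiniteMeasure_restrict hb
  refine (Lp.memLp v).mono_exponent ?_
  exact ENNReal.ofReal_le_of_le_toReal (by simpa using hq)

theorem integrable_rpow (hb : Bornology.IsBounded Ω) {q : ℝ} (hq0 : 0 < q) (hq : q ≤ 2)
    (v : L2Vec Ω) : Integrable (fun x => ‖v x‖ ^ q) (volume.restrict Ω) := by
  have := (memLp_of_le_two hb hq v).integrable_norm_rpow (by simpa using hq0) (by simp)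
  rwa [ENNReal.toReal_ofReal hq0.le] at this

theorem gradNorm_rpow (hb : Bornology.IsBounded Ω) {q : ℝ} (hq0 : 0 < q) (hq : q ≤ 2)
    (u : H1 Ω) : gradNorm q u ^ q = ENNReal.ofReal (powInt q (grad u)) := by
  have h := eLpNorm_nnreal_pow_eq_lintegral (f := grad u) (μ := volume.restrict Ω)
    (p := Real.toNNReal q) (by simpa using hq0)
  rw [Real.coe_toNNReal q hq0.le] at h
  rw [gradNorm, ENNReal.ofReal, h, powInt,
    ofReal_integral_eq_lintegral_ofReal (integrable_rpow hb hq0 hq _)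
      (ae_of_all _ fun _ => Real.rpow_nonneg (norm_nonneg _) _)]
  refine lintegral_congr fun x => ?_
  rw [← ENNReal.ofReal_rpow_of_nonneg (norm_nonneg _) hq0.le, ofReal_norm]

end Spaces

/-! ### The Poincaré–Sobolev inequality on H¹₀. -/

section Sobolev

variable {d : ℕ} {Ω : Set (EuclideanSpace ℝ (Fin d))}

theorem norm_fderiv_le_of_coord {η : EuclideanSpace ℝ (Fin d) → ℝ} {x v : EuclideanSpace ℝ (Fin d)}
    (h : ∀ i, v i = fderiv ℝ η x (EuclideanSpace.single i 1)) : ‖fderiv ℝ η x‖ ≤ ‖v‖ := by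
  have hv : fderiv ℝ η x = innerSL ℝ v := by
    refine ContinuousLinearMap.coe_injective ((EuclideanSpace.basisFun (Fin d) ℝ).toBasis.ext
      fun i => ?_)
    simp [← h i, EuclideanSpace.inner_single_right]
  rw [hv, innerSL_apply_norm]

/-- Gagliardo–Nirenberg–Sobolev for smooth functions supported in a bounded set. The exponent
condition 1/q - 1/d ≤ 1/2 is the hypothesis 2d/(d+2) ≤ q, and q < 2 ≤ d places q below the
dimension. -/
theorem enorm_toL2_le_of_mem_testH1 (hd : 2 ≤ d) (hΩ : IsOpen Ω) (hb : Bornology.IsBounded Ω)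
    {q : ℝ} (hq1 : 1 < q) (hq2 : q < 2) (hqd : 2 * (d : ℝ) / (d + 2) ≤ q) :
    ∃ C : ℝ≥0, ∀ u ∈ testH1 Ω, ‖toL2 u‖ₑ ≤ C * gradNorm q u := by
  set p : ℝ≥0 := Real.toNNReal q with hp
  have hpq : (p : ℝ) = q := Real.coe_toNNReal q (by linarith)
  have hd' : (2 : ℝ) ≤ d := by exact_mod_cast hd
  refine ⟨eLpNormLESNormFDerivOfLeConst ℝ volume Ω p 2, fun u hu => ?_⟩
  obtain ⟨η, hη, hu⟩ := hu
  have hgn := eLpNorm_le_eLpNorm_fderiv_of_le (volume : Measure (EuclideanSpace ℝ (Fin d)))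
    (u := η) (s := Ω) (hη.contDiff.of_le (by exact_mod_cast le_top))
    ((subset_tsupport η).trans hη.tsupport_subset)
    (p := p) (q := 2) (by rw [← NNReal.coe_le_coe, hpq]; simpa using hq1.le)
    (by
      rw [← NNReal.coe_lt_coe, hpq, finrank_euclideanSpace, Fintype.card_fin]
      push_cast
      linarith)
    (by
      rw [finrank_euclideanSpace, Fintype.card_fin, NNReal.coe_inv, hpq]
      push_cast
      have h1 : q⁻¹ ≤ (2 * (d : ℝ) / (d + 2))⁻¹ := inv_anti₀ (by positivity) hqd
      have h2 : (2 * (d : ℝ) / (d + 2))⁻¹ = 2⁻¹ + (d : ℝ)⁻¹ := by field_simp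
      linarith) hb
  have h1 : ‖toL2 u‖ₑ ≤ eLpNorm η 2 volume := by
    rw [Lp.enorm_def, eLpNorm_congr_ae hu]
    exact eLpNorm_mono_measure _ Measure.restrict_le_self
  have h2 : eLpNorm (fderiv ℝ η) p volume ≤ gradNorm q u := by
    rw [← eLpNorm_norm, ← eLpNorm_restrict_eq_of_support_subset (s := Ω)
      (f := fun x => ‖fderiv ℝ η x‖) (fun x hx => hη.tsupport_subset
        (support_fderiv_subset ℝ (f := η) fun h => hx (by simp only [h, norm_zero])))]
    refine eLpNorm_mono_ae ?_
    filter_upwards [ae_all_iff.2 fun i => grad_ae_eq_of_mem_testH1 hΩ hη hu i] with x hx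
    rw [norm_norm]
    exact norm_fderiv_le_of_coord hx
  exact h1.trans (hgn.trans (by gcongr))

theorem gradNorm_le (hb : Bornology.IsBounded Ω) {q : ℝ} (hq2 : q ≤ 2) :
    ∃ C : ℝ≥0, ∀ u : H1 Ω, gradNorm q u ≤ C * ‖u‖ₑ := by
  have hfin := isFiniteMeasure_restrict hb
  set c := (volume.restrict Ω) univ ^ (1 / (ENNReal.ofReal q).toReal - 1 / (2 : ℝ≥0∞).toReal)
    with hc
  rcases le_or_gt q 0 with hq0 | hq0
  · refine ⟨0, fun u => ?_⟩
    simp [gradNorm, ENNReal.ofReal_of_nonpos hq0]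
  have hc' : c ≠ ∞ := by
    refine ENNReal.rpow_ne_top_of_nonneg ?_ (measure_ne_top _ _)
    rw [ENNReal.toReal_ofReal hq0.le, ENNReal.toReal_ofNat, sub_nonneg]
    exact one_div_le_one_div_of_le hq0 hq2
  refine ⟨c.toNNReal, fun u => ?_⟩
  rw [ENNReal.coe_toNNReal hc']
  have h := eLpNorm_le_eLpNorm_mul_rpow_measure_univ (p := ENNReal.ofReal q) (q := 2)
    (μ := volume.restrict Ω) (f := grad u)
    (ENNReal.ofReal_le_of_le_toReal (by simpa using hq2)) (Lp.aestronglyMeasurable _)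
  rw [← Lp.enorm_def, ← hc, mul_comm] at h
  refine h.trans ?_
  gcongr
  rw [← ofReal_norm, ← ofReal_norm]
  exact ENNReal.ofReal_le_ofReal (norm_grad_le u)

theorem gradNorm_sub_le {q : ℝ} (hq1 : 1 ≤ q) (u v : H1 Ω) :
    gradNorm q (u - v) ≤ gradNorm q u + gradNorm q v := by
  have h : ⇑(grad (u - v)) =ᵐ[volume.restrict Ω] ⇑(grad u) - ⇑(grad v) := by
    rw [grad_sub]
    exact Lp.coeFn_sub _ _
  rw [gradNorm, eLpNorm_congr_ae h]
  exact eLpNorm_sub_le (Lp.aestronglyMeasurable _) (Lp.aestronglyMeasurable _)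
    (by simpa using hq1)

/-- Density. On a bounded set with q < 2 the L^q norm of the gradient is dominated by the H¹ norm,
so replacing u by a test function v costs at most (1 + CD)‖u - v‖, which can be made arbitrarily
small. -/
theorem enorm_toL2_le_of_mem_H01 (hd : 2 ≤ d) (hΩ : IsOpen Ω) (hb : Bornology.IsBounded Ω)
    {q : ℝ} (hq1 : 1 < q) (hq2 : q < 2) (hqd : 2 * (d : ℝ) / (d + 2) ≤ q) :
    ∃ C : ℝ≥0, ∀ u ∈ H01 Ω, ‖toL2 u‖ₑ ≤ C * gradNorm q u := by
  obtain ⟨C, hC⟩ := enorm_toL2_le_of_mem_testH1 hd hΩ hb hq1 hq2 hqd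
  obtain ⟨D, hD⟩ := gradNorm_le (Ω := Ω) hb hq2.le
  refine ⟨C, fun u hu => ?_⟩
  have key : ∀ v ∈ testH1 Ω, ‖toL2 u‖ₑ ≤ C * gradNorm q u + (1 + C * D) * ‖u - v‖ₑ := by
    intro v hv
    have h1 : ‖toL2 u‖ₑ ≤ ‖toL2 v‖ₑ + ‖u - v‖ₑ := by
      have : toL2 u = toL2 v + toL2 (u - v) := by rw [toL2_sub]; abel
      rw [this]
      refine (enorm_add_le _ _).trans ?_
      gcongr
      rw [← ofReal_norm, ← ofReal_norm]
      exact ENNReal.ofReal_le_ofReal (norm_toL2_le _)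
    have h2 : gradNorm q v ≤ gradNorm q u + D * ‖u - v‖ₑ := by
      have h := gradNorm_sub_le hq1.le u (u - v)
      rw [sub_sub_cancel] at h
      refine h.trans ?_
      gcongr
      exact hD _
    calc ‖toL2 u‖ₑ ≤ ‖toL2 v‖ₑ + ‖u - v‖ₑ := h1
      _ ≤ C * (gradNorm q u + D * ‖u - v‖ₑ) + ‖u - v‖ₑ := by
          gcongr
          exact (hC v hv).trans (by gcongr)
      _ = _ := by ring
  obtain ⟨s, hs, hlim⟩ := mem_closure_iff_seq_limit.1 hu
  have h0 : Tendsto (fun n => ‖u - s n‖ₑ) atTop (𝓝 0) := by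
    have : Tendsto (fun n => u - s n) atTop (𝓝 (u - u)) := tendsto_const_nhds.sub hlim
    rw [sub_self] at this
    have h := ENNReal.tendsto_ofReal this.norm
    rw [norm_zero, ENNReal.ofReal_zero] at h
    exact h.congr fun n => ofReal_norm _
  have h1 : Tendsto (fun n => C * gradNorm q u + (1 + C * D) * ‖u - s n‖ₑ) atTop
      (𝓝 (C * gradNorm q u + (1 + C * D) * 0)) := by
    refine tendsto_const_nhds.add (ENNReal.Tendsto.const_mul h0 (Or.inr ?_))
    exact ENNReal.add_ne_top.2 ⟨ENNReal.one_ne_top, ENNReal.mul_ne_top (by simp) (by simp)⟩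
  rw [mul_zero, add_zero] at h1
  exact ge_of_tendsto' h1 fun n => key _ (hs n)

/-- The Poincaré–Sobolev inequality on `H¹₀(Ω)`. -/
theorem exists_sobolev (hd : 2 ≤ d) (hΩ : IsOpen Ω) (hb : Bornology.IsBounded Ω)
    (P : GenPoly) (hdeg : P.a ≤ 4 / ((d : ℝ) + 2)) :
    ∃ C : ℝ, 0 < C ∧ ∀ u ∈ H01 Ω, ‖toL2 u‖ ^ P.β ≤ C * powInt P.β (grad u) := by
  have hd' : (2 : ℝ) ≤ d := by exact_mod_cast hd
  obtain ⟨C, hC⟩ := enorm_toL2_le_of_mem_H01 (Ω := Ω) hd hΩ hb P.one_lt_β P.β_lt_two (by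
    -- The degree condition a ≤ 4/(d+2) is exactly 2d/(d+2) ≤ β.
    have : 2 * (d : ℝ) / (d + 2) = 2 - 4 / (d + 2) := by field_simp; ring
    rw [this, GenPoly.β]
    linarith)
  refine ⟨(C : ℝ) ^ P.β + 1, by positivity, fun u hu => ?_⟩
  have h := ENNReal.rpow_le_rpow (hC u hu) P.β_pos.le
  rw [ENNReal.mul_rpow_of_nonneg _ _ P.β_pos.le, gradNorm_rpow hb P.β_pos P.β_lt_two.le,
    ← ofReal_norm, ENNReal.ofReal_rpow_of_nonneg (norm_nonneg _) P.β_pos.le,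
    ← ENNReal.ofReal_coe_nnreal, ENNReal.ofReal_rpow_of_nonneg C.coe_nonneg P.β_pos.le,
    ← ENNReal.ofReal_mul (by positivity)] at h
  have hX := powInt_nonneg P.β (grad u)
  rw [ENNReal.ofReal_le_ofReal_iff (by positivity)] at h
  linarith

end Sobolev

/-! ### The flux operator on L², its dissipation and its convex energy. -/

section Operator

variable {d : ℕ} {Ω : Set (EuclideanSpace ℝ (Fin d))}

namespace GenPoly

variable (P : GenPoly)

/-- The operator `v ↦ K(|v|) v` on `(L²(Ω))ᵈ`. -/
def fluxOp (v : L2Vec Ω) : L2Vec Ω := P.lipschitzWith_flux.compLp P.flux_zero v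

theorem coeFn_fluxOp (v : L2Vec Ω) :
    ∀ᵐ x ∂volume.restrict Ω, P.fluxOp v x = P.flux (v x) :=
  P.lipschitzWith_flux.coeFn_compLp P.flux_zero v

theorem continuous_fluxOp : Continuous (P.fluxOp : L2Vec Ω → L2Vec Ω) :=
  (P.lipschitzWith_flux.lipschitzWith_compLp P.flux_zero).continuous

theorem inner_fluxOp (v w : L2Vec Ω) :
    inner ℝ (P.fluxOp v) w = ∫ x in Ω, P.K ‖v x‖ * inner ℝ (v x) (w x) := by
  rw [L2.inner_def]
  refine integral_congr_ae ?_
  filter_upwards [P.coeFn_fluxOp v] with x hx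
  rw [hx, flux, real_inner_smul_left]

theorem fluxOp_zero : P.fluxOp (0 : L2Vec Ω) = 0 := by
  refine Lp.ext ?_
  filter_upwards [P.coeFn_fluxOp (0 : L2Vec Ω),
    Lp.coeFn_zero (EuclideanSpace ℝ (Fin d)) 2 (volume.restrict Ω)] with x h1 h2
  rw [h1, h2, Pi.zero_apply, flux_zero]

theorem fluxOp_cocoercive (v w : L2Vec Ω) :
    P.coeff 0 * ‖P.fluxOp v - P.fluxOp w‖ ^ 2 ≤ inner ℝ (P.fluxOp v - P.fluxOp w) (v - w) := by
  rw [← real_inner_self_eq_norm_sq, ← real_inner_smul_left, L2.inner_def, L2.inner_def]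
  refine integral_mono_ae (L2.integrable_inner _ _) (L2.integrable_inner _ _) ?_
  filter_upwards [P.coeFn_fluxOp v, P.coeFn_fluxOp w, Lp.coeFn_sub v w,
    Lp.coeFn_sub (P.fluxOp v) (P.fluxOp w),
    Lp.coeFn_smul (P.coeff 0) (P.fluxOp v - P.fluxOp w)] with x h1 h2 h3 h4 h5
  simp only [h5, Pi.smul_apply, h4, h3, Pi.sub_apply, h1, h2, real_inner_smul_left,
    real_inner_self_eq_norm_sq]
  exact P.flux_cocoercive (v x) (w x)

/-- `∫_Ω K(|v|) |v|²`. -/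
def dissip (v : L2Vec Ω) : ℝ := inner ℝ (P.fluxOp v) v

/-- Cocoercivity against the zero field. It lets the dissipation absorb every pairing of the flux
with the gradient of the data. -/
theorem norm_fluxOp_sq_le (v : L2Vec Ω) : P.coeff 0 * ‖P.fluxOp v‖ ^ 2 ≤ P.dissip v := by
  have := P.fluxOp_cocoercive v 0
  rwa [fluxOp_zero, sub_zero, sub_zero] at this

theorem norm_fluxOp_le (v : L2Vec Ω) : ‖P.fluxOp v‖ ≤ (P.coeff 0)⁻¹ * ‖v‖ := by
  have h1 := (P.norm_fluxOp_sq_le v).trans (real_inner_le_norm _ _)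
  rw [inv_mul_eq_div, le_div_iff₀ P.coeff_zero_pos]
  rcases (norm_nonneg (P.fluxOp v)).eq_or_lt with h | h
  · rw [← h, zero_mul]
    exact norm_nonneg _
  · refine le_of_mul_le_mul_left ?_ h
    linarith

theorem dissip_le (v : L2Vec Ω) : P.dissip v ≤ (P.coeff 0)⁻¹ * ‖v‖ ^ 2 := by
  calc P.dissip v ≤ ‖P.fluxOp v‖ * ‖v‖ := real_inner_le_norm _ _
    _ ≤ (P.coeff 0)⁻¹ * ‖v‖ * ‖v‖ :=
        mul_le_mul_of_nonneg_right (P.norm_fluxOp_le v) (norm_nonneg _)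
    _ = _ := by ring

theorem dissip_eq (v : L2Vec Ω) : P.dissip v = ∫ x in Ω, P.root ‖v x‖ * ‖v x‖ := by
  rw [dissip, inner_fluxOp]
  refine integral_congr_ae (ae_of_all _ fun x => ?_)
  simp only
  rw [real_inner_self_eq_norm_sq, ← P.K_mul_self (norm_nonneg _)]
  ring

theorem integrable_root_mul (v : L2Vec Ω) :
    Integrable (fun x => P.root ‖v x‖ * ‖v x‖) (volume.restrict Ω) := by
  refine (L2.integrable_inner (P.fluxOp v) v (𝕜 := ℝ)).congr ?_
  filter_upwards [P.coeFn_fluxOp v] with x hx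
  rw [hx, inner_flux_self]

/-- `∫_Ω Φ(|v|)`, where `Φ` is the potential. -/
def energy (v : L2Vec Ω) : ℝ := ∫ x in Ω, P.potential ‖v x‖

theorem integrable_potential (v : L2Vec Ω) :
    Integrable (fun x => P.potential ‖v x‖) (volume.restrict Ω) := by
  refine (P.integrable_root_mul v).mono'
    (P.continuous_potential_norm.comp_aestronglyMeasurable (Lp.aestronglyMeasurable v))
    (ae_of_all _ fun x => ?_)
  rw [Real.norm_of_nonneg (P.potential_nonneg (norm_nonneg _))]
  exact P.potential_le (norm_nonneg _)

theorem energy_nonneg (v : L2Vec Ω) : 0 ≤ P.energy v :=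
  integral_nonneg fun _ => P.potential_nonneg (norm_nonneg _)

theorem energy_le_dissip (v : L2Vec Ω) : P.energy v ≤ P.dissip v := by
  rw [dissip_eq]
  exact integral_mono (P.integrable_potential v) (P.integrable_root_mul v)
    fun x => P.potential_le (norm_nonneg _)

theorem dissip_le_energy (v : L2Vec Ω) : P.dissip v ≤ 2 * P.energy v := by
  rw [dissip_eq, energy, ← integral_const_mul]
  exact integral_mono (P.integrable_root_mul v) ((P.integrable_potential v).const_mul 2)
    fun x => P.root_mul_le_potential (norm_nonneg _)

theorem inner_fluxOp_le_energy_sub (v w : L2Vec Ω) :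
    inner ℝ (P.fluxOp v) (w - v) ≤ P.energy w - P.energy v := by
  rw [energy, energy, ← integral_sub (P.integrable_potential w) (P.integrable_potential v),
    L2.inner_def]
  refine integral_mono_ae (L2.integrable_inner _ _)
    ((P.integrable_potential w).sub (P.integrable_potential v)) ?_
  filter_upwards [P.coeFn_fluxOp v, Lp.coeFn_sub w v] with x h1 h2
  rw [h1, h2]
  exact P.inner_flux_sub_le (v x) (w x)

theorem energy_sub_le_inner_fluxOp (v w : L2Vec Ω) :
    P.energy w - P.energy v ≤ inner ℝ (P.fluxOp w) (w - v) := by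
  have := P.inner_fluxOp_le_energy_sub w v
  rw [← neg_sub w v, inner_neg_right] at this
  linarith

theorem continuous_energy : Continuous (P.energy : L2Vec Ω → ℝ) := by
  rw [continuous_iff_continuousAt]
  intro v
  have h1 : Tendsto (fun w : L2Vec Ω => P.energy v + inner ℝ (P.fluxOp v) (w - v)) (𝓝 v)
      (𝓝 (P.energy v)) := by
    have : Continuous fun w : L2Vec Ω => P.energy v + inner ℝ (P.fluxOp v) (w - v) := by fun_prop
    simpa using this.tendsto v
  have h2 : Tendsto (fun w : L2Vec Ω => P.energy v + inner ℝ (P.fluxOp w) (w - v)) (𝓝 v)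
      (𝓝 (P.energy v)) := by
    have : Continuous fun w : L2Vec Ω => P.energy v + inner ℝ (P.fluxOp w) (w - v) :=
      continuous_const.add (P.continuous_fluxOp.inner (by fun_prop))
    simpa using this.tendsto v
  refine tendsto_of_tendsto_of_tendsto_of_le_of_le h1 h2 (fun w => ?_) fun w => ?_
  · have := P.inner_fluxOp_le_energy_sub v w
    simp only
    linarith
  · have := P.energy_sub_le_inner_fluxOp v w
    simp only
    linarith

/-- Convexity at both endpoints traps the difference quotient of the energy between the pairings of
the slope of v with the flux at time t and with the flux at time s. Both converge to the same limit
because the flux operator is continuous. -/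
theorem hasDerivAt_energy {v : ℝ → L2Vec Ω} {v' : L2Vec Ω} {t : ℝ} (hv : HasDerivAt v v' t) :
    HasDerivAt (fun s => P.energy (v s)) (inner ℝ (P.fluxOp (v t)) v') t := by
  rw [hasDerivAt_iff_tendsto_slope] at hv ⊢
  have h1 : Tendsto (fun s => inner ℝ (P.fluxOp (v t)) (slope v t s)) (𝓝[≠] t)
      (𝓝 (inner ℝ (P.fluxOp (v t)) v')) := tendsto_const_nhds.inner hv
  have hc : Tendsto v (𝓝[≠] t) (𝓝 (v t)) :=
    (hasDerivAt_iff_tendsto_slope.2 hv).continuousAt.tendsto.mono_left nhdsWithin_le_nhds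
  have h2 : Tendsto (fun s => inner ℝ (P.fluxOp (v s)) (slope v t s)) (𝓝[≠] t)
      (𝓝 (inner ℝ (P.fluxOp (v t)) v')) :=
    ((P.continuous_fluxOp.tendsto _).comp hc).inner hv
  -- The two bounds exchange roles with the sign of s - t; taking their minimum and maximum treats
  -- both cases at once.
  have key : ∀ s, (inner ℝ (P.fluxOp (v t)) (slope v t s) ≤ slope (fun s => P.energy (v s)) t s ∧
      slope (fun s => P.energy (v s)) t s ≤ inner ℝ (P.fluxOp (v s)) (slope v t s)) ∨
      (inner ℝ (P.fluxOp (v s)) (slope v t s) ≤ slope (fun s => P.energy (v s)) t s ∧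
      slope (fun s => P.energy (v s)) t s ≤ inner ℝ (P.fluxOp (v t)) (slope v t s)) := by
    intro s
    have e1 := P.inner_fluxOp_le_energy_sub (v t) (v s)
    have e2 := P.energy_sub_le_inner_fluxOp (v t) (v s)
    simp only [slope_def_module, real_inner_smul_right, smul_eq_mul]
    rcases le_total 0 (s - t)⁻¹ with h | h
    · exact Or.inl ⟨mul_le_mul_of_nonneg_left e1 h, mul_le_mul_of_nonneg_left e2 h⟩
    · exact Or.inr ⟨mul_le_mul_of_nonpos_left e2 h, mul_le_mul_of_nonpos_left e1 h⟩
  have h3 := h1.min h2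
  have h4 := h1.max h2
  rw [min_self] at h3
  rw [max_self] at h4
  refine tendsto_of_tendsto_of_tendsto_of_le_of_le h3 h4 (fun s => ?_) fun s => ?_
  · rcases key s with h | h
    · exact (min_le_left _ _).trans h.1
    · exact (min_le_right _ _).trans h.1
  · rcases key s with h | h
    · exact h.2.trans (le_max_right _ _)
    · exact h.2.trans (le_max_left _ _)

theorem exists_powInt_le (hb : Bornology.IsBounded Ω) {δ : ℝ} (hδ : 0 < δ) :
    ∃ C, 0 < C ∧ ∀ v : L2Vec Ω, powInt P.β v ≤ δ + C * P.dissip v := by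
  have hfin := isFiniteMeasure_restrict hb
  set m := (volume.restrict Ω).real univ with hm
  have hm0 : 0 ≤ m := measureReal_nonneg
  -- The pointwise error is integrated over measure m. Dividing by m + 1 keeps the total below δ and
  -- allows m = 0.
  obtain ⟨C, hC, h⟩ := P.exists_rpow_le (δ := δ / (m + 1)) (by positivity)
  refine ⟨C, hC, fun v => ?_⟩
  calc powInt P.β v ≤ ∫ x in Ω, (δ / (m + 1) + C * (P.root ‖v x‖ * ‖v x‖)) :=
        integral_mono (integrable_rpow hb P.β_pos P.β_lt_two.le v)
          ((integrable_const _).add ((P.integrable_root_mul v).const_mul C))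
          fun x => h _ (norm_nonneg _)
    _ = m * (δ / (m + 1)) + C * P.dissip v := by
        rw [integral_add (integrable_const _) ((P.integrable_root_mul v).const_mul C),
          integral_const, integral_const_mul, ← dissip_eq, smul_eq_mul]
    _ ≤ _ := by
        have : m * (δ / (m + 1)) ≤ δ := by
          rw [mul_div_assoc', div_le_iff₀ (by positivity)]
          nlinarith
        linarith

end GenPoly

theorem add_rpow_le_mul {x y p : ℝ} (hx : 0 ≤ x) (hy : 0 ≤ y) (hp : 1 ≤ p) :
    (x + y) ^ p ≤ 2 ^ (p - 1) * (x ^ p + y ^ p) := by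
  have := NNReal.rpow_add_le_mul_rpow_add_rpow ⟨x, hx⟩ ⟨y, hy⟩ hp
  exact_mod_cast this

theorem powInt_sub_le (hb : Bornology.IsBounded Ω) {q : ℝ} (hq1 : 1 ≤ q) (hq2 : q ≤ 2)
    (v w : L2Vec Ω) : powInt q (v - w) ≤ 2 * (powInt q v + powInt q w) := by
  have hq0 : 0 < q := by linarith
  have i1 := integrable_rpow hb hq0 hq2 v
  have i2 := integrable_rpow hb hq0 hq2 w
  rw [powInt, powInt, powInt, ← integral_add i1 i2, ← integral_const_mul]
  refine integral_mono_ae (integrable_rpow hb hq0 hq2 (v - w)) ((i1.add i2).const_mul 2) ?_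
  filter_upwards [Lp.coeFn_sub v w] with x hx
  rw [hx, Pi.sub_apply]
  have h1 : ‖v x - w x‖ ^ q ≤ (‖v x‖ + ‖w x‖) ^ q :=
    Real.rpow_le_rpow (norm_nonneg _) (norm_sub_le _ _) hq0.le
  have h2 := add_rpow_le_mul (norm_nonneg (v x)) (norm_nonneg (w x)) hq1
  have h3 : (2 : ℝ) ^ (q - 1) ≤ 2 := by
    calc (2 : ℝ) ^ (q - 1) ≤ 2 ^ (1 : ℝ) :=
          Real.rpow_le_rpow_of_exponent_le (by norm_num) (by linarith)
      _ = 2 := Real.rpow_one 2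
  refine h1.trans (h2.trans (mul_le_mul_of_nonneg_right h3 (by positivity)))

end Operator

/-! ### Comparison principles and Gronwall inequalities. -/

section DifferentialInequalities

/-- If y t > B, take the last time σ at which y is at most B. After σ the function lies above B,
hence does not increase, a contradiction. -/
theorem le_of_deriv_nonpos_above {y y' : ℝ → ℝ} {s t B : ℝ} (hst : s ≤ t)
    (hc : ContinuousOn y (Icc s t)) (hd : ∀ τ ∈ Ioo s t, HasDerivAt y (y' τ) τ)
    (h : ∀ τ ∈ Ioo s t, B < y τ → y' τ ≤ 0) (hs : y s ≤ B) : y t ≤ B := by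
  by_contra! ht
  set S := Icc s t ∩ y ⁻¹' Iic B with hS
  have hScl : IsCompact S :=
    isCompact_Icc.of_isClosed_subset (hc.preimage_isClosed_of_isClosed isClosed_Icc isClosed_Iic)
      inter_subset_left
  have hσ : sSup S ∈ S := hScl.sSup_mem ⟨s, left_mem_Icc.2 hst, hs⟩
  set σ := sSup S
  have hσB : y σ ≤ B := hσ.2
  have habove : ∀ τ ∈ Ioo σ t, B < y τ := by
    intro τ hτ
    by_contra! hle
    have : τ ∈ S := ⟨⟨hσ.1.1.trans hτ.1.le, hτ.2.le⟩, hle⟩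
    exact absurd (le_csSup hScl.bddAbove this) (not_le.2 hτ.1)
  have hanti : AntitoneOn y (Icc σ t) := by
    refine antitoneOn_of_hasDerivWithinAt_nonpos (f' := y') (convex_Icc σ t)
      (hc.mono (Icc_subset_Icc_left hσ.1.1)) (fun τ hτ => ?_) fun τ hτ => ?_
    · rw [interior_Icc] at hτ
      exact (hd τ ⟨hσ.1.1.trans_lt hτ.1, hτ.2⟩).hasDerivWithinAt
    · rw [interior_Icc] at hτ
      exact h τ ⟨hσ.1.1.trans_lt hτ.1, hτ.2⟩ (habove τ hτ)
  have := hanti (left_mem_Icc.2 hσ.1.2) (right_mem_Icc.2 hσ.1.2) hσ.1.2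
  linarith

theorem eventually_le_of_deriv_neg_above {y y' : ℝ → ℝ} {T B κ : ℝ} (hκ : 0 < κ)
    (hd : ∀ τ, T ≤ τ → HasDerivAt y (y' τ) τ) (h : ∀ τ, T ≤ τ → B < y τ → y' τ ≤ -κ) :
    ∀ᶠ t in atTop, y t ≤ B := by
  have hcont : ∀ s t, T ≤ s → ContinuousOn y (Icc s t) := fun s t hs τ hτ =>
    (hd τ (hs.trans hτ.1)).continuousAt.continuousWithinAt
  have hex : ∃ τ, T ≤ τ ∧ y τ ≤ B := by
    by_contra! hab
    -- A function that stays above B decreases at rate at least κ, so it would have reached B by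
    -- this time.
    set t := T + (|y T - B|) / κ with ht
    have hTt : T ≤ t := by
      have : 0 ≤ |y T - B| / κ := by positivity
      linarith
    have hle := image_le_of_deriv_right_le_deriv_boundary (f := y) (f' := y') (a := T) (b := t)
      (B := fun τ => y T - κ * (τ - T)) (B' := fun _ => -κ) (hcont T t le_rfl)
      (fun τ hτ => (hd τ hτ.1).hasDerivWithinAt) (by simp) (by fun_prop)
      (fun τ _ => by
        have := (((hasDerivAt_id τ).sub_const T).const_mul κ).const_sub (y T)
        simpa using this.hasDerivWithinAt)
      (fun τ hτ => h τ hτ.1 (hab τ hτ.1)) (right_mem_Icc.2 hTt)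
    have h1 := hab t hTt
    have h2 : κ * (t - T) = |y T - B| := by
      rw [ht]
      field_simp
      ring
    simp only [h2] at hle
    have := le_abs_self (y T - B)
    linarith
  obtain ⟨τ, hτ, hyτ⟩ := hex
  filter_upwards [eventually_ge_atTop τ] with t ht
  refine le_of_deriv_nonpos_above ht (hcont τ t hτ) (fun σ hσ => hd σ (hτ.trans hσ.1.le))
    (fun σ hσ hB => ?_) hyτ
  have := h σ (hτ.trans hσ.1.le) hB
  linarith

/-- Let B exceed L^{1/p} and pick m with L < m < B^p. Eventually h ≤ m, so wherever y > B its
derivative is at most -c(B^p - m) < 0, and y ends up below B. If L is infinite there is nothing to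
prove. -/
theorem limsup_le_of_deriv_le {y y' h : ℝ → ℝ} {c p : ℝ} (hc : 0 < c) (hp : 0 < p)
    (hd : ∀ t, 0 < t → HasDerivAt y (y' t) t)
    (hy' : ∀ t, 0 < t → y' t ≤ c * (-(y t) ^ p + h t)) :
    limsup (fun t => ENNReal.ofReal (y t)) atTop
      ≤ (limsup (fun t => ENNReal.ofReal (h t)) atTop) ^ (1 / p) := by
  set L := limsup (fun t => ENNReal.ofReal (h t)) atTop with hL
  refine le_of_forall_gt fun b hb => ?_
  obtain ⟨B, hLB, hBb⟩ := exists_between hb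
  refine lt_of_le_of_lt ?_ hBb
  have hBtop : B ≠ ∞ := (hBb.trans_le le_top).ne
  have hLB' : L < B ^ p := by
    rw [one_div] at hLB
    calc L = (L ^ p⁻¹) ^ p := (ENNReal.rpow_inv_rpow hp.ne' L).symm
      _ < B ^ p := ENNReal.rpow_lt_rpow hLB hp
  obtain ⟨m, hLm, hmB⟩ := exists_between hLB'
  have hmtop : m ≠ ∞ := (hmB.trans_le le_top).ne
  have hm0 : 0 < m.toReal := ENNReal.toReal_pos (bot_le.trans_lt hLm).ne' hmtop
  have hB0 : 0 ≤ B.toReal := ENNReal.toReal_nonneg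
  have hmB' : m.toReal < B.toReal ^ p := by
    rw [ENNReal.toReal_rpow]
    exact ENNReal.toReal_strict_mono (ENNReal.rpow_ne_top_of_nonneg hp.le hBtop) hmB
  have hev : ∀ᶠ t in atTop, h t ≤ m.toReal := by
    filter_upwards [eventually_lt_of_limsup_lt hLm] with t ht
    exact ENNReal.ofReal_le_iff_le_toReal hmtop |>.1 ht.le
  obtain ⟨T, hT⟩ := eventually_atTop.1 (hev.and (eventually_gt_atTop 0))
  have hfin : ∀ᶠ t in atTop, y t ≤ B.toReal := by
    refine eventually_le_of_deriv_neg_above (y' := y') (T := T)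
      (κ := c * (B.toReal ^ p - m.toReal)) (mul_pos hc (by linarith))
      (fun τ hτ => hd τ (hT τ hτ).2) fun τ hτ hBy => ?_
    refine (hy' τ (hT τ hτ).2).trans ?_
    rw [← mul_neg]
    refine mul_le_mul_of_nonneg_left ?_ hc.le
    have := Real.rpow_le_rpow hB0 hBy.le hp.le
    have := (hT τ hτ).1
    linarith
  refine limsup_le_of_le (by isBoundedDefault) ?_
  filter_upwards [hfin] with t ht
  exact ENNReal.ofReal_le_of_le_toReal ht

theorem limsup_le_of_deriv_add_le {y y' h : ℝ → ℝ} {c : ℝ} (hc : 0 < c)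
    (hd : ∀ t, 0 < t → HasDerivAt y (y' t) t) (hy' : ∀ t, 0 < t → y' t + c * y t ≤ c * h t) :
    limsup (fun t => ENNReal.ofReal (y t)) atTop
      ≤ limsup (fun t => ENNReal.ofReal (h t)) atTop := by
  have := limsup_le_of_deriv_le (h := h) hc one_pos hd fun t ht => by
    rw [Real.rpow_one]
    linarith [hy' t ht]
  simpa using this

theorem sub_le_integral_of_deriv_le {y y' h : ℝ → ℝ} {s t : ℝ} (hst : s ≤ t)
    (hc : ContinuousOn y (Icc s t)) (hd : ∀ τ ∈ Ioo s t, HasDerivAt y (y' τ) τ)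
    (hh : ContinuousOn h (Icc s t)) (hy' : ∀ τ ∈ Ioo s t, y' τ ≤ h τ) :
    y t - y s ≤ ∫ τ in s..t, h τ :=
  intervalIntegral.sub_le_integral_of_hasDeriv_right_of_le hst hc
    (fun τ hτ => (hd τ hτ).hasDerivWithinAt) (hh.integrableOn_compact isCompact_Icc) hy'

/-- The source h need not be integrable at the left end. The inequality is integrated from σ > s,
and then σ → s by continuity of y; the extended-valued integral covers the divergent case. -/
theorem ofReal_le_add_lintegral {y y' h : ℝ → ℝ} {s t : ℝ} (hst : s ≤ t)
    (hc : ContinuousOn y (Icc s t)) (hd : ∀ τ ∈ Ioo s t, HasDerivAt y (y' τ) τ)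
    (hh : ContinuousOn h (Ioc s t)) (hh0 : ∀ τ ∈ Ioc s t, 0 ≤ h τ)
    (hy' : ∀ τ ∈ Ioo s t, y' τ ≤ h τ) :
    ENNReal.ofReal (y t) ≤ ENNReal.ofReal (y s) + ∫⁻ τ in Ioo s t, ENNReal.ofReal (h τ) := by
  rcases hst.eq_or_lt with rfl | hst
  · simp
  have key : ∀ σ ∈ Ioo s t,
      ENNReal.ofReal (y t) ≤ ENNReal.ofReal (y σ) + ∫⁻ τ in Ioo s t, ENNReal.ofReal (h τ) := by
    intro σ hσ
    have hsub : Icc σ t ⊆ Ioc s t := fun τ hτ => ⟨hσ.1.trans_le hτ.1, hτ.2⟩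
    have hi := sub_le_integral_of_deriv_le hσ.2.le (hc.mono (Icc_subset_Icc_left hσ.1.le))
      (fun τ hτ => hd τ ⟨hσ.1.trans hτ.1, hτ.2⟩) (hh.mono hsub)
      (fun τ hτ => hy' τ ⟨hσ.1.trans hτ.1, hτ.2⟩)
    rw [intervalIntegral.integral_of_le hσ.2.le, integral_Ioc_eq_integral_Ioo] at hi
    have hsub' : Ioo σ t ⊆ Ioc s t := Ioo_subset_Icc_self.trans hsub
    have e := ofReal_integral_eq_lintegral_ofReal (μ := volume.restrict (Ioo σ t)) (f := h)
      (((hh.mono hsub).integrableOn_compact isCompact_Icc).mono_set Ioo_subset_Icc_self)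
      ((ae_restrict_iff' measurableSet_Ioo).2 (ae_of_all _ fun τ hτ => hh0 τ (hsub' hτ)))
    calc ENNReal.ofReal (y t) ≤ ENNReal.ofReal (y σ + ∫ τ in Ioo σ t, h τ) :=
          ENNReal.ofReal_le_ofReal (by linarith)
      _ ≤ ENNReal.ofReal (y σ) + ENNReal.ofReal (∫ τ in Ioo σ t, h τ) := ENNReal.ofReal_add_le
      _ ≤ _ := by
          rw [e]
          gcongr
          exact hσ.1.le
  have hlim : Tendsto (fun σ => ENNReal.ofReal (y σ) + ∫⁻ τ in Ioo s t, ENNReal.ofReal (h τ))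
      (𝓝[>] s) (𝓝 (ENNReal.ofReal (y s) + ∫⁻ τ in Ioo s t, ENNReal.ofReal (h τ))) := by
    refine Tendsto.add_const _ (ENNReal.tendsto_ofReal ?_)
    have := (hc s (left_mem_Icc.2 hst.le)).mono_left
      (nhdsWithin_mono s (Ioo_subset_Icc_self (a := s) (b := t)))
    rwa [nhdsWithin_Ioo_eq_nhdsGT hst] at this
  refine ge_of_tendsto hlim ?_
  filter_upwards [Ioo_mem_nhdsGT hst] with σ hσ using key σ hσ

/-- Integrating factor normalised to 1 at the final time. -/
theorem gronwall_lintegral {y y' h : ℝ → ℝ} {s t k : ℝ} (hst : s ≤ t)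
    (hc : ContinuousOn y (Icc s t)) (hd : ∀ τ ∈ Ioo s t, HasDerivAt y (y' τ) τ)
    (hh : ContinuousOn h (Ioc s t)) (hh0 : ∀ τ ∈ Ioc s t, 0 ≤ h τ)
    (hy' : ∀ τ ∈ Ioo s t, y' τ + k * y τ ≤ h τ) :
    ENNReal.ofReal (y t) ≤ ENNReal.ofReal (Real.exp (-k * (t - s)) * y s)
      + ∫⁻ τ in Ioo s t, ENNReal.ofReal (Real.exp (-k * (t - τ)) * h τ) := by
  have hE : Continuous fun τ => Real.exp (-k * (t - τ)) := by fun_prop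
  have := ofReal_le_add_lintegral (y := fun τ => Real.exp (-k * (t - τ)) * y τ)
    (y' := fun τ => Real.exp (-k * (t - τ)) * k * y τ + Real.exp (-k * (t - τ)) * y' τ)
    (h := fun τ => Real.exp (-k * (t - τ)) * h τ) hst (hE.continuousOn.mul hc)
    (fun τ hτ => by
      refine HasDerivAt.mul ?_ (hd τ hτ)
      have := ((((hasDerivAt_id τ).const_sub t)).const_mul (-k)).exp
      simpa using this)
    (hE.continuousOn.mul hh) (fun τ hτ => mul_nonneg (Real.exp_pos _).le (hh0 τ hτ))
    (fun τ hτ => by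
      have := mul_le_mul_of_nonneg_left (hy' τ hτ) (Real.exp_pos (-k * (t - τ))).le
      linarith)
  simpa using this

end DifferentialInequalities

/-! ### Upper limits of extended nonnegative functions. -/

section Limsup

theorem limsup_add_le_ennreal {ι : Type*} {l : Filter ι} (u v : ι → ℝ≥0∞) :
    limsup (fun t => u t + v t) l ≤ limsup u l + limsup v l := by
  refine ENNReal.le_of_forall_pos_le_add fun ε hε hfin => ?_
  have hu : limsup u l ≠ ∞ := (ENNReal.add_lt_top.1 hfin).1.ne
  have hv : limsup v l ≠ ∞ := (ENNReal.add_lt_top.1 hfin).2.ne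
  have hε' : ((ε : ℝ≥0∞) / 2) ≠ 0 := by simpa using hε.ne'
  refine limsup_le_of_le (by isBoundedDefault) ?_
  filter_upwards [eventually_lt_of_limsup_lt (ENNReal.lt_add_right hu hε'),
    eventually_lt_of_limsup_lt (ENNReal.lt_add_right hv hε')] with t h1 h2
  calc u t + v t ≤ (limsup u l + ε / 2) + (limsup v l + ε / 2) := add_le_add h1.le h2.le
    _ = limsup u l + limsup v l + (ε / 2 + ε / 2) := by ring
    _ = _ := by rw [ENNReal.add_halves]

theorem limsup_const_mul_ennreal {ι : Type*} {l : Filter ι} [l.NeBot] {c : ℝ≥0∞} (hc : c ≠ ∞)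
    (u : ι → ℝ≥0∞) : limsup (fun t => c * u t) l = c * limsup u l :=
  (Monotone.map_limsup_of_continuousAt (f := fun x => c * x)
    (fun _ _ h => mul_le_mul_right h c) u
    (ENNReal.continuous_const_mul hc).continuousAt).symm

theorem limsup_const_add_ennreal {ι : Type*} {l : Filter ι} [l.NeBot] (c : ℝ≥0∞)
    (u : ι → ℝ≥0∞) : limsup (fun t => c + u t) l = c + limsup u l :=
  (Monotone.map_limsup_of_continuousAt (f := fun x => c + x)
    (fun _ _ h => add_le_add_right h c) u
    (continuous_const.add continuous_id).continuousAt).symm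

theorem limsup_mono_ennreal {u v : ℝ → ℝ≥0∞} (h : ∀ t, 0 < t → u t ≤ v t) :
    limsup u atTop ≤ limsup v atTop := by
  refine limsup_le_limsup ?_
  filter_upwards [eventually_gt_atTop 0] with t ht using h t ht

end Limsup

/-! ### Differential inequalities satisfied by a solution. -/

section Solution

variable {d : ℕ} {Ω : Set (EuclideanSpace ℝ (Fin d))} {P : GenPoly} {φ : ℝ → H1 Ω} {f : ℝ → L2 Ω}
  {ρ₀ : H1 Ω} {ρt : ℝ → H1 Ω}

theorem hasDerivAt_of_contDiffOn {F : Type*} [NormedAddCommGroup F] [NormedSpace ℝ F] {u : ℝ → F}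
    (hu : ContDiffOn ℝ 1 u (Ioi 0)) {t : ℝ} (ht : 0 < t) : HasDerivAt u (deriv u t) t :=
  ((hu.differentiableOn one_ne_zero t ht).differentiableAt (Ioi_mem_nhds ht)).hasDerivAt

theorem continuousOn_deriv_of_contDiffOn {F : Type*} [NormedAddCommGroup F] [NormedSpace ℝ F]
    {u : ℝ → F} (hu : ContDiffOn ℝ 1 u (Ioi 0)) : ContinuousOn (deriv u) (Ioi 0) :=
  hu.continuousOn_deriv_of_isOpen isOpen_Ioi le_rfl

namespace IsWeakSolution

theorem hasDerivAt (hsol : IsWeakSolution P φ f ρ₀ ρt) {t : ℝ} (ht : 0 < t) :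
    HasDerivAt ρt (deriv ρt t) t := hasDerivAt_of_contDiffOn hsol.contDiffOn_H1 ht

theorem hasDerivAt_toL2 (hsol : IsWeakSolution P φ f ρ₀ ρt) {t : ℝ} (ht : 0 < t) :
    HasDerivAt (fun s => toL2 (ρt s)) (toL2 (deriv ρt t)) t :=
  toL2L.hasFDerivAt.comp_hasDerivAt t (hsol.hasDerivAt ht)

/-- Difference quotients stay in the closed subspace. This makes ρ̃_t an admissible test function.
-/
theorem deriv_mem_H01 (hsol : IsWeakSolution P φ f ρ₀ ρt) {t : ℝ} (ht : 0 < t) :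
    deriv ρt t ∈ H01 Ω := by
  have h := hasDerivAt_iff_tendsto_slope.1 (hsol.hasDerivAt ht)
  refine isClosed_H01.mem_of_tendsto h ?_
  filter_upwards [nhdsWithin_le_nhds (Ioi_mem_nhds ht)] with s hs
  rw [slope_def_module]
  exact smul_mem_H01 _ (sub_mem_H01 (hsol.mem_H01 s (le_of_lt hs)) (hsol.mem_H01 t ht.le))

theorem variational' (hsol : IsWeakSolution P φ f ρ₀ ρt) {t : ℝ} (ht : 0 < t) {w : H1 Ω}
    (hw : w ∈ H01 Ω) :
    inner ℝ (toL2 (deriv ρt t)) (toL2 w)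
      + inner ℝ (P.fluxOp (grad (ρt t + φ t))) (grad w) = inner ℝ (fTilde φ f t) (toL2 w) := by
  rw [P.inner_fluxOp]
  exact hsol.variational t ht w hw

/-- ρ̃ is only C¹ into H¹(Ω), but `toL2` commutes with the first derivative, so the C² regularity in
L²(Ω) makes ρ̃_t differentiable there. -/
theorem hasDerivAt_toL2_deriv (hsol : IsWeakSolution P φ f ρ₀ ρt) {t : ℝ} (ht : 0 < t) :
    HasDerivAt (fun s => toL2 (deriv ρt s)) (deriv (fun s => toL2 (deriv ρt s)) t) t := by
  have h1 : ContDiffOn ℝ 1 (deriv fun s => toL2 (ρt s)) (Ioi 0) :=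
    hsol.contDiffOn_L2.deriv_of_isOpen isOpen_Ioi (by norm_num)
  refine hasDerivAt_of_contDiffOn (h1.congr fun s hs => ?_) ht
  exact (hsol.hasDerivAt_toL2 hs).deriv.symm

end IsWeakSolution

/-- `‖ρ̃‖²`. -/
def massSq (ρt : ℝ → H1 Ω) (t : ℝ) : ℝ := ‖toL2 (ρt t)‖ ^ 2

/-- `‖ρ̃_t‖²`. -/
def rateSq (ρt : ℝ → H1 Ω) (t : ℝ) : ℝ := ‖toL2 (deriv ρt t)‖ ^ 2

/-- The energy of `∇ρ`. -/
def energyAt (P : GenPoly) (φ ρt : ℝ → H1 Ω) (t : ℝ) : ℝ := P.energy (grad (ρt t + φ t))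

/-- The right-hand side `‖ρ̃‖² + ‖φ‖₁² + ‖f̃‖² + ‖φ_t‖₁²` of the energy inequalities. -/
def forcing (φ : ℝ → H1 Ω) (f : ℝ → L2 Ω) (ρt : ℝ → H1 Ω) (t : ℝ) : ℝ :=
  massSq ρt t + ‖φ t‖ ^ 2 + ‖fTilde φ f t‖ ^ 2 + ‖deriv φ t‖ ^ 2

theorem forcing_nonneg (φ : ℝ → H1 Ω) (f : ℝ → L2 Ω) (ρt : ℝ → H1 Ω) (t : ℝ) :
    0 ≤ forcing φ f ρt t := by
  unfold forcing massSq
  positivity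

theorem massSq_nonneg (ρt : ℝ → H1 Ω) (t : ℝ) : 0 ≤ massSq ρt t := sq_nonneg _

theorem rateSq_nonneg (ρt : ℝ → H1 Ω) (t : ℝ) : 0 ≤ rateSq ρt t := sq_nonneg _

theorem energyAt_nonneg (P : GenPoly) (φ ρt : ℝ → H1 Ω) (t : ℝ) : 0 ≤ energyAt P φ ρt t :=
  P.energy_nonneg _

theorem hasDerivAt_massSq (hsol : IsWeakSolution P φ f ρ₀ ρt) {t : ℝ} (ht : 0 < t) :
    HasDerivAt (massSq ρt) (2 * inner ℝ (toL2 (ρt t)) (toL2 (deriv ρt t))) t :=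
  (hsol.hasDerivAt_toL2 ht).norm_sq

theorem hasDerivAt_rateSq (hsol : IsWeakSolution P φ f ρ₀ ρt) {t : ℝ} (ht : 0 < t) :
    HasDerivAt (rateSq ρt)
      (2 * inner ℝ (toL2 (deriv ρt t)) (deriv (fun s => toL2 (deriv ρt s)) t)) t :=
  (hsol.hasDerivAt_toL2_deriv ht).norm_sq

theorem hasDerivAt_energyAt (hreg : IsRegularData φ f) (hsol : IsWeakSolution P φ f ρ₀ ρt)
    {t : ℝ} (ht : 0 < t) :
    HasDerivAt (energyAt P φ ρt)
      (inner ℝ (P.fluxOp (grad (ρt t + φ t))) (grad (deriv ρt t + deriv φ t))) t :=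
  P.hasDerivAt_energy (gradL.hasFDerivAt.comp_hasDerivAt t
    ((hsol.hasDerivAt ht).add (hasDerivAt_of_contDiffOn hreg.contDiffOn_φ ht)))

theorem continuousOn_massSq (hsol : IsWeakSolution P φ f ρ₀ ρt) :
    ContinuousOn (massSq ρt) (Ici 0) :=
  (toL2L.continuous.comp_continuousOn hsol.continuousOn).norm.pow 2

theorem continuousOn_energyAt (hreg : IsRegularData φ f) (hsol : IsWeakSolution P φ f ρ₀ ρt) :
    ContinuousOn (energyAt P φ ρt) (Ici 0) :=
  P.continuous_energy.comp_continuousOn (gradL.continuous.comp_continuousOn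
    (hsol.continuousOn.add hreg.continuousOn_φ))

theorem continuousOn_deriv_fTilde_sq (hreg : IsRegularData φ f) :
    ContinuousOn (fun t => ‖deriv (fTilde φ f) t‖ ^ 2) (Ioi 0) :=
  (continuousOn_deriv_of_contDiffOn hreg.contDiffOn_fTilde).norm.pow 2

/-- Young's inequality weighted so that the flux part is paid for by the fraction ε of the
dissipation. -/
theorem inner_fluxOp_grad_le (P : GenPoly) {ε : ℝ} (hε : 0 < ε) (v : L2Vec Ω) (u : H1 Ω) :
    inner ℝ (P.fluxOp v) (grad u) ≤ ε * P.dissip v + (4 * ε * P.coeff 0)⁻¹ * ‖u‖ ^ 2 := by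
  have h0 := P.coeff_zero_pos
  have h1 := P.norm_fluxOp_sq_le v
  have h2 : inner ℝ (P.fluxOp v) (grad u) ≤ ‖P.fluxOp v‖ * ‖u‖ :=
    (real_inner_le_norm _ _).trans
      (mul_le_mul_of_nonneg_left (norm_grad_le u) (norm_nonneg _))
  have h3 : ‖P.fluxOp v‖ * ‖u‖ ≤
      ε * (P.coeff 0 * ‖P.fluxOp v‖ ^ 2) + (4 * ε * P.coeff 0)⁻¹ * ‖u‖ ^ 2 := by
    have h4 : ε * (P.coeff 0 * ‖P.fluxOp v‖ ^ 2) + (4 * ε * P.coeff 0)⁻¹ * ‖u‖ ^ 2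
        - ‖P.fluxOp v‖ * ‖u‖
        = (4 * ε * P.coeff 0)⁻¹ * (2 * ε * P.coeff 0 * ‖P.fluxOp v‖ - ‖u‖) ^ 2 := by
      field_simp
      ring
    have h5 : 0 ≤ (4 * ε * P.coeff 0)⁻¹ * (2 * ε * P.coeff 0 * ‖P.fluxOp v‖ - ‖u‖) ^ 2 := by
      positivity
    linarith
  have := mul_le_mul_of_nonneg_left h1 hε.le
  linarith

theorem dissip_eq_of_solution (hsol : IsWeakSolution P φ f ρ₀ ρt) {t : ℝ} (ht : 0 < t) :
    P.dissip (grad (ρt t + φ t)) = inner ℝ (fTilde φ f t) (toL2 (ρt t))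
      - inner ℝ (toL2 (ρt t)) (toL2 (deriv ρt t))
      + inner ℝ (P.fluxOp (grad (ρt t + φ t))) (grad (φ t)) := by
  have h := hsol.variational' ht (hsol.mem_H01 t ht.le)
  have e : P.dissip (grad (ρt t + φ t)) =
      inner ℝ (P.fluxOp (grad (ρt t + φ t))) (grad (ρt t))
      + inner ℝ (P.fluxOp (grad (ρt t + φ t))) (grad (φ t)) := by
    rw [← inner_add_right, ← grad_add]
    rfl
  rw [e, real_inner_comm (toL2 (deriv ρt t)) (toL2 (ρt t))]
  linarith

theorem deriv_massSq_le (hsol : IsWeakSolution P φ f ρ₀ ρt) {t : ℝ} (ht : 0 < t) :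
    2 * inner ℝ (toL2 (ρt t)) (toL2 (deriv ρt t)) + P.dissip (grad (ρt t + φ t))
      ≤ (P.coeff 0)⁻¹ * ‖φ t‖ ^ 2 + 2 * (‖fTilde φ f t‖ * ‖toL2 (ρt t)‖) := by
  have h1 := dissip_eq_of_solution hsol ht
  have h2 := inner_fluxOp_grad_le P (ε := 1 / 2) (by norm_num) (grad (ρt t + φ t)) (φ t)
  have h3 := real_inner_le_norm (fTilde φ f t) (toL2 (ρt t))
  have e : (4 * (1 / 2 : ℝ) * P.coeff 0)⁻¹ = (P.coeff 0)⁻¹ / 2 := by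
    rw [mul_inv]
    norm_num
    ring
  rw [e] at h2
  linarith

/-- The constant in the differential inequalities. -/
def GenPoly.cst (P : GenPoly) : ℝ := 3 + 2 * (P.coeff 0)⁻¹

theorem inv_coeff_pos (P : GenPoly) : 0 < (P.coeff 0)⁻¹ := inv_pos.2 P.coeff_zero_pos

theorem cst_pos (P : GenPoly) : 0 < P.cst := by
  have := inv_coeff_pos P
  unfold GenPoly.cst
  positivity

theorem deriv_massSq_add_energyAt_le (hsol : IsWeakSolution P φ f ρ₀ ρt) {t : ℝ} (ht : 0 < t) :
    2 * inner ℝ (toL2 (ρt t)) (toL2 (deriv ρt t)) + energyAt P φ ρt t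
      ≤ P.cst * (massSq ρt t + ‖φ t‖ ^ 2 + ‖fTilde φ f t‖ ^ 2) := by
  have h1 := deriv_massSq_le hsol ht
  have h2 := P.energy_le_dissip (grad (ρt t + φ t))
  have h3 := two_mul_le_add_sq ‖fTilde φ f t‖ ‖toL2 (ρt t)‖
  have h0 := inv_coeff_pos P
  have p1 := mul_nonneg h0.le (sq_nonneg ‖φ t‖)
  have p2 := mul_nonneg h0.le (sq_nonneg ‖fTilde φ f t‖)
  have p3 := mul_nonneg h0.le (sq_nonneg ‖toL2 (ρt t)‖)
  unfold energyAt massSq GenPoly.cst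
  linarith [sq_nonneg ‖φ t‖, sq_nonneg ‖fTilde φ f t‖, sq_nonneg ‖toL2 (ρt t)‖]

/-- Testing with ρ̃_t turns E' into (f̃, ρ̃_t) - ‖ρ̃_t‖² plus the pairing of the flux with ∇φ_t. A
multiple of the identity for J obtained by testing with ρ̃ is added (3/2 suffices): it supplies the
term E/2 and absorbs the pairings with ∇φ and ∇φ_t, while the products with ρ̃_t use up part of
‖ρ̃_t‖². -/
theorem deriv_energyAt_le (hsol : IsWeakSolution P φ f ρ₀ ρt) {t : ℝ} (ht : 0 < t) :
    inner ℝ (P.fluxOp (grad (ρt t + φ t))) (grad (deriv ρt t + deriv φ t))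
      + 1 / 4 * rateSq ρt t + 1 / 2 * energyAt P φ ρt t ≤ P.cst * forcing φ f ρt t := by
  have h1 := dissip_eq_of_solution hsol ht
  have h2 := inner_fluxOp_grad_le P (ε := 1 / 2) (by norm_num) (grad (ρt t + φ t)) (φ t)
  have h3 := inner_fluxOp_grad_le P (ε := 1 / 4) (by norm_num) (grad (ρt t + φ t)) (deriv φ t)
  have h4 := hsol.variational' ht (hsol.deriv_mem_H01 ht)
  rw [real_inner_self_eq_norm_sq] at h4
  have h5 := P.energy_le_dissip (grad (ρt t + φ t))
  have h6 := real_inner_le_norm (fTilde φ f t) (toL2 (ρt t))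
  have h7 := real_inner_le_norm (fTilde φ f t) (toL2 (deriv ρt t))
  have h8 := (abs_le.1 (abs_real_inner_le_norm (toL2 (ρt t)) (toL2 (deriv ρt t)))).1
  have s1 := sq_nonneg (‖toL2 (deriv ρt t)‖ - 2 * ‖fTilde φ f t‖)
  have s2 := sq_nonneg (‖toL2 (deriv ρt t)‖ - 2 * ‖toL2 (ρt t)‖)
  have s3 := sq_nonneg (‖fTilde φ f t‖ - ‖toL2 (ρt t)‖)
  have s4 := sq_nonneg ‖toL2 (deriv ρt t)‖
  have s5 := sq_nonneg ‖φ t‖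
  have s6 := sq_nonneg ‖fTilde φ f t‖
  have s7 := sq_nonneg ‖toL2 (ρt t)‖
  have s8 := sq_nonneg ‖deriv φ t‖
  have e1 : (4 * (1 / 2 : ℝ) * P.coeff 0)⁻¹ = (P.coeff 0)⁻¹ / 2 := by
    rw [mul_inv]
    norm_num
    ring
  have e2 : (4 * (1 / 4 : ℝ) * P.coeff 0)⁻¹ = (P.coeff 0)⁻¹ := by norm_num
  rw [e1] at h2
  rw [e2] at h3
  rw [grad_add (deriv ρt t), inner_add_right]
  have h0 := inv_coeff_pos P
  have p1 := mul_nonneg h0.le (sq_nonneg ‖φ t‖)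
  have p2 := mul_nonneg h0.le (sq_nonneg ‖fTilde φ f t‖)
  have p3 := mul_nonneg h0.le (sq_nonneg ‖toL2 (ρt t)‖)
  have p4 := mul_nonneg h0.le (sq_nonneg ‖deriv φ t‖)
  unfold energyAt forcing massSq rateSq GenPoly.cst
  linarith

/-- This replaces differentiating the equation in time. The equations at s and t are subtracted and
tested with ρ̃(s) - ρ̃(t). Cocoercivity absorbs the increment of the flux and leaves ‖φ(s) -
φ(t)‖²/(4a₀). Dividing by (s - t)² and letting s → t gives the claim. -/
theorem inner_deriv_rate_le (hreg : IsRegularData φ f) (hsol : IsWeakSolution P φ f ρ₀ ρt)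
    {t : ℝ} (ht : 0 < t) :
    inner ℝ (deriv (fun s => toL2 (deriv ρt s)) t) (toL2 (deriv ρt t))
      ≤ inner ℝ (deriv (fTilde φ f) t) (toL2 (deriv ρt t))
        + (4 * P.coeff 0)⁻¹ * ‖deriv φ t‖ ^ 2 := by
  have h0 := P.coeff_zero_pos
  have key : ∀ s, 0 < s →
      inner ℝ (slope (fun s => toL2 (deriv ρt s)) t s) (slope (fun s => toL2 (ρt s)) t s)
        ≤ inner ℝ (slope (fTilde φ f) t s) (slope (fun s => toL2 (ρt s)) t s)
          + (4 * P.coeff 0)⁻¹ * ‖slope φ t s‖ ^ 2 := by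
    intro s hs
    have hw := sub_mem_H01 (hsol.mem_H01 s hs.le) (hsol.mem_H01 t ht.le)
    have v1 := hsol.variational' hs hw
    have v2 := hsol.variational' ht hw
    set F₁ := P.fluxOp (grad (ρt s + φ s))
    set F₂ := P.fluxOp (grad (ρt t + φ t))
    have c1 : P.coeff 0 * ‖F₁ - F₂‖ ^ 2 ≤
        inner ℝ (F₁ - F₂) (grad (ρt s + φ s) - grad (ρt t + φ t)) := P.fluxOp_cocoercive _ _
    have eg : grad (ρt s + φ s) - grad (ρt t + φ t) = grad (ρt s - ρt t) + grad (φ s - φ t) := by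
      simp only [grad_add, grad_sub]
      abel
    rw [eg, inner_add_right, inner_sub_left (x := F₁) (y := F₂) (z := grad (ρt s - ρt t))] at c1
    have c2 : inner ℝ (F₁ - F₂) (grad (φ s - φ t)) ≤ ‖F₁ - F₂‖ * ‖φ s - φ t‖ :=
      (real_inner_le_norm _ _).trans
        (mul_le_mul_of_nonneg_left (norm_grad_le _) (norm_nonneg _))
    have c3 : ‖F₁ - F₂‖ * ‖φ s - φ t‖ ≤ P.coeff 0 * ‖F₁ - F₂‖ ^ 2
        + (4 * P.coeff 0)⁻¹ * ‖φ s - φ t‖ ^ 2 := by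
      have e : P.coeff 0 * ‖F₁ - F₂‖ ^ 2 + (4 * P.coeff 0)⁻¹ * ‖φ s - φ t‖ ^ 2
          - ‖F₁ - F₂‖ * ‖φ s - φ t‖
          = (4 * P.coeff 0)⁻¹ * (2 * P.coeff 0 * ‖F₁ - F₂‖ - ‖φ s - φ t‖) ^ 2 := by
        field_simp
        ring
      have : 0 ≤ (4 * P.coeff 0)⁻¹ * (2 * P.coeff 0 * ‖F₁ - F₂‖ - ‖φ s - φ t‖) ^ 2 := by
        positivity
      linarith
    have main : inner ℝ (toL2 (deriv ρt s) - toL2 (deriv ρt t)) (toL2 (ρt s) - toL2 (ρt t))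
        ≤ inner ℝ (fTilde φ f s - fTilde φ f t) (toL2 (ρt s) - toL2 (ρt t))
          + (4 * P.coeff 0)⁻¹ * ‖φ s - φ t‖ ^ 2 := by
      rw [← toL2_sub (ρt s), inner_sub_left, inner_sub_left]
      linarith
    have hsq : 0 ≤ (s - t)⁻¹ * (s - t)⁻¹ := mul_self_nonneg _
    have := mul_le_mul_of_nonneg_left main hsq
    simp only [slope_def_module, real_inner_smul_left, real_inner_smul_right, norm_smul,
      Real.norm_eq_abs, mul_pow, sq_abs]
    linarith
  have t1 := hasDerivAt_iff_tendsto_slope.1 (hsol.hasDerivAt_toL2_deriv ht)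
  have t2 := hasDerivAt_iff_tendsto_slope.1 (hsol.hasDerivAt_toL2 ht)
  have t3 := hasDerivAt_iff_tendsto_slope.1 (hasDerivAt_of_contDiffOn hreg.contDiffOn_fTilde ht)
  have t4 := hasDerivAt_iff_tendsto_slope.1 (hasDerivAt_of_contDiffOn hreg.contDiffOn_φ ht)
  refine le_of_tendsto_of_tendsto (t1.inner t2)
    ((t3.inner t2).add ((t4.norm.pow 2).const_mul _)) ?_
  filter_upwards [nhdsWithin_le_nhds (Ioi_mem_nhds ht)] with s hs using key s hs

theorem deriv_rateSq_le (hreg : IsRegularData φ f) (hsol : IsWeakSolution P φ f ρ₀ ρt)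
    {t : ℝ} (ht : 0 < t) :
    2 * inner ℝ (toL2 (deriv ρt t)) (deriv (fun s => toL2 (deriv ρt s)) t)
      ≤ rateSq ρt t + ‖deriv (fTilde φ f) t‖ ^ 2 + P.cst * forcing φ f ρt t := by
  have h1 := inner_deriv_rate_le hreg hsol ht
  rw [real_inner_comm] at h1
  have h2 := real_inner_le_norm (deriv (fTilde φ f) t) (toL2 (deriv ρt t))
  have h3 := two_mul_le_add_sq ‖deriv (fTilde φ f) t‖ ‖toL2 (deriv ρt t)‖
  have h0 := inv_coeff_pos P
  have e : (4 * P.coeff 0)⁻¹ = (P.coeff 0)⁻¹ / 4 := by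
    rw [mul_inv]
    ring
  rw [e] at h1
  have h4 : (P.coeff 0)⁻¹ * ‖deriv φ t‖ ^ 2 ≤ P.cst * forcing φ f ρt t := by
    refine mul_le_mul ?_ ?_ (sq_nonneg _) (cst_pos P).le
    · unfold GenPoly.cst
      linarith
    · unfold forcing massSq
      have := sq_nonneg ‖toL2 (ρt t)‖
      have := sq_nonneg ‖φ t‖
      have := sq_nonneg ‖fTilde φ f t‖
      linarith
  have h5 := mul_nonneg h0.le (sq_nonneg ‖deriv φ t‖)
  unfold rateSq
  linarith

end Solution

/-! ### Bounds of the L² norm of the solution. -/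

section Mass

variable {d : ℕ} {Ω : Set (EuclideanSpace ℝ (Fin d))} {P : GenPoly} {φ : ℝ → H1 Ω} {f : ℝ → L2 Ω}
  {ρ₀ : H1 Ω} {ρt : ℝ → H1 Ω}

theorem GenPoly.dissip_grad_le (P : GenPoly) (u : H1 Ω) :
    P.dissip (grad u) ≤ (P.coeff 0)⁻¹ * ‖u‖ ^ 2 := by
  refine (P.dissip_le _).trans (mul_le_mul_of_nonneg_left ?_ (inv_coeff_pos P).le)
  exact pow_le_pow_left₀ (norm_nonneg _) (norm_grad_le u) 2

/-- The space `Ω` supports the Poincaré–Sobolev inequality with the exponent `β`. -/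
def SobolevIneq (P : GenPoly) (Ω : Set (EuclideanSpace ℝ (Fin d))) : Prop :=
  ∃ C : ℝ, 0 < C ∧ ∀ u ∈ H01 Ω, ‖toL2 u‖ ^ P.β ≤ C * powInt P.β (grad u)

/-- Sobolev, the splitting ∇ρ̃ = ∇ρ - ∇φ and coercivity bound ‖ρ̃‖^β by δ/2 + M J + C‖φ‖₁², so the
dissipation forces decay of order ‖ρ̃‖^β. Half of that decay absorbs the source term by Young's
inequality, which is where ‖f̃‖^λ arises. -/
theorem exists_deriv_massSq_le (hb : Bornology.IsBounded Ω) (hS : SobolevIneq P Ω)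
    {δ : ℝ} (hδ : 0 < δ) :
    ∃ c D : ℝ, 0 < c ∧ 0 < D ∧ ∀ (φ : ℝ → H1 Ω) (f : ℝ → L2 Ω) (ρ₀ : H1 Ω) (ρt : ℝ → H1 Ω),
      IsWeakSolution P φ f ρ₀ ρt → ∀ t, 0 < t →
        2 * inner ℝ (toL2 (ρt t)) (toL2 (deriv ρt t))
          ≤ c * (-(massSq ρt t) ^ (P.β / 2) + (δ + D * gFun P φ f t)) := by
  obtain ⟨S, hS0, hS⟩ := hS
  -- This tolerance is spent twice, for ∇ρ and for ∇φ, and is multiplied by 2S, for a total of δ/2.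
  obtain ⟨R, hR0, hR⟩ := P.exists_powInt_le (Ω := Ω) hb (δ := δ / (8 * S)) (by positivity)
  have hβ := P.one_lt_β
  have hβ2 := P.β_lt_two
  have ha := inv_coeff_pos P
  set A := (P.coeff 0)⁻¹ with hA
  set M := 2 * S * R with hM
  have hM0 : 0 < M := by positivity
  -- With this κ, Young applied to (κ r)(2‖f̃‖/κ) costs at most r^β/(2M), half of the available
  -- decay r^β/M.
  set κ := (1 / (2 * M)) ^ (P.β)⁻¹ with hκ
  have hκ0 : 0 < κ := by positivity
  have hκβ : κ ^ P.β = 1 / (2 * M) := Real.rpow_inv_rpow (by positivity) P.β_pos.ne'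
  set N := (2 / κ) ^ P.lam with hN
  have hN0 : 0 < N := by positivity
  refine ⟨1 / (2 * M), 2 * M * (2 * A + N), by positivity, by positivity, ?_⟩
  intro φ f ρ₀ ρt hsol t ht
  have h1 := deriv_massSq_le hsol ht
  have h2 := hS _ (hsol.mem_H01 t ht.le)
  have e : grad (ρt t) = grad (ρt t + φ t) - grad (φ t) := by rw [grad_add]; abel
  have h3 := powInt_sub_le hb hβ.le hβ2.le (grad (ρt t + φ t)) (grad (φ t))
  rw [← e] at h3
  have h4 := hR (grad (ρt t + φ t))
  have h5 := hR (grad (φ t))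
  have h6 := P.dissip_grad_le (φ t)
  set J := P.dissip (grad (ρt t + φ t))
  have hmass : massSq ρt t ^ (P.β / 2) = ‖toL2 (ρt t)‖ ^ P.β := by
    rw [massSq, ← Real.rpow_natCast, ← Real.rpow_mul (norm_nonneg _)]
    congr 1
    push_cast
    ring
  rw [hmass]
  set r := ‖toL2 (ρt t)‖ with hr
  have hr0 : 0 ≤ r := norm_nonneg _
  have h7 : r ^ P.β ≤ δ / 2 + M * J + M * (A * ‖φ t‖ ^ 2) := by
    calc r ^ P.β ≤ S * powInt P.β (grad (ρt t)) := h2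
      _ ≤ S * (2 * ((δ / (8 * S) + R * J) + (δ / (8 * S) + R * (A * ‖φ t‖ ^ 2)))) := by
          refine mul_le_mul_of_nonneg_left (h3.trans ?_) hS0.le
          have := mul_le_mul_of_nonneg_left h6 hR0.le
          linarith
      _ = _ := by
          rw [hM]
          field_simp
          ring
  have h8 : 2 * (‖fTilde φ f t‖ * r) ≤ 1 / (2 * M) * r ^ P.β + N * ‖fTilde φ f t‖ ^ P.lam := by
    have hy := Real.young_inequality_of_nonneg (mul_nonneg hκ0.le hr0)
      (mul_nonneg (div_pos two_pos hκ0).le (norm_nonneg (fTilde φ f t))) P.holderConjugate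
    rw [Real.mul_rpow hκ0.le hr0, Real.mul_rpow (div_pos two_pos hκ0).le (norm_nonneg _), hκβ,
      ← hN] at hy
    have e1 : κ * r * (2 / κ * ‖fTilde φ f t‖) = 2 * (‖fTilde φ f t‖ * r) := by field_simp
    rw [e1] at hy
    have p1 : 1 / (2 * M) * r ^ P.β / P.β ≤ 1 / (2 * M) * r ^ P.β :=
      div_le_self (by positivity) hβ.le
    have p2 : N * ‖fTilde φ f t‖ ^ P.lam / P.lam ≤ N * ‖fTilde φ f t‖ ^ P.lam :=
      div_le_self (by positivity) (by linarith [P.two_le_lam])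
    linarith
  have h9 : -J ≤ 1 / M * (-r ^ P.β + δ / 2) + A * ‖φ t‖ ^ 2 := by
    have := mul_le_mul_of_nonneg_left h7 (by positivity : 0 ≤ 1 / M)
    have e2 : 1 / M * (δ / 2 + M * J + M * (A * ‖φ t‖ ^ 2)) =
        1 / M * (δ / 2) + J + A * ‖φ t‖ ^ 2 := by field_simp
    rw [e2] at this
    linarith
  have e3 : 1 / (2 * M) * (-r ^ P.β + (δ + 2 * M * (2 * A + N) * gFun P φ f t)) =
      1 / M * (-r ^ P.β + δ / 2) + 1 / (2 * M) * r ^ P.β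
        + (2 * A + N) * (‖fTilde φ f t‖ ^ P.lam + ‖φ t‖ ^ 2) := by
    unfold gFun
    field_simp
    ring
  rw [e3]
  have p3 : 0 ≤ A * ‖fTilde φ f t‖ ^ P.lam := by positivity
  have p4 : 0 ≤ N * ‖φ t‖ ^ 2 := by positivity
  linarith

theorem gFun_nonneg (P : GenPoly) (φ : ℝ → H1 Ω) (f : ℝ → L2 Ω) (t : ℝ) : 0 ≤ gFun P φ f t := by
  unfold gFun
  positivity

theorem IsEnvelope.nonneg {G : ℝ → ℝ} (hG : IsEnvelope (Ioi 0) (gFun P φ f) G) {t : ℝ}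
    (ht : 0 < t) : 0 ≤ G t := (gFun_nonneg P φ f t).trans (hG.le t ht)

theorem massSq_zero (hsol : IsWeakSolution P φ f ρ₀ ρt) :
    massSq ρt 0 = ‖toL2 (ρ₀ - φ 0)‖ ^ 2 := by rw [massSq, hsol.initial]

theorem GenPoly.one_le_two_div_β (P : GenPoly) : 1 ≤ 2 / P.β := by
  rw [one_le_div P.β_pos]
  exact P.β_lt_two.le

theorem le_one_add_rpow {x p : ℝ} (hx : 0 ≤ x) (hp : 1 ≤ p) : x ≤ 1 + x ^ p := by
  rcases le_total x 1 with h | h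
  · have := Real.rpow_nonneg hx p
    linarith
  · have := Real.self_le_rpow_of_one_le h hp
    linarith

/-- Barrier argument on [0, t] at the level ‖ρ̃⁰‖² + B with B^{β/2} = 1 + D G(t). Above it the
derivative is nonpositive, because g ≤ G ≤ G(t) on (0, t]. -/
theorem exists_massSq_le (hb : Bornology.IsBounded Ω) (hS : SobolevIneq P Ω) :
    ∃ D : ℝ, 0 < D ∧ ∀ (φ : ℝ → H1 Ω) (f : ℝ → L2 Ω) (ρ₀ : H1 Ω) (ρt : ℝ → H1 Ω),
      IsWeakSolution P φ f ρ₀ ρt → ∀ G : ℝ → ℝ, IsEnvelope (Ioi 0) (gFun P φ f) G →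
        ∀ t, 0 < t → massSq ρt t ≤ ‖toL2 (ρ₀ - φ 0)‖ ^ 2 + D * (1 + G t ^ (2 / P.β)) := by
  obtain ⟨c, D, hc, hD, h⟩ := exists_deriv_massSq_le hb hS one_pos
  have hp := P.one_le_two_div_β
  refine ⟨2 ^ (2 / P.β - 1) * (1 + D ^ (2 / P.β)), by positivity, ?_⟩
  intro φ f ρ₀ ρt hsol G hG t ht
  have hG0 := hG.nonneg ht
  set B := (1 + D * G t) ^ (2 / P.β) with hB
  have hB0 : 0 ≤ B := by positivity
  have hBle : B ≤ 2 ^ (2 / P.β - 1) * (1 + D ^ (2 / P.β)) * (1 + G t ^ (2 / P.β)) := by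
    have h1 := add_rpow_le_mul zero_le_one (mul_nonneg hD.le hG0) hp
    rw [Real.one_rpow, Real.mul_rpow hD.le hG0] at h1
    refine h1.trans ?_
    rw [mul_assoc]
    refine mul_le_mul_of_nonneg_left ?_ (by positivity)
    have : 0 ≤ D ^ (2 / P.β) := by positivity
    have : 0 ≤ G t ^ (2 / P.β) := by positivity
    nlinarith
  have hBβ : B ^ (P.β / 2) = 1 + D * G t := by
    rw [hB, ← Real.rpow_mul (by positivity)]
    have : 2 / P.β * (P.β / 2) = 1 := by
      have := P.β_pos
      field_simp
    rw [this, Real.rpow_one]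
  have h0 := massSq_nonneg ρt 0
  have := le_of_deriv_nonpos_above (y := massSq ρt) (B := massSq ρt 0 + B) ht.le
    ((continuousOn_massSq hsol).mono Icc_subset_Ici_self)
    (fun τ hτ => hasDerivAt_massSq hsol hτ.1)
    (fun τ hτ hlt => by
      refine (h φ f ρ₀ ρt hsol τ hτ.1).trans (mul_nonpos_of_nonneg_of_nonpos hc.le ?_)
      have h1 : B ^ (P.β / 2) ≤ massSq ρt τ ^ (P.β / 2) :=
        Real.rpow_le_rpow hB0 (by linarith) (by linarith [P.β_pos])
      have h2 : gFun P φ f τ ≤ G t := (hG.le τ hτ.1).trans (hG.monotoneOn hτ.1 ht hτ.2.le)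
      have h3 := mul_le_mul_of_nonneg_left h2 hD.le
      linarith) (by linarith)
  rw [massSq_zero hsol] at this
  linarith

/-- The envelope lives on (0, ∞), so the value at 0 is reached as a right limit. It removes φ⁰ from
the first estimate, which mentions only ρ⁰ and the envelope. -/
theorem norm_φ_zero_sq_le (hreg : IsRegularData φ f) {G : ℝ → ℝ}
    (hG : IsEnvelope (Ioi 0) (gFun P φ f) G) {t : ℝ} (ht : 0 < t) : ‖φ 0‖ ^ 2 ≤ G t := by
  have hc : Tendsto (fun s => ‖φ s‖ ^ 2) (𝓝[>] 0) (𝓝 (‖φ 0‖ ^ 2)) :=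
    (((hreg.continuousOn_φ 0 self_mem_Ici).mono_left
      (nhdsWithin_mono 0 Ioi_subset_Ici_self)).norm.pow 2)
  refine le_of_tendsto hc ?_
  filter_upwards [Ioo_mem_nhdsGT ht] with s hs
  have h1 : ‖φ s‖ ^ 2 ≤ gFun P φ f s := by
    have : 0 ≤ ‖fTilde φ f s‖ ^ P.lam := by positivity
    unfold gFun
    linarith
  exact h1.trans ((hG.le s hs.1).trans (hG.monotoneOn hs.1 ht hs.2.le))

theorem exists_norm_le (hb : Bornology.IsBounded Ω) (hS : SobolevIneq P Ω) :
    ∃ C : ℝ≥0, ∀ (φ : ℝ → H1 Ω) (f : ℝ → L2 Ω) (ρ₀ : H1 Ω) (ρt : ℝ → H1 Ω),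
      IsRegularData φ f → IsWeakSolution P φ f ρ₀ ρt →
      ∀ G : ℝ → ℝ, IsEnvelope (Ioi 0) (gFun P φ f) G →
        ∀ t, 0 < t → ‖toL2 (ρt t)‖ ≤ C * (1 + ‖toL2 ρ₀‖ + G t ^ (1 / P.β)) := by
  obtain ⟨D, hD, h⟩ := exists_massSq_le (P := P) hb hS
  refine ⟨⟨2 + D, by positivity⟩, ?_⟩
  intro φ f ρ₀ ρt hreg hsol G hG t ht
  have hG0 := hG.nonneg ht
  set x := G t ^ (1 / P.β) with hx
  have hx0 : 0 ≤ x := by positivity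
  have hx2 : G t ^ (2 / P.β) = x ^ 2 := by
    rw [hx, ← Real.rpow_natCast, ← Real.rpow_mul hG0]
    congr 1
    push_cast
    ring
  have h1 := h φ f ρ₀ ρt hsol G hG t ht
  rw [hx2] at h1
  have h2 : ‖φ 0‖ ^ 2 ≤ 1 + x ^ 2 := by
    rw [← hx2]
    exact (norm_φ_zero_sq_le hreg hG ht).trans (le_one_add_rpow hG0 P.one_le_two_div_β)
  have h3 : ‖φ 0‖ ≤ 1 + x := by
    refine abs_le_of_sq_le_sq' (b := 1 + x) (by nlinarith) (by linarith) |>.2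
  have h4 : ‖toL2 (ρ₀ - φ 0)‖ ≤ ‖toL2 ρ₀‖ + (1 + x) := by
    rw [toL2_sub]
    refine (norm_sub_le _ _).trans ?_
    have := norm_toL2_le (φ 0)
    linarith
  have h5 : ‖toL2 (ρt t)‖ ≤ ‖toL2 (ρ₀ - φ 0)‖ + (1 + D) * (1 + x) := by
    refine abs_le_of_sq_le_sq' (b := ‖toL2 (ρ₀ - φ 0)‖ + (1 + D) * (1 + x)) ?_ (by positivity) |>.2
    have h6 : D * (1 + x ^ 2) ≤ ((1 + D) * (1 + x)) ^ 2 := by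
      have h7 : D ≤ (1 + D) ^ 2 := by nlinarith
      have h8 : 1 + x ^ 2 ≤ (1 + x) ^ 2 := by nlinarith
      rw [mul_pow]
      exact mul_le_mul h7 h8 (by positivity) (by positivity)
    have h9 : 0 ≤ ‖toL2 (ρ₀ - φ 0)‖ * ((1 + D) * (1 + x)) := by positivity
    change massSq ρt t ≤ _
    nlinarith
  have h10 := norm_nonneg (toL2 ρ₀)
  change ‖toL2 (ρt t)‖ ≤ (2 + D) * (1 + ‖toL2 ρ₀‖ + x)
  nlinarith

theorem limsup_rpow_ennreal {ι : Type*} {l : Filter ι} [l.NeBot] {p : ℝ} (hp : 0 ≤ p)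
    (u : ι → ℝ≥0∞) : limsup (fun t => u t ^ p) l = (limsup u l) ^ p :=
  (Monotone.map_limsup_of_continuousAt (f := fun x : ℝ≥0∞ => x ^ p)
    (fun _ _ h => ENNReal.rpow_le_rpow h hp) u
    ENNReal.continuous_rpow_const.continuousAt).symm

theorem limsup_sq_ennreal {ι : Type*} {l : Filter ι} [l.NeBot]
    (u : ι → ℝ≥0∞) : limsup (fun t => u t ^ 2) l = (limsup u l) ^ 2 := by
  have := limsup_rpow_ennreal (l := l) (p := 2) (by norm_num) u
  simpa only [ENNReal.rpow_two] using this

theorem enorm_sq_eq {F : Type*} [NormedAddCommGroup F] (x : F) :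
    ‖x‖ₑ ^ 2 = ENNReal.ofReal (‖x‖ ^ 2) := by
  rw [ENNReal.ofReal_pow (norm_nonneg _), ofReal_norm]

theorem limsup_gFun_eq_zero (P : GenPoly)
    (hf : limsup (fun t => ‖fTilde φ f t‖ₑ) atTop = 0) (hφ : limsup (fun t => ‖φ t‖ₑ) atTop = 0) :
    limsup (fun t => ENNReal.ofReal (gFun P φ f t)) atTop = 0 := by
  have hl : 0 < P.lam := by linarith [P.two_le_lam]
  have h : ∀ t, ENNReal.ofReal (gFun P φ f t) = ‖fTilde φ f t‖ₑ ^ P.lam + ‖φ t‖ₑ ^ 2 := by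
    intro t
    rw [gFun, ENNReal.ofReal_add (by positivity) (by positivity), enorm_sq_eq,
      ← ENNReal.ofReal_rpow_of_nonneg (norm_nonneg _) hl.le, ofReal_norm]
  simp only [h]
  refine le_antisymm ((limsup_add_le_ennreal _ _).trans ?_) bot_le
  rw [limsup_rpow_ennreal hl.le, limsup_sq_ennreal, hf, hφ, ENNReal.zero_rpow_of_pos hl]
  simp

theorem exists_limsup_massSq_le (hb : Bornology.IsBounded Ω) (hS : SobolevIneq P Ω)
    {δ : ℝ} (hδ : 0 < δ) :
    ∃ D : ℝ, 0 < D ∧ ∀ (φ : ℝ → H1 Ω) (f : ℝ → L2 Ω) (ρ₀ : H1 Ω) (ρt : ℝ → H1 Ω),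
      IsWeakSolution P φ f ρ₀ ρt →
        limsup (fun t => ‖toL2 (ρt t)‖ₑ ^ 2) atTop ≤
          (ENNReal.ofReal δ + ENNReal.ofReal D
            * limsup (fun t => ENNReal.ofReal (gFun P φ f t)) atTop) ^ (2 / P.β) := by
  obtain ⟨c, D, hc, hD, h⟩ := exists_deriv_massSq_le hb hS hδ
  refine ⟨D, hD, fun φ f ρ₀ ρt hsol => ?_⟩
  have h1 := limsup_le_of_deriv_le (y := massSq ρt) (p := P.β / 2)
    (h := fun t => δ + D * gFun P φ f t) hc (by linarith [P.β_pos])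
    (fun t ht => hasDerivAt_massSq hsol ht) (fun t ht => h φ f ρ₀ ρt hsol t ht)
  have e : ∀ t, ENNReal.ofReal (δ + D * gFun P φ f t) =
      ENNReal.ofReal δ + ENNReal.ofReal D * ENNReal.ofReal (gFun P φ f t) := fun t => by
    rw [ENNReal.ofReal_add hδ.le (mul_nonneg hD.le (gFun_nonneg P φ f t)),
      ENNReal.ofReal_mul hD.le]
  simp only [e] at h1
  rw [limsup_const_add_ennreal, limsup_const_mul_ennreal ENNReal.ofReal_ne_top, one_div_div] at h1
  simp only [enorm_sq_eq]
  exact h1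

theorem exists_limsup_norm_sq_le (hb : Bornology.IsBounded Ω) (hS : SobolevIneq P Ω) :
    ∃ C : ℝ≥0, ∀ (φ : ℝ → H1 Ω) (f : ℝ → L2 Ω) (ρ₀ : H1 Ω) (ρt : ℝ → H1 Ω),
      IsWeakSolution P φ f ρ₀ ρt →
        limsup (fun t => ‖toL2 (ρt t)‖ₑ ^ 2) atTop ≤
          C * (1 + limsup (fun t => ENNReal.ofReal (gFun P φ f t)) atTop) ^ (2 / P.β) := by
  obtain ⟨D, hD, h⟩ := exists_limsup_massSq_le (P := P) hb hS one_pos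
  have hp : 0 ≤ 2 / P.β := zero_le_one.trans P.one_le_two_div_β
  refine ⟨(1 + Real.toNNReal D) ^ (2 / P.β), fun φ f ρ₀ ρt hsol => (h φ f ρ₀ ρt hsol).trans ?_⟩
  rw [ENNReal.coe_rpow_of_nonneg _ hp, ← ENNReal.mul_rpow_of_nonneg _ _ hp]
  refine ENNReal.rpow_le_rpow ?_ hp
  rw [ENNReal.ofReal_one]
  push_cast
  set L := limsup (fun t => ENNReal.ofReal (gFun P φ f t)) atTop
  calc 1 + ENNReal.ofReal D * L ≤ 1 + ENNReal.ofReal D * L + (L + ENNReal.ofReal D) :=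
        le_self_add
    _ = (1 + ENNReal.ofReal D) * (1 + L) := by ring

/-- Once g → 0 only δ^{2/β} remains in the upper limit, for every δ > 0. The constant D depends on δ
but multiplies zero. -/
theorem limsup_norm_sq_eq_zero (hb : Bornology.IsBounded Ω) (hS : SobolevIneq P Ω)
    (hsol : IsWeakSolution P φ f ρ₀ ρt)
    (hf : limsup (fun t => ‖fTilde φ f t‖ₑ) atTop = 0) (hφ : limsup (fun t => ‖φ t‖ₑ) atTop = 0) :
    limsup (fun t => ‖toL2 (ρt t)‖ₑ ^ 2) atTop = 0 := by
  have hp : 0 < 2 / P.β := one_pos.trans_le P.one_le_two_div_β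
  have h : ∀ δ : ℝ≥0, 0 < δ →
      (limsup (fun t => ‖toL2 (ρt t)‖ₑ ^ 2) atTop) ^ (2 / P.β)⁻¹ ≤ 0 + δ := by
    intro δ hδ
    obtain ⟨D, -, h⟩ := exists_limsup_massSq_le (P := P) hb hS (δ := δ) (by exact_mod_cast hδ)
    have h1 := h φ f ρ₀ ρt hsol
    rw [limsup_gFun_eq_zero P hf hφ, mul_zero, add_zero, ENNReal.ofReal_coe_nnreal] at h1
    rw [zero_add, ENNReal.rpow_inv_le_iff hp]
    exact h1
  have h0 := le_antisymm (ENNReal.le_of_forall_pos_le_add fun ε hε _ => h ε hε) bot_le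
  exact (ENNReal.rpow_eq_zero_iff_of_pos (inv_pos.2 hp)).1 h0

end Mass

/-! ### Gronwall inequalities with a constant source split off. -/

section DifferentialInequalitiesConst

/-- Subtracting the equilibrium Kc/k removes the constant source, so c ends up outside the integral,
as the form of `boundA` requires. -/
theorem gronwall_lintegral_const {y y' b : ℝ → ℝ} {s t k K c : ℝ} (hst : s ≤ t) (hk : 0 < k)
    (hK : 0 ≤ K) (hc0 : 0 ≤ c) (hys : 0 ≤ y s)
    (hc : ContinuousOn y (Icc s t)) (hd : ∀ τ ∈ Ioo s t, HasDerivAt y (y' τ) τ)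
    (hb : ContinuousOn b (Ioc s t)) (hb0 : ∀ τ ∈ Ioc s t, 0 ≤ b τ)
    (hy' : ∀ τ ∈ Ioo s t, y' τ + k * y τ ≤ K * (c + b τ)) :
    ENNReal.ofReal (y t) ≤ ENNReal.ofReal (y s + K * c / k)
      + ENNReal.ofReal K * ∫⁻ τ in Ioo s t, ENNReal.ofReal (Real.exp (-k * (t - τ)) * b τ) := by
  have he : 0 ≤ K * c / k := by positivity
  have h := gronwall_lintegral (y := fun τ => y τ - K * c / k) (h := fun τ => K * b τ) (k := k) hst
    (hc.sub continuousOn_const) (fun τ hτ => (hd τ hτ).sub_const _) (continuousOn_const.mul hb)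
    (fun τ hτ => mul_nonneg hK (hb0 τ hτ)) (fun τ hτ => by
      have := hy' τ hτ
      have e : k * (y τ - K * c / k) = k * y τ - K * c := by field_simp
      simp only [e]
      linarith)
  have e : ∀ τ, ENNReal.ofReal (Real.exp (-k * (t - τ)) * (K * b τ)) =
      ENNReal.ofReal K * ENNReal.ofReal (Real.exp (-k * (t - τ)) * b τ) := fun τ => by
    rw [← ENNReal.ofReal_mul hK]
    ring_nf
  simp only [e] at h
  rw [lintegral_const_mul' _ _ ENNReal.ofReal_ne_top] at h
  have hexp : Real.exp (-k * (t - s)) ≤ 1 := Real.exp_le_one_iff.2 (by nlinarith)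
  calc ENNReal.ofReal (y t) = ENNReal.ofReal ((y t - K * c / k) + K * c / k) := by
        rw [sub_add_cancel]
    _ ≤ ENNReal.ofReal (y t - K * c / k) + ENNReal.ofReal (K * c / k) := ENNReal.ofReal_add_le
    _ ≤ ENNReal.ofReal (Real.exp (-k * (t - s)) * (y s - K * c / k))
        + ENNReal.ofReal K * (∫⁻ τ in Ioo s t, ENNReal.ofReal (Real.exp (-k * (t - τ)) * b τ))
        + ENNReal.ofReal (K * c / k) := by gcongr
    _ ≤ ENNReal.ofReal (y s)
        + ENNReal.ofReal K * (∫⁻ τ in Ioo s t, ENNReal.ofReal (Real.exp (-k * (t - τ)) * b τ))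
        + ENNReal.ofReal (K * c / k) := by
        gcongr
        have := Real.exp_pos (-k * (t - s))
        nlinarith
    _ = _ := by
        rw [ENNReal.ofReal_add hys he]
        ring

theorem ofReal_le_add_lintegral_const {y y' b : ℝ → ℝ} {s t K c : ℝ} (hst : s ≤ t)
    (hst1 : t - s ≤ 1) (hK : 0 ≤ K) (hc0 : 0 ≤ c) (hys : 0 ≤ y s)
    (hc : ContinuousOn y (Icc s t)) (hd : ∀ τ ∈ Ioo s t, HasDerivAt y (y' τ) τ)
    (hb : ContinuousOn b (Ioc s t)) (hb0 : ∀ τ ∈ Ioc s t, 0 ≤ b τ)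
    (hy' : ∀ τ ∈ Ioo s t, y' τ ≤ K * (c + b τ)) :
    ENNReal.ofReal (y t) ≤ ENNReal.ofReal (y s + K * c)
      + ENNReal.ofReal K * ∫⁻ τ in Ioo s t, ENNReal.ofReal (b τ) := by
  have he : 0 ≤ K * c := by positivity
  have h := ofReal_le_add_lintegral (y := fun τ => y τ - K * c * (τ - s)) (h := fun τ => K * b τ)
    (y' := fun τ => y' τ - K * c) hst
    (hc.sub (by fun_prop)) (fun τ hτ => by
      refine (hd τ hτ).sub ?_
      simpa using ((hasDerivAt_id τ).sub_const s).const_mul (K * c))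
    (continuousOn_const.mul hb)
    (fun τ hτ => mul_nonneg hK (hb0 τ hτ)) (fun τ hτ => by
      have := hy' τ hτ
      linarith)
  simp only [ENNReal.ofReal_mul hK, sub_self, mul_zero, sub_zero] at h
  rw [lintegral_const_mul' _ _ ENNReal.ofReal_ne_top] at h
  calc ENNReal.ofReal (y t) ≤ ENNReal.ofReal ((y t - K * c * (t - s)) + K * c) := by
        refine ENNReal.ofReal_le_ofReal ?_
        nlinarith
    _ ≤ ENNReal.ofReal (y t - K * c * (t - s)) + ENNReal.ofReal (K * c) := ENNReal.ofReal_add_le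
    _ ≤ ENNReal.ofReal (y s) + ENNReal.ofReal K * (∫⁻ τ in Ioo s t, ENNReal.ofReal (b τ))
        + ENNReal.ofReal (K * c) := by gcongr
    _ = _ := by
        rw [ENNReal.ofReal_add hys he]
        ring

/-- Carries an energy bound with a possibly infinite integral I through the affine map that bounds
the gradient norm by the energy. -/
theorem ofReal_affine_le {e x A K D m C : ℝ} {I : ℝ≥0∞} (hx0 : 0 ≤ x) (hD : 0 ≤ D) (hm : 0 ≤ m)
    (h : ENNReal.ofReal e ≤ ENNReal.ofReal x + ENNReal.ofReal K * I)
    (hx : D * (1 + m * x) ≤ C * A) (hC : 0 ≤ C) (hK : D * m * K ≤ C) :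
    ENNReal.ofReal (D * (1 + m * e)) ≤ ENNReal.ofReal C * (ENNReal.ofReal A + I) := by
  calc ENNReal.ofReal (D * (1 + m * e)) = ENNReal.ofReal (D + D * m * e) := by ring_nf
    _ ≤ ENNReal.ofReal D + ENNReal.ofReal (D * m * e) := ENNReal.ofReal_add_le
    _ = ENNReal.ofReal D + ENNReal.ofReal (D * m) * ENNReal.ofReal e := by
        rw [ENNReal.ofReal_mul (by positivity)]
    _ ≤ ENNReal.ofReal D + ENNReal.ofReal (D * m) *
          (ENNReal.ofReal x + ENNReal.ofReal K * I) := by gcongr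
    _ = ENNReal.ofReal (D * (1 + m * x)) + ENNReal.ofReal (D * m * K) * I := by
        rw [mul_add, ← mul_assoc, ← ENNReal.ofReal_mul (by positivity),
          ← ENNReal.ofReal_mul (by positivity), ← add_assoc,
          ← ENNReal.ofReal_add hD (by positivity)]
        ring_nf
    _ ≤ ENNReal.ofReal (C * A) + ENNReal.ofReal C * I := by gcongr
    _ = _ := by rw [ENNReal.ofReal_mul hC, mul_add]

end DifferentialInequalitiesConst

/-! ### Bounds of the gradient. -/

section Gradient

variable {d : ℕ} {Ω : Set (EuclideanSpace ℝ (Fin d))} {P : GenPoly} {φ : ℝ → H1 Ω} {f : ℝ → L2 Ω}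
  {ρ₀ : H1 Ω} {ρt : ℝ → H1 Ω}

/-- λ ≥ 2, so the square of ‖f̃‖ is at most 1 plus its λ-th power. -/
theorem φ_sq_add_fTilde_sq_le (P : GenPoly) (φ : ℝ → H1 Ω) (f : ℝ → L2 Ω) (t : ℝ) :
    ‖φ t‖ ^ 2 + ‖fTilde φ f t‖ ^ 2 ≤ 1 + gFun P φ f t := by
  have h : ‖fTilde φ f t‖ ^ 2 ≤ 1 + ‖fTilde φ f t‖ ^ P.lam := by
    have hx := norm_nonneg (fTilde φ f t)
    have := le_one_add_rpow (x := ‖fTilde φ f t‖ ^ (2 : ℝ)) (p := P.lam / 2) (by positivity)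
      (by linarith [P.two_le_lam])
    rwa [← Real.rpow_mul hx, mul_div_cancel₀ _ (two_ne_zero), Real.rpow_two] at this
  unfold gFun
  linarith

theorem exists_forcing_le (hb : Bornology.IsBounded Ω) (hS : SobolevIneq P Ω) :
    ∃ D : ℝ, 0 < D ∧ ∀ (φ : ℝ → H1 Ω) (f : ℝ → L2 Ω) (ρ₀ : H1 Ω) (ρt : ℝ → H1 Ω),
      IsWeakSolution P φ f ρ₀ ρt → ∀ G : ℝ → ℝ, IsEnvelope (Ioi 0) (gFun P φ f) G →
        ∀ t, 0 < t → massSq ρt t ≤ D * (1 + ‖toL2 (ρ₀ - φ 0)‖ ^ 2 + G t ^ (2 / P.β)) ∧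
          forcing φ f ρt t
            ≤ D * (1 + ‖toL2 (ρ₀ - φ 0)‖ ^ 2 + (‖deriv φ t‖ ^ 2 + G t ^ (2 / P.β))) := by
  obtain ⟨D, hD, h⟩ := exists_massSq_le (P := P) hb hS
  refine ⟨D + 2, by positivity, ?_⟩
  intro φ f ρ₀ ρt hsol G hG t ht
  have h1 := h φ f ρ₀ ρt hsol G hG t ht
  have h2 := φ_sq_add_fTilde_sq_le P φ f t
  have h3 := hG.le t ht
  have h4 := le_one_add_rpow (hG.nonneg ht) P.one_le_two_div_β
  have h5 : 0 ≤ G t ^ (2 / P.β) := Real.rpow_nonneg (hG.nonneg ht) _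
  have p1 := mul_nonneg hD.le (sq_nonneg ‖toL2 (ρ₀ - φ 0)‖)
  have p2 := mul_nonneg hD.le (sq_nonneg ‖deriv φ t‖)
  have p3 := sq_nonneg ‖toL2 (ρ₀ - φ 0)‖
  have p4 := sq_nonneg ‖deriv φ t‖
  unfold forcing
  constructor <;> linarith

theorem energyAt_zero_le (hsol : IsWeakSolution P φ f ρ₀ ρt) :
    energyAt P φ ρt 0 ≤ (P.coeff 0)⁻¹ * ‖ρ₀‖ ^ 2 := by
  have : ρt 0 + φ 0 = ρ₀ := by rw [hsol.initial]; abel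
  rw [energyAt, this]
  exact (P.energy_le_dissip _).trans (P.dissip_grad_le ρ₀)

theorem norm_toL2_sub_sq_le (ρ₀ : H1 Ω) (φ₀ : H1 Ω) :
    ‖toL2 (ρ₀ - φ₀)‖ ^ 2 ≤ 2 * (‖ρ₀‖ ^ 2 + ‖toL2 φ₀‖ ^ 2) := by
  have h1 : ‖toL2 (ρ₀ - φ₀)‖ ≤ ‖ρ₀‖ + ‖toL2 φ₀‖ := by
    rw [toL2_sub]
    exact (norm_sub_le _ _).trans (by linarith [norm_toL2_le ρ₀])
  calc ‖toL2 (ρ₀ - φ₀)‖ ^ 2 ≤ (‖ρ₀‖ + ‖toL2 φ₀‖) ^ 2 := by gcongr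
    _ ≤ _ := add_sq_le

theorem exists_gradNorm_rpow_le (hb : Bornology.IsBounded Ω) (P : GenPoly) {δ : ℝ} (hδ : 0 < δ) :
    ∃ C : ℝ, 0 < C ∧ ∀ (φ : ℝ → H1 Ω) (ρt : ℝ → H1 Ω) (t : ℝ),
      gradNorm P.β (ρt t + φ t) ^ P.β ≤ ENNReal.ofReal (δ + C * energyAt P φ ρt t) := by
  obtain ⟨C, hC, h⟩ := P.exists_powInt_le (Ω := Ω) hb hδ
  refine ⟨C * 2, by positivity, fun φ ρt t => ?_⟩
  rw [gradNorm_rpow hb P.β_pos P.β_lt_two.le]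
  refine ENNReal.ofReal_le_ofReal ((h _).trans ?_)
  have := mul_le_mul_of_nonneg_left (P.dissip_le_energy (grad (ρt t + φ t))) hC.le
  unfold energyAt
  linarith

theorem IsEnvelope.continuousOn_rpow {G : ℝ → ℝ} (hG : IsEnvelope (Ioi 0) (gFun P φ f) G) :
    ContinuousOn (fun t => G t ^ (2 / P.β)) (Ioi 0) :=
  hG.continuousOn.rpow_const fun _ _ => Or.inr (zero_le_one.trans P.one_le_two_div_β)

theorem IsRegularData.continuousOn_deriv_φ_sq (hreg : IsRegularData φ f) :
    ContinuousOn (fun t => ‖deriv φ t‖ ^ 2) (Ioi 0) :=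
  (continuousOn_deriv_of_contDiffOn hreg.contDiffOn_φ).norm.pow 2

theorem exists_gradNorm_le_boundA (hb : Bornology.IsBounded Ω) (hS : SobolevIneq P Ω) :
    ∃ C : ℝ≥0, ∀ (φ : ℝ → H1 Ω) (f : ℝ → L2 Ω) (ρ₀ : H1 Ω) (ρt : ℝ → H1 Ω),
      IsRegularData φ f → IsWeakSolution P φ f ρ₀ ρt →
      ∀ G : ℝ → ℝ, IsEnvelope (Ioi 0) (gFun P φ f) G → ∀ t, 0 < t →
        gradNorm P.β (ρt t + φ t) ^ P.β ≤ C * boundA P φ ρ₀ G t := by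
  obtain ⟨D, hD, hforc⟩ := exists_forcing_le (P := P) hb hS
  obtain ⟨R, hR, hgrad⟩ := exists_gradNorm_rpow_le (Ω := Ω) hb P one_pos
  have hcst := cst_pos P
  have ha := inv_coeff_pos P
  set K := P.cst * D with hK
  have hK0 : 0 < K := by positivity
  -- The initial energy costs ‖ρ⁰‖²/a₀. The constant source costs Kc/(1/2), and c is at most twice
  -- the leading term of `boundA`, hence 4K.
  refine ⟨Real.toNNReal (1 + R * ((P.coeff 0)⁻¹ + 4 * K)), ?_⟩
  intro φ f ρ₀ ρt hreg hsol G hG t ht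
  set c := 1 + ‖toL2 (ρ₀ - φ 0)‖ ^ 2 with hc
  have hc0 : 0 ≤ c := by positivity
  have hIoc : Ioc 0 t ⊆ Ioi 0 := fun τ hτ => hτ.1
  have h := gronwall_lintegral_const (y := energyAt P φ ρt)
    (b := fun τ => ‖deriv φ τ‖ ^ 2 + G τ ^ (2 / P.β)) (k := 1 / 2) (K := K) (c := c)
    ht.le (by norm_num) hK0.le hc0 (energyAt_nonneg _ _ _ _)
    ((continuousOn_energyAt hreg hsol).mono Icc_subset_Ici_self)
    (fun τ hτ => hasDerivAt_energyAt hreg hsol hτ.1)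
    ((hreg.continuousOn_deriv_φ_sq.add hG.continuousOn_rpow).mono hIoc)
    (fun τ hτ => add_nonneg (sq_nonneg _) (Real.rpow_nonneg (hG.nonneg hτ.1) _))
    (fun τ hτ => by
      have h1 := deriv_energyAt_le hsol hτ.1
      have h2 := mul_le_mul_of_nonneg_left (hforc φ f ρ₀ ρt hsol G hG τ hτ.1).2 hcst.le
      have h3 := rateSq_nonneg ρt τ
      rw [hK, mul_assoc]
      linarith)
  have h0 := energyAt_zero_le hsol
  have h1 := norm_toL2_sub_sq_le ρ₀ (φ 0)
  have h2 := energyAt_nonneg P φ ρt 0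
  refine (hgrad φ ρt t).trans ?_
  have := ofReal_affine_le (A := 1 + ‖ρ₀‖ ^ 2 + ‖toL2 (φ 0)‖ ^ 2)
    (C := 1 + R * ((P.coeff 0)⁻¹ + 4 * K)) (D := 1) (m := R) (by positivity) zero_le_one hR.le h
    (by
      have q1 := sq_nonneg ‖ρ₀‖
      have q2 := sq_nonneg ‖toL2 (φ 0)‖
      have e1 : energyAt P φ ρt 0 + K * c / (1 / 2) ≤
          ((P.coeff 0)⁻¹ + 4 * K) * (1 + ‖ρ₀‖ ^ 2 + ‖toL2 (φ 0)‖ ^ 2) := by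
        have e2 : K * c / (1 / 2) ≤ 4 * K * (1 + ‖ρ₀‖ ^ 2 + ‖toL2 (φ 0)‖ ^ 2) := by
          rw [div_le_iff₀ (by norm_num)]
          have : c ≤ 2 * (1 + ‖ρ₀‖ ^ 2 + ‖toL2 (φ 0)‖ ^ 2) := by linarith
          have := mul_le_mul_of_nonneg_left this hK0.le
          linarith
        have q3 := mul_nonneg ha.le q2
        linarith
      have e3 := mul_le_mul_of_nonneg_left e1 hR.le
      linarith) (by positivity) (by
      have q1 := mul_pos hR hK0
      have q2 := mul_pos hR ha
      linarith)
  rw [one_mul] at this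
  exact this

theorem exists_limsup_forcing_le (hb : Bornology.IsBounded Ω) (hS : SobolevIneq P Ω) :
    ∃ C : ℝ≥0, ∀ (φ : ℝ → H1 Ω) (f : ℝ → L2 Ω) (ρ₀ : H1 Ω) (ρt : ℝ → H1 Ω),
      IsWeakSolution P φ f ρ₀ ρt →
        limsup (fun t => ENNReal.ofReal (forcing φ f ρt t)) atTop ≤
          C * (1 + limsup (fun t => ‖deriv φ t‖ₑ ^ 2) atTop
            + (limsup (fun t => ENNReal.ofReal (gFun P φ f t)) atTop) ^ (2 / P.β)) := by
  obtain ⟨C, h⟩ := exists_limsup_norm_sq_le (P := P) hb hS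
  have hp := P.one_le_two_div_β
  refine ⟨C * 2 ^ (2 / P.β - 1) + 2, fun φ f ρ₀ ρt hsol => ?_⟩
  set L := limsup (fun t => ENNReal.ofReal (gFun P φ f t)) atTop with hL
  set N := limsup (fun t => ‖deriv φ t‖ₑ ^ 2) atTop with hN
  have h1 := h φ f ρ₀ ρt hsol
  have h2 : (1 + L) ^ (2 / P.β) ≤ 2 ^ (2 / P.β - 1) * (1 + L ^ (2 / P.β)) := by
    have := ENNReal.rpow_add_le_mul_rpow_add_rpow 1 L hp
    rwa [ENNReal.one_rpow] at this
  have h3 : L ≤ 1 + L ^ (2 / P.β) := by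
    rcases le_total L 1 with hle | hle
    · exact hle.trans le_self_add
    · refine le_add_left ?_
      calc L = L ^ (1 : ℝ) := (ENNReal.rpow_one L).symm
        _ ≤ _ := ENNReal.rpow_le_rpow_of_exponent_le hle hp
  have hle : ∀ t, ENNReal.ofReal (forcing φ f ρt t) ≤
      (‖toL2 (ρt t)‖ₑ ^ 2 + (1 + ENNReal.ofReal (gFun P φ f t))) + ‖deriv φ t‖ₑ ^ 2 := by
    intro t
    have hg := gFun_nonneg P φ f t
    rw [enorm_sq_eq, enorm_sq_eq, ← ENNReal.ofReal_one, ← ENNReal.ofReal_add zero_le_one hg,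
      ← ENNReal.ofReal_add (by positivity) (by positivity),
      ← ENNReal.ofReal_add (by positivity) (by positivity)]
    refine ENNReal.ofReal_le_ofReal ?_
    have := φ_sq_add_fTilde_sq_le P φ f t
    unfold forcing massSq
    linarith
  calc limsup (fun t => ENNReal.ofReal (forcing φ f ρt t)) atTop
      ≤ limsup (fun t => (‖toL2 (ρt t)‖ₑ ^ 2 + (1 + ENNReal.ofReal (gFun P φ f t)))
          + ‖deriv φ t‖ₑ ^ 2) atTop := limsup_mono_ennreal fun t _ => hle t
    _ ≤ (limsup (fun t => ‖toL2 (ρt t)‖ₑ ^ 2) atTop + (1 + L)) + N := by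
        refine (limsup_add_le_ennreal _ _).trans ?_
        gcongr
        refine (limsup_add_le_ennreal _ _).trans ?_
        rw [limsup_const_add_ennreal]
    _ ≤ (C * (2 ^ (2 / P.β - 1) * (1 + L ^ (2 / P.β))) + (1 + (1 + L ^ (2 / P.β)))) + N := by
        gcongr
        exact h1.trans (by gcongr)
    -- The missing cross terms are added so that the sum factors exactly.
    _ ≤ (C * (2 ^ (2 / P.β - 1) * (1 + L ^ (2 / P.β))) + (1 + (1 + L ^ (2 / P.β)))) + N
        + (C * 2 ^ (2 / P.β - 1) * N + N + L ^ (2 / P.β)) := le_self_add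
    _ = (C * 2 ^ (2 / P.β - 1) + 2) * (1 + N + L ^ (2 / P.β)) := by ring
    _ = _ := by
        push_cast
        rw [ENNReal.coe_rpow_of_ne_zero two_ne_zero]
        norm_cast

theorem limsup_energyAt_le (hreg : IsRegularData φ f) (hsol : IsWeakSolution P φ f ρ₀ ρt) :
    limsup (fun t => ENNReal.ofReal (energyAt P φ ρt t)) atTop ≤
      ENNReal.ofReal (2 * P.cst) * limsup (fun t => ENNReal.ofReal (forcing φ f ρt t)) atTop := by
  have hcst := cst_pos P
  have h := limsup_le_of_deriv_add_le (y := energyAt P φ ρt) (c := 1 / 2)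
    (h := fun t => 2 * P.cst * forcing φ f ρt t) (by norm_num)
    (fun t ht => hasDerivAt_energyAt hreg hsol ht) (fun t ht => by
      have h1 := deriv_energyAt_le hsol ht
      have h2 := rateSq_nonneg ρt t
      linarith)
  simp only [ENNReal.ofReal_mul (by positivity : 0 ≤ 2 * P.cst)] at h
  rwa [limsup_const_mul_ennreal ENNReal.ofReal_ne_top] at h

theorem limsup_gradNorm_rpow_le {δ R : ℝ} (hR : 0 ≤ R)
    (h : ∀ t, gradNorm P.β (ρt t + φ t) ^ P.β ≤ ENNReal.ofReal (δ + R * energyAt P φ ρt t)) :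
    limsup (fun t => gradNorm P.β (ρt t + φ t) ^ P.β) atTop ≤ ENNReal.ofReal δ
      + ENNReal.ofReal R * limsup (fun t => ENNReal.ofReal (energyAt P φ ρt t)) atTop := by
  rw [← limsup_const_mul_ennreal ENNReal.ofReal_ne_top, ← limsup_const_add_ennreal]
  refine limsup_mono_ennreal fun t _ => (h t).trans ?_
  rw [← ENNReal.ofReal_mul hR]
  exact ENNReal.ofReal_add_le

theorem exists_limsup_gradNorm_le (hb : Bornology.IsBounded Ω) (hS : SobolevIneq P Ω) :
    ∃ C : ℝ≥0, ∀ (φ : ℝ → H1 Ω) (f : ℝ → L2 Ω) (ρ₀ : H1 Ω) (ρt : ℝ → H1 Ω),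
      IsRegularData φ f → IsWeakSolution P φ f ρ₀ ρt →
        limsup (fun t => gradNorm P.β (ρt t + φ t) ^ P.β) atTop ≤
          C * (1 + limsup (fun t => ‖deriv φ t‖ₑ ^ 2) atTop
            + (limsup (fun t => ENNReal.ofReal (gFun P φ f t)) atTop) ^ (2 / P.β)) := by
  obtain ⟨D, hforc⟩ := exists_limsup_forcing_le (P := P) hb hS
  obtain ⟨R, hR, hgrad⟩ := exists_gradNorm_rpow_le (Ω := Ω) hb P one_pos
  refine ⟨1 + Real.toNNReal R * (Real.toNNReal (2 * P.cst) * D), fun φ f ρ₀ ρt hreg hsol => ?_⟩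
  have h1 := limsup_gradNorm_rpow_le hR.le (hgrad φ ρt)
  have h2 := limsup_energyAt_le hreg hsol
  have h3 := hforc φ f ρ₀ ρt hsol
  set S := limsup (fun t => ‖deriv φ t‖ₑ ^ 2) atTop
    + (limsup (fun t => ENNReal.ofReal (gFun P φ f t)) atTop) ^ (2 / P.β) with hSdef
  rw [add_assoc, ← hSdef] at h3 ⊢
  calc limsup (fun t => gradNorm P.β (ρt t + φ t) ^ P.β) atTop
      ≤ 1 + ENNReal.ofReal R * (ENNReal.ofReal (2 * P.cst) * (D * (1 + S))) := by
        refine h1.trans ?_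
        rw [ENNReal.ofReal_one]
        gcongr
        exact h2.trans (by gcongr)
    _ ≤ 1 + ENNReal.ofReal R * (ENNReal.ofReal (2 * P.cst) * (D * (1 + S))) + S := le_self_add
    _ = (1 + ENNReal.ofReal R * (ENNReal.ofReal (2 * P.cst) * D)) * (1 + S) := by ring
    _ = _ := by
        push_cast
        rfl

/-- All four terms of the forcing vanish in the limit, ‖ρ̃‖² by the previous part, so the energy
does too. Coercivity then leaves only the arbitrary δ. -/
theorem limsup_gradNorm_eq_zero (hb : Bornology.IsBounded Ω) (hS : SobolevIneq P Ω)
    (hreg : IsRegularData φ f) (hsol : IsWeakSolution P φ f ρ₀ ρt)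
    (hf : limsup (fun t => ‖fTilde φ f t‖ₑ) atTop = 0) (hφ : limsup (fun t => ‖φ t‖ₑ) atTop = 0)
    (hφ' : limsup (fun t => ‖deriv φ t‖ₑ) atTop = 0) :
    limsup (fun t => gradNorm P.β (ρt t + φ t)) atTop = 0 := by
  have hforc : limsup (fun t => ENNReal.ofReal (forcing φ f ρt t)) atTop = 0 := by
    have e : ∀ t, ENNReal.ofReal (forcing φ f ρt t) =
        ‖toL2 (ρt t)‖ₑ ^ 2 + ‖φ t‖ₑ ^ 2 + ‖fTilde φ f t‖ₑ ^ 2 + ‖deriv φ t‖ₑ ^ 2 := by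
      intro t
      simp only [enorm_sq_eq]
      rw [← ENNReal.ofReal_add (by positivity) (by positivity),
        ← ENNReal.ofReal_add (by positivity) (by positivity),
        ← ENNReal.ofReal_add (by positivity) (by positivity)]
      rfl
    simp only [e]
    refine le_antisymm ?_ bot_le
    calc _ ≤ limsup (fun t => ‖toL2 (ρt t)‖ₑ ^ 2) atTop + limsup (fun t => ‖φ t‖ₑ ^ 2) atTop
          + limsup (fun t => ‖fTilde φ f t‖ₑ ^ 2) atTop
          + limsup (fun t => ‖deriv φ t‖ₑ ^ 2) atTop := by
          refine (limsup_add_le_ennreal _ _).trans ?_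
          gcongr
          refine (limsup_add_le_ennreal _ _).trans ?_
          gcongr
          exact limsup_add_le_ennreal _ _
      _ = 0 := by
          rw [limsup_norm_sq_eq_zero hb hS hsol hf hφ, limsup_sq_ennreal, limsup_sq_ennreal,
            limsup_sq_ennreal, hf, hφ, hφ']
          simp
  have hen : limsup (fun t => ENNReal.ofReal (energyAt P φ ρt t)) atTop = 0 := by
    have := limsup_energyAt_le hreg hsol
    rw [hforc, mul_zero] at this
    exact le_antisymm this bot_le
  have h : ∀ δ : ℝ≥0, 0 < δ →
      limsup (fun t => gradNorm P.β (ρt t + φ t) ^ P.β) atTop ≤ 0 + δ := by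
    intro δ hδ
    obtain ⟨R, hR, hgrad⟩ := exists_gradNorm_rpow_le (Ω := Ω) hb P (δ := δ) (by exact_mod_cast hδ)
    have := limsup_gradNorm_rpow_le hR.le (hgrad φ ρt)
    rw [hen, mul_zero, ENNReal.ofReal_coe_nnreal] at this
    rwa [zero_add, ← add_zero (δ : ℝ≥0∞)]
  have h0 := le_antisymm (ENNReal.le_of_forall_pos_le_add fun ε hε _ => h ε hε) bot_le
  rw [limsup_rpow_ennreal P.β_pos.le] at h0
  exact (ENNReal.rpow_eq_zero_iff_of_pos P.β_pos).1 h0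

end Gradient

/-! ### Bounds of the time derivative, and uniform bounds for t ≥ 1. -/

section Rate

variable {d : ℕ} {Ω : Set (EuclideanSpace ℝ (Fin d))} {P : GenPoly} {φ : ℝ → H1 Ω} {f : ℝ → L2 Ω}
  {ρ₀ : H1 Ω} {ρt : ℝ → H1 Ω}

theorem continuousOn_rateSq (hsol : IsWeakSolution P φ f ρ₀ ρt) :
    ContinuousOn (rateSq ρt) (Ioi 0) := fun _ hτ =>
  (hasDerivAt_rateSq hsol hτ).continuousAt.continuousWithinAt

theorem deriv_massSq_add_energyAt_le_forcing (hsol : IsWeakSolution P φ f ρ₀ ρt) {t : ℝ}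
    (ht : 0 < t) :
    2 * inner ℝ (toL2 (ρt t)) (toL2 (deriv ρt t)) + energyAt P φ ρt t
      ≤ P.cst * forcing φ f ρt t := by
  refine (deriv_massSq_add_energyAt_le hsol ht).trans
    (mul_le_mul_of_nonneg_left ?_ (cst_pos P).le)
  unfold forcing
  linarith [sq_nonneg ‖deriv φ t‖]

/-- Nothing is known about ρ̃_t at time 0, so (τ - s)‖ρ̃_t‖² + 8E is followed on [s, t₀] with s > 0:
the weight kills ‖ρ̃_t(s)‖², and then s → 0. The weight and (‖ρ̃_t‖²)' produce at most 2‖ρ̃_t‖²,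
which 8 · 1/4 absorbs. The factor t₀ kept on ‖f̃_t‖² cancels the later division by t₀. -/
theorem exists_rateSq_initial_le (hb : Bornology.IsBounded Ω) (hS : SobolevIneq P Ω) :
    ∃ K : ℝ, 0 < K ∧ ∀ (φ : ℝ → H1 Ω) (f : ℝ → L2 Ω) (ρ₀ : H1 Ω) (ρt : ℝ → H1 Ω),
      IsRegularData φ f → IsWeakSolution P φ f ρ₀ ρt →
      ∀ G : ℝ → ℝ, IsEnvelope (Ioi 0) (gFun P φ f) G → ∀ t₀, 0 < t₀ → t₀ < 1 →
        ENNReal.ofReal (t₀ * rateSq ρt t₀ + 8 * energyAt P φ ρt t₀) ≤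
          ENNReal.ofReal (K * (1 + ‖ρ₀‖ ^ 2 + ‖toL2 (φ 0)‖ ^ 2))
          + ENNReal.ofReal K * ∫⁻ s in Ioo 0 t₀, ENNReal.ofReal
            ((‖deriv φ s‖ ^ 2 + G s ^ (2 / P.β)) + t₀ * ‖deriv (fTilde φ f) s‖ ^ 2) := by
  obtain ⟨D, hD, hforc⟩ := exists_forcing_le (P := P) hb hS
  have hcst := cst_pos P
  have ha := inv_coeff_pos P
  -- One forcing term comes from the rate inequality and eight from the energy inequality; the 1
  -- covers ‖f̃_t‖².
  set K := 9 * (P.cst * D) + 1 with hK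
  have hK0 : 0 < K := by positivity
  refine ⟨8 * (P.coeff 0)⁻¹ + 2 * K, by positivity, ?_⟩
  intro φ f ρ₀ ρt hreg hsol G hG t₀ ht₀ ht₁
  set b : ℝ → ℝ := fun s =>
    (‖deriv φ s‖ ^ 2 + G s ^ (2 / P.β)) + t₀ * ‖deriv (fTilde φ f) s‖ ^ 2 with hbdef
  set c := 1 + ‖toL2 (ρ₀ - φ 0)‖ ^ 2 with hc
  have hc0 : 0 ≤ c := by positivity
  have hb0 : ∀ τ, 0 < τ → 0 ≤ b τ := fun τ hτ => by
    have := Real.rpow_nonneg (hG.nonneg hτ) (2 / P.β)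
    positivity
  have hbc : ContinuousOn b (Ioi 0) :=
    (hreg.continuousOn_deriv_φ_sq.add hG.continuousOn_rpow).add
      (continuousOn_const.mul (continuousOn_deriv_fTilde_sq hreg))
  have key : ∀ s ∈ Ioo 0 t₀,
      ENNReal.ofReal ((t₀ - s) * rateSq ρt t₀ + 8 * energyAt P φ ρt t₀) ≤
        ENNReal.ofReal (8 * energyAt P φ ρt s + K * c)
          + ENNReal.ofReal K * ∫⁻ τ in Ioo 0 t₀, ENNReal.ofReal (b τ) := by
    intro s hs
    have hsub : Icc s t₀ ⊆ Ioi 0 := fun τ hτ => hs.1.trans_le hτ.1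
    have h := ofReal_le_add_lintegral_const
      (y := fun τ => (τ - s) * rateSq ρt τ + 8 * energyAt P φ ρt τ)
      (b := b) (K := K) (c := c) hs.2.le (by linarith [hs.1]) hK0.le hc0
      (by
        have := energyAt_nonneg P φ ρt s
        simpa using this)
      (((continuousOn_id.sub continuousOn_const).mul ((continuousOn_rateSq hsol).mono hsub)).add
        (continuousOn_const.mul
          ((continuousOn_energyAt hreg hsol).mono (hsub.trans Ioi_subset_Ici_self))))
      (fun τ hτ => (((hasDerivAt_id τ).sub_const s).mul
          (hasDerivAt_rateSq hsol (hs.1.trans hτ.1))).add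
        ((hasDerivAt_energyAt hreg hsol (hs.1.trans hτ.1)).const_mul 8))
      (hbc.mono (Ioc_subset_Icc_self.trans hsub))
      (fun τ hτ => hb0 τ (hs.1.trans hτ.1))
      (fun τ hτ => by
        have hτ0 := hs.1.trans hτ.1
        have h1 := deriv_rateSq_le hreg hsol hτ0
        have h2 := deriv_energyAt_le hsol hτ0
        have h3 := mul_le_mul_of_nonneg_left (hforc φ f ρ₀ ρt hsol G hG τ hτ0).2 hcst.le
        have h4 := energyAt_nonneg P φ ρt τ
        have h5 := rateSq_nonneg ρt τ
        have h6 := forcing_nonneg φ f ρt τ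
        have h7 := Real.rpow_nonneg (hG.nonneg hτ0) (2 / P.β)
        have h8 := mul_le_mul_of_nonneg_left h1 (sub_nonneg.2 hτ.1.le)
        have h9 : (τ - s) * (rateSq ρt τ + ‖deriv (fTilde φ f) τ‖ ^ 2 + P.cst * forcing φ f ρt τ)
            ≤ rateSq ρt τ + t₀ * ‖deriv (fTilde φ f) τ‖ ^ 2 + P.cst * forcing φ f ρt τ := by
          have a1 : (τ - s) * rateSq ρt τ ≤ 1 * rateSq ρt τ :=
            mul_le_mul_of_nonneg_right (by linarith [hs.1, hτ.2]) h5
          have a2 : (τ - s) * ‖deriv (fTilde φ f) τ‖ ^ 2 ≤ t₀ * ‖deriv (fTilde φ f) τ‖ ^ 2 :=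
            mul_le_mul_of_nonneg_right (by linarith [hs.1, hτ.2]) (sq_nonneg _)
          have a3 : (τ - s) * (P.cst * forcing φ f ρt τ) ≤ 1 * (P.cst * forcing φ f ρt τ) :=
            mul_le_mul_of_nonneg_right (by linarith [hs.1, hτ.2]) (mul_nonneg hcst.le h6)
          linarith
        have h10 : t₀ * ‖deriv (fTilde φ f) τ‖ ^ 2 ≤ K * (t₀ * ‖deriv (fTilde φ f) τ‖ ^ 2) := by
          refine le_mul_of_one_le_left (by positivity) ?_
          have : 0 ≤ P.cst * D := by positivity
          linarith
        have h11 : 9 * (P.cst * (D * (c + (‖deriv φ τ‖ ^ 2 + G τ ^ (2 / P.β))))) ≤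
            K * (c + (‖deriv φ τ‖ ^ 2 + G τ ^ (2 / P.β))) := by
          have : 0 ≤ c + (‖deriv φ τ‖ ^ 2 + G τ ^ (2 / P.β)) := by positivity
          rw [hK]
          linarith
        simp only [hbdef, id]
        linarith)
    simp only [sub_self, zero_mul, zero_add] at h
    refine h.trans ?_
    gcongr
    exact hs.1.le
  have hL : Tendsto
      (fun s => ENNReal.ofReal ((t₀ - s) * rateSq ρt t₀ + 8 * energyAt P φ ρt t₀)) (𝓝[>] 0)
      (𝓝 (ENNReal.ofReal (t₀ * rateSq ρt t₀ + 8 * energyAt P φ ρt t₀))) := by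
    have : Continuous fun s => (t₀ - s) * rateSq ρt t₀ + 8 * energyAt P φ ρt t₀ := by fun_prop
    have h := (ENNReal.tendsto_ofReal (this.tendsto 0)).mono_left
      (nhdsWithin_le_nhds (s := Ioi (0 : ℝ)))
    simpa using h
  have hR : Tendsto (fun s => ENNReal.ofReal (8 * energyAt P φ ρt s + K * c)
          + ENNReal.ofReal K * ∫⁻ τ in Ioo 0 t₀, ENNReal.ofReal (b τ)) (𝓝[>] 0)
      (𝓝 (ENNReal.ofReal (8 * energyAt P φ ρt 0 + K * c)
          + ENNReal.ofReal K * ∫⁻ τ in Ioo 0 t₀, ENNReal.ofReal (b τ))) := by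
    refine Tendsto.add_const _ (ENNReal.tendsto_ofReal ?_)
    have := ((continuousOn_energyAt hreg hsol) 0 self_mem_Ici).mono_left
      (nhdsWithin_mono 0 Ioi_subset_Ici_self)
    exact (this.const_mul 8).add_const _
  have h := le_of_tendsto_of_tendsto hL hR
    (by filter_upwards [Ioo_mem_nhdsGT ht₀] with s hs using key s hs)
  refine h.trans ?_
  have h0 := energyAt_zero_le hsol
  have h1 := norm_toL2_sub_sq_le ρ₀ (φ 0)
  gcongr
  · have q1 := sq_nonneg ‖ρ₀‖
    have q2 := sq_nonneg ‖toL2 (φ 0)‖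
    have e2 : K * c ≤ K * (2 * (1 + ‖ρ₀‖ ^ 2 + ‖toL2 (φ 0)‖ ^ 2)) :=
      mul_le_mul_of_nonneg_left (by linarith) hK0.le
    have q3 := mul_nonneg ha.le q2
    linarith
  · linarith

/-- Gronwall with rate 1/4 for Z = ‖ρ̃_t‖² + 8E on [t₀, t]: the two inequalities give Z' ≤ -‖ρ̃_t‖²
- 4E + sources. The starting value comes from `exists_rateSq_initial_le` divided by t₀. -/
theorem exists_rateSq_le_boundB (hb : Bornology.IsBounded Ω) (hS : SobolevIneq P Ω) :
    ∃ C : ℝ≥0, ∀ (φ : ℝ → H1 Ω) (f : ℝ → L2 Ω) (ρ₀ : H1 Ω) (ρt : ℝ → H1 Ω),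
      IsRegularData φ f → IsWeakSolution P φ f ρ₀ ρt → ∀ t₀, 0 < t₀ → t₀ < 1 →
      ∀ G : ℝ → ℝ, IsEnvelope (Ioi 0) (gFun P φ f) G → ∀ t, t₀ ≤ t →
        ‖toL2 (deriv ρt t)‖ₑ ^ 2 ≤ C * boundB P φ f ρ₀ G t₀ t := by
  obtain ⟨D, hD, hforc⟩ := exists_forcing_le (P := P) hb hS
  obtain ⟨K, hK0, hstart⟩ := exists_rateSq_initial_le (P := P) hb hS
  have hcst := cst_pos P
  set M := 9 * (P.cst * D) + 1 with hM
  have hM0 : 0 < M := by positivity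
  refine ⟨Real.toNNReal (K + K * Real.exp (1 / 4) + M), ?_⟩
  intro φ f ρ₀ ρt hreg hsol t₀ ht₀ ht₁ G hG t ht
  set c := 1 + ‖toL2 (ρ₀ - φ 0)‖ ^ 2 with hc
  set F : ℝ → ℝ := fun s => ‖deriv (fTilde φ f) s‖ ^ 2 with hF
  set b : ℝ → ℝ := fun s => c + ‖deriv φ s‖ ^ 2 + F s + G s ^ (2 / P.β) with hbdef
  set I₁ := ∫⁻ s in Ioo 0 t₀, ENNReal.ofReal (‖deriv φ s‖ ^ 2 + G s ^ (2 / P.β)) with hI₁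
  set I₂ := ∫⁻ s in Ioo 0 t, ENNReal.ofReal (Real.exp (-(1 / 4) * (t - s)) * b s) with hI₂
  set IF := ∫⁻ s in Ioo 0 t₀, ENNReal.ofReal (F s) with hIF
  set A := 1 + ‖ρ₀‖ ^ 2 + ‖toL2 (φ 0)‖ ^ 2 with hA
  set e := Real.exp (-(1 / 4) * (t - t₀)) with he
  have he0 : 0 < e := Real.exp_pos _
  have hG0 : ∀ τ, 0 < τ → 0 ≤ G τ ^ (2 / P.β) := fun τ hτ => Real.rpow_nonneg (hG.nonneg hτ) _
  have hb0 : ∀ τ, 0 < τ → 0 ≤ b τ := fun τ hτ => by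
    have := hG0 τ hτ
    positivity
  have hbc : ContinuousOn b (Ioi 0) :=
    ((continuousOn_const.add hreg.continuousOn_deriv_φ_sq).add
      (continuousOn_deriv_fTilde_sq hreg)).add hG.continuousOn_rpow
  have hsub : Icc t₀ t ⊆ Ioi 0 := fun τ hτ => ht₀.trans_le hτ.1
  have hgr := gronwall_lintegral (y := fun τ => rateSq ρt τ + 8 * energyAt P φ ρt τ)
    (h := fun τ => M * b τ) (k := 1 / 4) ht
    (((continuousOn_rateSq hsol).mono hsub).add (continuousOn_const.mul
      ((continuousOn_energyAt hreg hsol).mono (hsub.trans Ioi_subset_Ici_self))))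
    (fun τ hτ => (hasDerivAt_rateSq hsol (ht₀.trans hτ.1)).add
      ((hasDerivAt_energyAt hreg hsol (ht₀.trans hτ.1)).const_mul 8))
    (continuousOn_const.mul (hbc.mono (Ioc_subset_Icc_self.trans hsub)))
    (fun τ hτ => mul_nonneg hM0.le (hb0 τ (ht₀.trans hτ.1)))
    (fun τ hτ => by
      have hτ0 := ht₀.trans hτ.1
      have h1 := deriv_rateSq_le hreg hsol hτ0
      have h2 := deriv_energyAt_le hsol hτ0
      have h3 := mul_le_mul_of_nonneg_left (hforc φ f ρ₀ ρt hsol G hG τ hτ0).2 hcst.le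
      have h4 := energyAt_nonneg P φ ρt τ
      have h5 := rateSq_nonneg ρt τ
      have h6 : 9 * (P.cst * (D * (c + (‖deriv φ τ‖ ^ 2 + G τ ^ (2 / P.β))))) + F τ ≤ M * b τ := by
        have q1 : 0 ≤ P.cst * D * F τ := by positivity
        have q2 : 0 ≤ c + (‖deriv φ τ‖ ^ 2 + G τ ^ (2 / P.β)) := by
          have := hG0 τ hτ0
          positivity
        simp only [hM, hbdef]
        linarith
      simp only [hF] at h6
      linarith)
  have hint := hstart φ f ρ₀ ρt hreg hsol G hG t₀ ht₀ ht₁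
  have hsplit : ∫⁻ s in Ioo 0 t₀, ENNReal.ofReal
      ((‖deriv φ s‖ ^ 2 + G s ^ (2 / P.β)) + t₀ * ‖deriv (fTilde φ f) s‖ ^ 2) =
      I₁ + ENNReal.ofReal t₀ * IF := by
    rw [hI₁, hIF, ← lintegral_const_mul' _ _ ENNReal.ofReal_ne_top, ← lintegral_add_left']
    · refine setLIntegral_congr_fun measurableSet_Ioo fun s hs => ?_
      have := hG0 s hs.1
      rw [ENNReal.ofReal_add (by positivity) (by positivity), ENNReal.ofReal_mul ht₀.le]
    · exact (((hreg.continuousOn_deriv_φ_sq.add hG.continuousOn_rpow).mono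
        (fun s hs => hs.1)).aemeasurable measurableSet_Ioo).ennreal_ofReal
  rw [hsplit] at hint
  have hZ : ENNReal.ofReal (rateSq ρt t₀ + 8 * energyAt P φ ρt t₀) ≤
      ENNReal.ofReal t₀⁻¹ * (ENNReal.ofReal (K * A) + ENNReal.ofReal K * I₁)
        + ENNReal.ofReal K * IF := by
    calc ENNReal.ofReal (rateSq ρt t₀ + 8 * energyAt P φ ρt t₀)
        ≤ ENNReal.ofReal (t₀⁻¹ * (t₀ * rateSq ρt t₀ + 8 * energyAt P φ ρt t₀)) := by
          refine ENNReal.ofReal_le_ofReal ?_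
          have h1 := energyAt_nonneg P φ ρt t₀
          have h2 : 1 ≤ t₀⁻¹ := (one_le_inv₀ ht₀).2 ht₁.le
          rw [mul_add, inv_mul_cancel_left₀ ht₀.ne']
          nlinarith
      _ ≤ ENNReal.ofReal t₀⁻¹ * (ENNReal.ofReal (K * A)
            + ENNReal.ofReal K * (I₁ + ENNReal.ofReal t₀ * IF)) := by
          rw [ENNReal.ofReal_mul (inv_nonneg.2 ht₀.le)]
          gcongr
      _ = ENNReal.ofReal t₀⁻¹ * (ENNReal.ofReal (K * A) + ENNReal.ofReal K * I₁)
          + (ENNReal.ofReal t₀⁻¹ * ENNReal.ofReal t₀) * (ENNReal.ofReal K * IF) := by ring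
      _ = _ := by
          rw [← ENNReal.ofReal_mul (inv_nonneg.2 ht₀.le), inv_mul_cancel₀ ht₀.ne',
            ENNReal.ofReal_one, one_mul]
  -- The first part of `boundB` has no ‖f̃_t‖², so its integral over (0, t₀) is moved into the
  -- second. Since t₀ - s ≤ 1, the weights differ by at most the factor e^{1/4}.
  have hIF2 : ENNReal.ofReal e * IF ≤ ENNReal.ofReal (Real.exp (1 / 4)) * I₂ := by
    rw [hIF, hI₂, ← lintegral_const_mul' _ _ ENNReal.ofReal_ne_top,
      ← lintegral_const_mul' _ _ ENNReal.ofReal_ne_top]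
    refine (setLIntegral_mono' measurableSet_Ioo fun s hs => ?_).trans
      (lintegral_mono_set (Ioo_subset_Ioo_right ht))
    rw [← ENNReal.ofReal_mul he0.le, ← ENNReal.ofReal_mul (Real.exp_pos _).le, ← mul_assoc,
      ← Real.exp_add]
    refine ENNReal.ofReal_le_ofReal (mul_le_mul (Real.exp_le_exp.2 ?_) ?_ (sq_nonneg _)
      (Real.exp_pos _).le)
    · linarith [hs.1]
    · have := hG0 s hs.1
      simp only [hbdef]
      have : 0 ≤ c := by positivity
      linarith [sq_nonneg ‖deriv φ s‖]
  have hint2 : ∫⁻ τ in Ioo t₀ t, ENNReal.ofReal (Real.exp (-(1 / 4) * (t - τ)) * (M * b τ)) ≤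
      ENNReal.ofReal M * I₂ := by
    rw [hI₂, ← lintegral_const_mul' _ _ ENNReal.ofReal_ne_top]
    refine (lintegral_mono_set (Ioo_subset_Ioo_left ht₀.le)).trans (le_of_eq ?_)
    refine lintegral_congr fun s => ?_
    rw [← ENNReal.ofReal_mul hM0.le]
    ring_nf
  have hfinal : ENNReal.ofReal (rateSq ρt t + 8 * energyAt P φ ρt t) ≤
      ENNReal.ofReal K * (ENNReal.ofReal (t₀⁻¹ * e) * (ENNReal.ofReal A + I₁))
        + (ENNReal.ofReal (K * Real.exp (1 / 4)) + ENNReal.ofReal M) * I₂ := by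
    refine hgr.trans ?_
    rw [← he, ENNReal.ofReal_mul he0.le]
    calc _ ≤ ENNReal.ofReal e * (ENNReal.ofReal t₀⁻¹ *
            (ENNReal.ofReal (K * A) + ENNReal.ofReal K * I₁) + ENNReal.ofReal K * IF)
          + ENNReal.ofReal M * I₂ := by gcongr
      _ = ENNReal.ofReal K * (ENNReal.ofReal (t₀⁻¹ * e) * (ENNReal.ofReal A + I₁))
          + ENNReal.ofReal K * (ENNReal.ofReal e * IF) + ENNReal.ofReal M * I₂ := by
          rw [ENNReal.ofReal_mul hK0.le, ENNReal.ofReal_mul (inv_nonneg.2 ht₀.le)]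
          ring
      _ ≤ ENNReal.ofReal K * (ENNReal.ofReal (t₀⁻¹ * e) * (ENNReal.ofReal A + I₁))
          + ENNReal.ofReal K * (ENNReal.ofReal (Real.exp (1 / 4)) * I₂)
          + ENNReal.ofReal M * I₂ := by gcongr
      _ = _ := by
          rw [ENNReal.ofReal_mul hK0.le]
          ring
  have hKe : 0 < K * Real.exp (1 / 4) := by positivity
  calc ‖toL2 (deriv ρt t)‖ₑ ^ 2 = ENNReal.ofReal (rateSq ρt t) := enorm_sq_eq _
    _ ≤ ENNReal.ofReal (rateSq ρt t + 8 * energyAt P φ ρt t) :=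
        ENNReal.ofReal_le_ofReal (by linarith [energyAt_nonneg P φ ρt t])
    _ ≤ _ := hfinal
    _ ≤ ENNReal.ofReal (K + K * Real.exp (1 / 4) + M) *
          (ENNReal.ofReal (t₀⁻¹ * e) * (ENNReal.ofReal A + I₁))
        + ENNReal.ofReal (K + K * Real.exp (1 / 4) + M) * I₂ := by
        rw [← ENNReal.ofReal_add hKe.le hM0.le]
        gcongr <;> linarith
    _ = _ := by
        rw [← mul_add]
        rfl

/-- The same functional ‖ρ̃_t‖² + 8E, now with decay rate 1/2, which the coefficient -4E just
permits. -/
theorem exists_limsup_rateSq_le (hb : Bornology.IsBounded Ω) (hS : SobolevIneq P Ω) :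
    ∃ C : ℝ≥0, ∀ (φ : ℝ → H1 Ω) (f : ℝ → L2 Ω) (ρ₀ : H1 Ω) (ρt : ℝ → H1 Ω),
      IsRegularData φ f → IsWeakSolution P φ f ρ₀ ρt →
        limsup (fun t => ‖toL2 (deriv ρt t)‖ₑ ^ 2) atTop ≤
          C * (1 + (limsup (fun t => ENNReal.ofReal (gFun P φ f t)) atTop) ^ (2 / P.β)
            + limsup (fun t => ‖deriv φ t‖ₑ ^ 2) atTop
            + limsup (fun t => ‖deriv (fTilde φ f) t‖ₑ ^ 2) atTop) := by
  obtain ⟨D, hforc⟩ := exists_limsup_forcing_le (P := P) hb hS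
  have hcst := cst_pos P
  refine ⟨2 + Real.toNNReal (18 * P.cst) * D, fun φ f ρ₀ ρt hreg hsol => ?_⟩
  have h := limsup_le_of_deriv_add_le (y := fun τ => rateSq ρt τ + 8 * energyAt P φ ρt τ)
    (c := 1 / 2)
    (h := fun t => 2 * ‖deriv (fTilde φ f) t‖ ^ 2 + 18 * P.cst * forcing φ f ρt t) (by norm_num)
    (fun t ht => (hasDerivAt_rateSq hsol ht).add ((hasDerivAt_energyAt hreg hsol ht).const_mul 8))
    (fun t ht => by
      have h1 := deriv_rateSq_le hreg hsol ht
      have h2 := deriv_energyAt_le hsol ht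
      have h3 := rateSq_nonneg ρt t
      linarith)
  have e : ∀ t, ENNReal.ofReal (2 * ‖deriv (fTilde φ f) t‖ ^ 2 + 18 * P.cst * forcing φ f ρt t) =
      2 * ‖deriv (fTilde φ f) t‖ₑ ^ 2
        + ENNReal.ofReal (18 * P.cst) * ENNReal.ofReal (forcing φ f ρt t) := fun t => by
    have := forcing_nonneg φ f ρt t
    rw [ENNReal.ofReal_add (by positivity) (by positivity), ENNReal.ofReal_mul (by norm_num),
      ENNReal.ofReal_mul (by positivity), enorm_sq_eq]
    norm_num
  simp only [e] at h
  have h1 : limsup (fun t => ‖toL2 (deriv ρt t)‖ₑ ^ 2) atTop ≤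
      limsup (fun t => ENNReal.ofReal (rateSq ρt t + 8 * energyAt P φ ρt t)) atTop := by
    refine limsup_mono_ennreal fun t _ => ?_
    rw [enorm_sq_eq]
    exact ENNReal.ofReal_le_ofReal (le_add_of_nonneg_right
      (mul_nonneg (by norm_num) (energyAt_nonneg P φ ρt t)))
  have h2 := hforc φ f ρ₀ ρt hsol
  have h3 := (h1.trans h).trans (limsup_add_le_ennreal _ _)
  rw [limsup_const_mul_ennreal (by simp), limsup_const_mul_ennreal ENNReal.ofReal_ne_top] at h3
  refine h3.trans ?_
  set N := limsup (fun t => ‖deriv φ t‖ₑ ^ 2) atTop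
  set L := (limsup (fun t => ENNReal.ofReal (gFun P φ f t)) atTop) ^ (2 / P.β)
  set Q := limsup (fun t => ‖deriv (fTilde φ f) t‖ₑ ^ 2) atTop
  calc _ ≤ 2 * Q + ENNReal.ofReal (18 * P.cst) * (D * (1 + N + L)) := by gcongr
    _ ≤ 2 * Q + ENNReal.ofReal (18 * P.cst) * (D * (1 + N + L))
        + (2 * (1 + N + L) + ENNReal.ofReal (18 * P.cst) * D * Q) := le_self_add
    _ = (2 + ENNReal.ofReal (18 * P.cst) * D) * (1 + L + N + Q) := by ring
    _ = _ := by
        push_cast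
        rfl

/-- For (τ - s)E + ‖ρ̃‖² the derivative of the weight produces E, which the mass inequality absorbs.
The starting value is ‖ρ̃(s)‖² alone, so no initial gradient enters. -/
theorem exists_gradNorm_le_of_one_le (hb : Bornology.IsBounded Ω) (hS : SobolevIneq P Ω) :
    ∃ C : ℝ≥0, ∀ (φ : ℝ → H1 Ω) (f : ℝ → L2 Ω) (ρ₀ : H1 Ω) (ρt : ℝ → H1 Ω),
      IsRegularData φ f → IsWeakSolution P φ f ρ₀ ρt →
      ∀ G : ℝ → ℝ, IsEnvelope (Ioi 0) (gFun P φ f) G → ∀ t, 1 ≤ t →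
        gradNorm P.β (ρt t + φ t) ^ P.β ≤
          C * (ENNReal.ofReal (1 + ‖toL2 (ρ₀ - φ 0)‖ ^ 2 + G t ^ (2 / P.β))
            + ∫⁻ s in Ioo (t - 1) t, ‖deriv φ s‖ₑ ^ 2) := by
  obtain ⟨D, hD, hforc⟩ := exists_forcing_le (P := P) hb hS
  obtain ⟨R, hR, hgrad⟩ := exists_gradNorm_rpow_le (Ω := Ω) hb P one_pos
  have hcst := cst_pos P
  set K := 2 * (P.cst * D) with hK
  have hK0 : 0 < K := by positivity
  refine ⟨Real.toNNReal (1 + R * 2 * (D + K)), ?_⟩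
  intro φ f ρ₀ ρt hreg hsol G hG t ht
  set c := 1 + ‖toL2 (ρ₀ - φ 0)‖ ^ 2 + G t ^ (2 / P.β) with hc
  have hGt := Real.rpow_nonneg (hG.nonneg (one_pos.trans_le ht)) (2 / P.β)
  have hc1 : 1 ≤ c := by linarith [sq_nonneg ‖toL2 (ρ₀ - φ 0)‖]
  have hGmono : ∀ τ, 0 < τ → τ ≤ t → G τ ^ (2 / P.β) ≤ G t ^ (2 / P.β) := fun τ hτ hτt =>
    Real.rpow_le_rpow (hG.nonneg hτ) (hG.monotoneOn hτ (hτ.trans_le hτt) hτt)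
      (zero_le_one.trans P.one_le_two_div_β)
  -- A window of length 1/2 rather than 1 keeps s > 0 even for t = 1.
  set s := t - 1 / 2 with hs
  have hs0 : 0 < s := by linarith
  have hst : s ≤ t := by linarith
  have hsub : Icc s t ⊆ Ioi 0 := fun τ hτ => hs0.trans_le hτ.1
  have h := ofReal_le_add_lintegral_const
    (y := fun τ => (τ - s) * energyAt P φ ρt τ + massSq ρt τ)
    (b := fun τ => ‖deriv φ τ‖ ^ 2) (K := K) (c := c) hst (by linarith) hK0.le
    (zero_le_one.trans hc1)
    (by
      have := massSq_nonneg ρt s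
      simpa using this)
    (((continuousOn_id.sub continuousOn_const).mul
      ((continuousOn_energyAt hreg hsol).mono (hsub.trans Ioi_subset_Ici_self))).add
      ((continuousOn_massSq hsol).mono (hsub.trans Ioi_subset_Ici_self)))
    (fun τ hτ => (((hasDerivAt_id τ).sub_const s).mul
        (hasDerivAt_energyAt hreg hsol (hs0.trans hτ.1))).add
      (hasDerivAt_massSq hsol (hs0.trans hτ.1)))
    (hreg.continuousOn_deriv_φ_sq.mono (Ioc_subset_Icc_self.trans hsub))
    (fun τ _ => sq_nonneg _)
    (fun τ hτ => by
      have hτ0 := hs0.trans hτ.1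
      have h1 := deriv_massSq_add_energyAt_le_forcing hsol hτ0
      have h2 := deriv_energyAt_le hsol hτ0
      have h3 := mul_le_mul_of_nonneg_left (hforc φ f ρ₀ ρt hsol G hG τ hτ0).2 hcst.le
      have h4 := energyAt_nonneg P φ ρt τ
      have h5 := rateSq_nonneg ρt τ
      have h6 := mul_nonneg hcst.le (forcing_nonneg φ f ρt τ)
      have h7 : (τ - s) * inner ℝ (P.fluxOp (grad (ρt τ + φ τ))) (grad (deriv ρt τ + deriv φ τ))
          ≤ P.cst * forcing φ f ρt τ := by
        have a1 := mul_le_mul_of_nonneg_left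
          (show inner ℝ (P.fluxOp (grad (ρt τ + φ τ))) (grad (deriv ρt τ + deriv φ τ))
            ≤ P.cst * forcing φ f ρt τ by linarith) (sub_nonneg.2 hτ.1.le)
        have a2 : (τ - s) * (P.cst * forcing φ f ρt τ) ≤ 1 * (P.cst * forcing φ f ρt τ) :=
          mul_le_mul_of_nonneg_right (by linarith [hτ.2]) h6
        linarith
      have h8 : P.cst * (D * (1 + ‖toL2 (ρ₀ - φ 0)‖ ^ 2 + (‖deriv φ τ‖ ^ 2 + G τ ^ (2 / P.β))))
          ≤ P.cst * (D * (c + ‖deriv φ τ‖ ^ 2)) := by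
        have := hGmono τ hτ0 hτ.2.le
        exact mul_le_mul_of_nonneg_left (mul_le_mul_of_nonneg_left (by linarith) hD.le) hcst.le
      rw [hK]
      simp only [id]
      linarith)
  simp only [sub_self, zero_mul, zero_add] at h
  have hts : t - s = 1 / 2 := by rw [hs]; ring
  have hint : ∫⁻ τ in Ioo s t, ENNReal.ofReal (‖deriv φ τ‖ ^ 2) ≤
      ∫⁻ τ in Ioo (t - 1) t, ‖deriv φ τ‖ₑ ^ 2 := by
    simp only [enorm_sq_eq]
    exact lintegral_mono_set (Ioo_subset_Ioo_left (by linarith))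
  have hmass : massSq ρt s ≤ D * c := by
    refine (hforc φ f ρ₀ ρt hsol G hG s hs0).1.trans (mul_le_mul_of_nonneg_left ?_ hD.le)
    have := hGmono s hs0 hst
    linarith
  have h' : ENNReal.ofReal (1 / 2 * energyAt P φ ρt t) ≤ ENNReal.ofReal ((D + K) * c)
      + ENNReal.ofReal K * ∫⁻ τ in Ioo (t - 1) t, ‖deriv φ τ‖ₑ ^ 2 := by
    calc ENNReal.ofReal (1 / 2 * energyAt P φ ρt t)
        ≤ ENNReal.ofReal ((t - s) * energyAt P φ ρt t + massSq ρt t) := by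
          rw [hts]
          exact ENNReal.ofReal_le_ofReal (le_add_of_nonneg_right (massSq_nonneg ρt t))
      _ ≤ _ := h
      _ ≤ _ := by
          gcongr
          linarith
  have hgr := hgrad φ ρt t
  have e : 1 + R * energyAt P φ ρt t = 1 * (1 + R * 2 * (1 / 2 * energyAt P φ ρt t)) := by ring
  rw [e] at hgr
  refine hgr.trans (ofReal_affine_le (by positivity) zero_le_one (by positivity) h' ?_
    (by positivity) ?_)
  · linarith
  · have : 0 < R * 2 * D := by positivity
    linarith

/-- With σ = τ - s, the functional σ²‖ρ̃_t‖² + 12(σE + ‖ρ̃‖²) again starts from ‖ρ̃(s)‖² alone. The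
first term produces at most 3σ‖ρ̃_t‖² (2σ from the weight, σ² ≤ σ from the rate inequality), and 12
· 1/4 absorbs it. -/
theorem exists_rateSq_le_of_one_le (hb : Bornology.IsBounded Ω) (hS : SobolevIneq P Ω) :
    ∃ C : ℝ≥0, ∀ (φ : ℝ → H1 Ω) (f : ℝ → L2 Ω) (ρ₀ : H1 Ω) (ρt : ℝ → H1 Ω),
      IsRegularData φ f → IsWeakSolution P φ f ρ₀ ρt →
      ∀ G : ℝ → ℝ, IsEnvelope (Ioi 0) (gFun P φ f) G → ∀ t, 1 ≤ t →
        ‖toL2 (deriv ρt t)‖ₑ ^ 2 ≤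
          C * (ENNReal.ofReal (1 + ‖toL2 (ρ₀ - φ 0)‖ ^ 2 + G t ^ (2 / P.β))
            + ∫⁻ s in Ioo (t - 1) t, (‖deriv φ s‖ₑ ^ 2 + ‖deriv (fTilde φ f) s‖ₑ ^ 2)) := by
  obtain ⟨D, hD, hforc⟩ := exists_forcing_le (P := P) hb hS
  have hcst := cst_pos P
  -- 25 = 1 + 12 + 12 forcing terms, from the rate, energy and mass inequalities; the 1 covers
  -- ‖f̃_t‖².
  set K := 25 * (P.cst * D) + 1 with hK
  have hK0 : 0 < K := by positivity
  refine ⟨Real.toNNReal (4 * (12 * D + K)), ?_⟩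
  intro φ f ρ₀ ρt hreg hsol G hG t ht
  set c := 1 + ‖toL2 (ρ₀ - φ 0)‖ ^ 2 + G t ^ (2 / P.β) with hc
  have hGt := Real.rpow_nonneg (hG.nonneg (one_pos.trans_le ht)) (2 / P.β)
  have hc1 : 1 ≤ c := by linarith [sq_nonneg ‖toL2 (ρ₀ - φ 0)‖]
  have hGmono : ∀ τ, 0 < τ → τ ≤ t → G τ ^ (2 / P.β) ≤ G t ^ (2 / P.β) := fun τ hτ hτt =>
    Real.rpow_le_rpow (hG.nonneg hτ) (hG.monotoneOn hτ (hτ.trans_le hτt) hτt)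
      (zero_le_one.trans P.one_le_two_div_β)
  set s := t - 1 / 2 with hs
  have hs0 : 0 < s := by linarith
  have hst : s ≤ t := by linarith
  have hsub : Icc s t ⊆ Ioi 0 := fun τ hτ => hs0.trans_le hτ.1
  have h := ofReal_le_add_lintegral_const
    (y := fun τ => (τ - s) ^ 2 * rateSq ρt τ
      + 12 * ((τ - s) * energyAt P φ ρt τ + massSq ρt τ))
    (b := fun τ => ‖deriv φ τ‖ ^ 2 + ‖deriv (fTilde φ f) τ‖ ^ 2) (K := K) (c := c) hst
    (by linarith) hK0.le (zero_le_one.trans hc1)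
    (by
      have := massSq_nonneg ρt s
      simpa using this)
    ((((continuousOn_id.sub continuousOn_const).pow 2).mul
      ((continuousOn_rateSq hsol).mono hsub)).add (continuousOn_const.mul
      (((continuousOn_id.sub continuousOn_const).mul
      ((continuousOn_energyAt hreg hsol).mono (hsub.trans Ioi_subset_Ici_self))).add
      ((continuousOn_massSq hsol).mono (hsub.trans Ioi_subset_Ici_self)))))
    (fun τ hτ => ((((hasDerivAt_id τ).sub_const s).pow 2).mul
        (hasDerivAt_rateSq hsol (hs0.trans hτ.1))).add (((((hasDerivAt_id τ).sub_const s).mul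
        (hasDerivAt_energyAt hreg hsol (hs0.trans hτ.1))).add
      (hasDerivAt_massSq hsol (hs0.trans hτ.1))).const_mul 12))
    ((hreg.continuousOn_deriv_φ_sq.add (continuousOn_deriv_fTilde_sq hreg)).mono
      (Ioc_subset_Icc_self.trans hsub))
    (fun τ _ => add_nonneg (sq_nonneg _) (sq_nonneg _))
    (fun τ hτ => by
      have hτ0 := hs0.trans hτ.1
      have h1 := deriv_massSq_add_energyAt_le_forcing hsol hτ0
      have h2 := deriv_energyAt_le hsol hτ0
      have h2' := deriv_rateSq_le hreg hsol hτ0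
      have h3 := mul_le_mul_of_nonneg_left (hforc φ f ρ₀ ρt hsol G hG τ hτ0).2 hcst.le
      have h4 := energyAt_nonneg P φ ρt τ
      have h5 := rateSq_nonneg ρt τ
      have h6 := mul_nonneg hcst.le (forcing_nonneg φ f ρt τ)
      have hσ0 : 0 ≤ τ - s := sub_nonneg.2 hτ.1.le
      have hσ1 : τ - s ≤ 1 := by linarith [hτ.2]
      have hσ2 : (τ - s) ^ 2 ≤ τ - s := by nlinarith
      set σ := τ - s with hσ
      have h7 : σ * inner ℝ (P.fluxOp (grad (ρt τ + φ τ))) (grad (deriv ρt τ + deriv φ τ))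
          ≤ P.cst * forcing φ f ρt τ - 1 / 4 * (σ * rateSq ρt τ) := by
        have a1 := mul_le_mul_of_nonneg_left
          (show inner ℝ (P.fluxOp (grad (ρt τ + φ τ))) (grad (deriv ρt τ + deriv φ τ))
            ≤ P.cst * forcing φ f ρt τ - 1 / 4 * rateSq ρt τ by linarith) hσ0
        have a2 : σ * (P.cst * forcing φ f ρt τ) ≤ 1 * (P.cst * forcing φ f ρt τ) :=
          mul_le_mul_of_nonneg_right hσ1 h6
        linarith
      have h9 : σ ^ 2 * (2 * inner ℝ (toL2 (deriv ρt τ))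
            (deriv (fun s => toL2 (deriv ρt s)) τ)) ≤
          σ * rateSq ρt τ + ‖deriv (fTilde φ f) τ‖ ^ 2 + P.cst * forcing φ f ρt τ := by
        have a1 := mul_le_mul_of_nonneg_left h2' (sq_nonneg σ)
        have a2 : σ ^ 2 * rateSq ρt τ ≤ σ * rateSq ρt τ := mul_le_mul_of_nonneg_right hσ2 h5
        have a3 : σ ^ 2 * ‖deriv (fTilde φ f) τ‖ ^ 2 ≤ 1 * ‖deriv (fTilde φ f) τ‖ ^ 2 :=
          mul_le_mul_of_nonneg_right (hσ2.trans hσ1) (sq_nonneg _)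
        have a4 : σ ^ 2 * (P.cst * forcing φ f ρt τ) ≤ 1 * (P.cst * forcing φ f ρt τ) :=
          mul_le_mul_of_nonneg_right (hσ2.trans hσ1) h6
        linarith
      have h8 : P.cst * (D * (1 + ‖toL2 (ρ₀ - φ 0)‖ ^ 2 + (‖deriv φ τ‖ ^ 2 + G τ ^ (2 / P.β))))
          ≤ P.cst * (D * (c + ‖deriv φ τ‖ ^ 2)) := by
        have := hGmono τ hτ0 hτ.2.le
        exact mul_le_mul_of_nonneg_left (mul_le_mul_of_nonneg_left (by linarith) hD.le) hcst.le
      have h10 : 0 ≤ P.cst * D * ‖deriv (fTilde φ f) τ‖ ^ 2 := by positivity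
      have h11 := sq_nonneg ‖deriv φ τ‖
      rw [hK]
      simp only [id, Pi.pow_apply, ← hσ, Nat.cast_ofNat, Nat.add_one_sub_one, pow_one]
      linarith)
  simp only [sub_self, zero_mul, zero_add, ne_eq, OfNat.ofNat_ne_zero, not_false_eq_true,
    zero_pow] at h
  have hts : t - s = 1 / 2 := by rw [hs]; ring
  set I := ∫⁻ τ in Ioo (t - 1) t, (‖deriv φ τ‖ₑ ^ 2 + ‖deriv (fTilde φ f) τ‖ₑ ^ 2) with hI
  have hint : ∫⁻ τ in Ioo s t, ENNReal.ofReal (‖deriv φ τ‖ ^ 2 + ‖deriv (fTilde φ f) τ‖ ^ 2) ≤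
      I := by
    simp only [hI, enorm_sq_eq, ← ENNReal.ofReal_add (sq_nonneg _) (sq_nonneg _)]
    exact lintegral_mono_set (Ioo_subset_Ioo_left (by linarith))
  have hmass : massSq ρt s ≤ D * c := by
    refine (hforc φ f ρ₀ ρt hsol G hG s hs0).1.trans (mul_le_mul_of_nonneg_left ?_ hD.le)
    have := hGmono s hs0 hst
    linarith
  have h' : ENNReal.ofReal (1 / 4 * rateSq ρt t) ≤ ENNReal.ofReal ((12 * D + K) * c)
      + ENNReal.ofReal (12 * D + K) * I := by
    calc ENNReal.ofReal (1 / 4 * rateSq ρt t)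
        ≤ ENNReal.ofReal ((t - s) ^ 2 * rateSq ρt t
          + 12 * ((t - s) * energyAt P φ ρt t + massSq ρt t)) := by
          rw [hts]
          refine ENNReal.ofReal_le_ofReal ?_
          have := massSq_nonneg ρt t
          have := energyAt_nonneg P φ ρt t
          linarith
      _ ≤ _ := h
      _ ≤ _ := by
          gcongr
          · linarith
          · linarith
  calc ‖toL2 (deriv ρt t)‖ₑ ^ 2 = ENNReal.ofReal 4 * ENNReal.ofReal (1 / 4 * rateSq ρt t) := by
        rw [enorm_sq_eq, ← ENNReal.ofReal_mul (by norm_num), rateSq]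
        ring_nf
    _ ≤ ENNReal.ofReal 4 * (ENNReal.ofReal ((12 * D + K) * c)
          + ENNReal.ofReal (12 * D + K) * I) := by gcongr
    _ = ENNReal.ofReal (4 * (12 * D + K)) * (ENNReal.ofReal c + I) := by
        rw [ENNReal.ofReal_mul (by positivity), ENNReal.ofReal_mul (by norm_num)]
        ring
    _ = _ := rfl

end Rate

end Forchheimer

end

/-! ### Assembly of the estimates with one common constant. -/

theorem theorem4p6 (d : ℕ) (hd : 2 ≤ d) (Ω : Set (EuclideanSpace ℝ (Fin d)))
    (hΩ_open : IsOpen Ω) (hΩ_bdd : Bornology.IsBounded Ω)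
    (P : Forchheimer.GenPoly) (hdeg : P.a ≤ 4 / ((d : ℝ) + 2)) :
    ∃ C : ℝ≥0, 0 < C ∧
      ∀ (φ : ℝ → Forchheimer.H1 Ω) (f : ℝ → Forchheimer.L2 Ω) (ρ₀ : Forchheimer.H1 Ω)
        (ρt : ℝ → Forchheimer.H1 Ω),
        Forchheimer.IsRegularData φ f → Forchheimer.IsWeakSolution P φ f ρ₀ ρt →
        -- bounds of the solution
        (∀ G : ℝ → ℝ, Forchheimer.IsEnvelope (Ioi 0) (Forchheimer.gFun P φ f) G →
          ∀ t : ℝ, 0 < t →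
            ‖Forchheimer.toL2 (ρt t)‖
              ≤ C * (1 + ‖Forchheimer.toL2 ρ₀‖ + G t ^ (1 / P.β))) ∧
        limsup (fun t => ‖Forchheimer.toL2 (ρt t)‖ₑ ^ 2) atTop
          ≤ C * (1 + limsup (fun t => ENNReal.ofReal (Forchheimer.gFun P φ f t)) atTop)
              ^ (2 / P.β) ∧
        (limsup (fun t => ‖Forchheimer.fTilde φ f t‖ₑ) atTop = 0 →
          limsup (fun t => ‖φ t‖ₑ) atTop = 0 →
          limsup (fun t => ‖Forchheimer.toL2 (ρt t)‖ₑ ^ 2) atTop = 0) ∧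
        -- bounds of the gradient
        (∀ G : ℝ → ℝ, Forchheimer.IsEnvelope (Ioi 0) (Forchheimer.gFun P φ f) G →
          ∀ t : ℝ, 0 < t →
            Forchheimer.gradNorm P.β (ρt t + φ t) ^ P.β
              ≤ C * Forchheimer.boundA P φ ρ₀ G t) ∧
        limsup (fun t => Forchheimer.gradNorm P.β (ρt t + φ t) ^ P.β) atTop
          ≤ C * (1 + limsup (fun t => ‖deriv φ t‖ₑ ^ 2) atTop
              + (limsup (fun t => ENNReal.ofReal (Forchheimer.gFun P φ f t)) atTop)
                  ^ (2 / P.β)) ∧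
        (limsup (fun t => ‖Forchheimer.fTilde φ f t‖ₑ) atTop = 0 →
          limsup (fun t => ‖φ t‖ₑ) atTop = 0 →
          limsup (fun t => ‖deriv φ t‖ₑ) atTop = 0 →
          limsup (fun t => Forchheimer.gradNorm P.β (ρt t + φ t)) atTop = 0) ∧
        -- bounds of the time derivative
        (∀ t₀ : ℝ, 0 < t₀ → t₀ < 1 →
          ∀ G : ℝ → ℝ, Forchheimer.IsEnvelope (Ioi 0) (Forchheimer.gFun P φ f) G →
          ∀ t : ℝ, t₀ ≤ t →
            ‖Forchheimer.toL2 (deriv ρt t)‖ₑ ^ 2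
              ≤ C * Forchheimer.boundB P φ f ρ₀ G t₀ t) ∧
        limsup (fun t => ‖Forchheimer.toL2 (deriv ρt t)‖ₑ ^ 2) atTop
          ≤ C * (1 + (limsup (fun t => ENNReal.ofReal (Forchheimer.gFun P φ f t)) atTop)
                  ^ (2 / P.β)
              + limsup (fun t => ‖deriv φ t‖ₑ ^ 2) atTop
              + limsup (fun t => ‖deriv (Forchheimer.fTilde φ f) t‖ₑ ^ 2) atTop) ∧
        -- uniform bounds for `t ≥ 1`
        (∀ G : ℝ → ℝ, Forchheimer.IsEnvelope (Ioi 0) (Forchheimer.gFun P φ f) G →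
          ∀ t : ℝ, 1 ≤ t →
            Forchheimer.gradNorm P.β (ρt t + φ t) ^ P.β
              ≤ C * (ENNReal.ofReal
                    (1 + ‖Forchheimer.toL2 (ρ₀ - φ 0)‖ ^ 2 + G t ^ (2 / P.β))
                  + ∫⁻ s in Ioo (t - 1) t, ‖deriv φ s‖ₑ ^ 2) ∧
            ‖Forchheimer.toL2 (deriv ρt t)‖ₑ ^ 2
              ≤ C * (ENNReal.ofReal
                    (1 + ‖Forchheimer.toL2 (ρ₀ - φ 0)‖ ^ 2 + G t ^ (2 / P.β))
                  + ∫⁻ s in Ioo (t - 1) t,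
                      (‖deriv φ s‖ₑ ^ 2 + ‖deriv (Forchheimer.fTilde φ f) s‖ₑ ^ 2))) := by
  have hS : Forchheimer.SobolevIneq P Ω := Forchheimer.exists_sobolev hd hΩ_open hΩ_bdd P hdeg
  obtain ⟨C₁, h₁⟩ := Forchheimer.exists_norm_le hΩ_bdd hS
  obtain ⟨C₂, h₂⟩ := Forchheimer.exists_limsup_norm_sq_le hΩ_bdd hS
  obtain ⟨C₃, h₃⟩ := Forchheimer.exists_gradNorm_le_boundA hΩ_bdd hS
  obtain ⟨C₄, h₄⟩ := Forchheimer.exists_limsup_gradNorm_le hΩ_bdd hS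
  obtain ⟨C₅, h₅⟩ := Forchheimer.exists_rateSq_le_boundB hΩ_bdd hS
  obtain ⟨C₆, h₆⟩ := Forchheimer.exists_limsup_rateSq_le hΩ_bdd hS
  obtain ⟨C₇, h₇⟩ := Forchheimer.exists_gradNorm_le_of_one_le hΩ_bdd hS
  obtain ⟨C₈, h₈⟩ := Forchheimer.exists_rateSq_le_of_one_le hΩ_bdd hS
  -- The sum dominates each constant, and the added 1 makes the result positive.
  have hle : ∀ i, (![C₁, C₂, C₃, C₄, C₅, C₆, C₇, C₈] : Fin 8 → ℝ≥0) i ≤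
      1 + ∑ j, (![C₁, C₂, C₃, C₄, C₅, C₆, C₇, C₈] : Fin 8 → ℝ≥0) j := fun i =>
    le_add_left (Finset.single_le_sum (fun _ _ => zero_le) (Finset.mem_univ i))
  set C := 1 + ∑ j, (![C₁, C₂, C₃, C₄, C₅, C₆, C₇, C₈] : Fin 8 → ℝ≥0) j
  have hC₁ : C₁ ≤ C := hle 0
  have hC₂ : C₂ ≤ C := hle 1
  have hC₃ : C₃ ≤ C := hle 2
  have hC₄ : C₄ ≤ C := hle 3
  have hC₅ : C₅ ≤ C := hle 4
  have hC₆ : C₆ ≤ C := hle 5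
  have hC₇ : C₇ ≤ C := hle 6
  have hC₈ : C₈ ≤ C := hle 7
  have up : ∀ {D : ℝ≥0} {x y : ℝ≥0∞}, D ≤ C → x ≤ D * y → x ≤ C * y := fun hD hx =>
    hx.trans (mul_le_mul_left (ENNReal.coe_le_coe.2 hD) _)
  refine ⟨C, by positivity, fun φ f ρ₀ ρt hreg hsol => ⟨fun G hG t ht => ?_,
    up hC₂ (h₂ φ f ρ₀ ρt hsol),
    fun hf hφ => Forchheimer.limsup_norm_sq_eq_zero hΩ_bdd hS hsol hf hφ,
    fun G hG t ht => up hC₃ (h₃ φ f ρ₀ ρt hreg hsol G hG t ht),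
    up hC₄ (h₄ φ f ρ₀ ρt hreg hsol),
    fun hf hφ hφ' => Forchheimer.limsup_gradNorm_eq_zero hΩ_bdd hS hreg hsol hf hφ hφ',
    fun t₀ h0 h1 G hG t ht => up hC₅ (h₅ φ f ρ₀ ρt hreg hsol t₀ h0 h1 G hG t ht),
    up hC₆ (h₆ φ f ρ₀ ρt hreg hsol),
    fun G hG t ht => ⟨up hC₇ (h₇ φ f ρ₀ ρt hreg hsol G hG t ht),
      up hC₈ (h₈ φ f ρ₀ ρt hreg hsol G hG t ht)⟩⟩⟩
  refine (h₁ φ f ρ₀ ρt hreg hsol G hG t ht).trans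
    (mul_le_mul_of_nonneg_right (NNReal.coe_le_coe.2 hC₁) ?_)
  have := Real.rpow_nonneg (hG.nonneg ht) (1 / P.β)
  positivity
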